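/- Let $S=S[1]S[2]\cdots S[n]$ be a stream of $n\ge 1$ natural numbers. $S$ contains a palindrome of length $\ell$ (an even palindrome with arms of length $\ell$) with midpoint $m$ if $\ell\le m\le n-\ell$ and $S[m-i+1]=S[m+i]$ for all $1\le i\le \ell$; for $1\le m\le n$ let $\ell(m)\ge 0$ be the largest such $\ell$. The machine is a randomized one-pass streaming word RAM: it has registers and a random access memory of words of $O(\log n)$ bits, unit-cost arithmetic and comparisons on words, a source of uniformly random words, an input stream that is read once from left to right, and a write-only output stream; space is the number of words of workspace (the output is not counted), time is the number of elementary steps. Theorem. For every constant $a$ there are a machine program of this kind and a constant $C$ such that for all $n\ge1$, all real $\varepsilon\in[1/\sqrt n,1]$ and all streams $S$ of length $n$ with symbols at most $(n+1)^a$, the program, started with $n$ and the spacing $\lfloor\varepsilon\sqrt n\rfloor$ as parameters, makes one pass over $S$ and reports for every midpoint $m\in\{1,\dots,n\}$ exactly one pair $(m,\tilde\ell(m))$, in at most $C\,n/\varepsilon$ time and at most $C\,\sqrt n/\varepsilon$ space for every outcome of the random words. With probability at least $1-1/n$, all the estimates satisfy $$\ell(m)-\varepsilon\sqrt n<\tilde\ell(m)\le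 \ell(m).$$ -/

import Mathlib

namespace PalStream

/-! ### Even palindromes -/

/-- The symbol `S[i]` of the stream `S = S[1] S[2] ⋯ S[n]` (indices start at `1`). -/
def symbol (S : List ℕ) (i : ℕ) : ℕ := S.getD (i - 1) 0

/-- `S` contains an (even) palindrome of length `l` with midpoint `m`: `l ≤ m ≤ n - l` and
`S[m - i + 1] = S[m + i]` for all `i ∈ {1, …, l}`. -/
def IsPalindromeAt (S : List ℕ) (m l : ℕ) : Prop :=
  l ≤ m ∧ m + l ≤ S.length ∧ ∀ i, 1 ≤ i → i ≤ l → symbol S (m - i + 1) = symbol S (m + i)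

/-- `ℓ(m)`, the maximal length of a palindrome of `S` with midpoint `m`. The set is never empty
(it contains `0`) and is bounded by `m`, so the supremum is a maximum. -/
noncomputable def palLength (S : List ℕ) (m : ℕ) : ℕ := sSup {l | IsPalindromeAt S m l}

/-! ### A randomized one-pass streaming word RAM

A program is a fixed finite command. It has `r` registers, a random access memory (a word in every
cell, initially `0`), a read-only input stream which can only be read forwards and only once,
a source of uniformly random words, and a write-only output stream. All numbers that the machine
handles are words, that is, natural numbers less than `W`. -/

/-- The binary word operations. -/
inductive Op where
  | add | sub | mul | div | mod | lt | eq

/-- Value of an operation on words: sums and products are reduced modulo the number `W` of words,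
subtraction is truncated at `0`, comparisons give `1` or `0`. -/
def Op.eval (W : ℕ) : Op → ℕ → ℕ → ℕ
  | .add, a, b => (a + b) % W
  | .sub, a, b => a - b
  | .mul, a, b => (a * b) % W
  | .div, a, b => a / b
  | .mod, a, b => a % b
  | .lt, a, b => if a < b then 1 else 0
  | .eq, a, b => if a = b then 1 else 0

/-- Arithmetic expressions over `r` registers. -/
inductive Expr (r : ℕ) where
  | const (c : ℕ)
  | reg (x : Fin r)
  | bin (o : Op) (e₁ e₂ : Expr r)

/-- Value of an expression. -/
def Expr.eval {r : ℕ} (W : ℕ) (ρ : Fin r → ℕ) : Expr r → ℕ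
  | .const c => c % W
  | .reg x => ρ x
  | .bin o e₁ e₂ => o.eval W (e₁.eval W ρ) (e₂.eval W ρ)

/-- Time for evaluating an expression: one step for every constant, register and operation. -/
def Expr.cost {r : ℕ} : Expr r → ℕ
  | .const _ => 1
  | .reg _ => 1
  | .bin _ e₁ e₂ => 1 + e₁.cost + e₂.cost

/-- Programs with `r` registers. -/
inductive Cmd (r : ℕ) where
  /-- do nothing -/
  | skip
  /-- `x := e` -/
  | assign (x : Fin r) (e : Expr r)
  /-- `x := memory[e]` -/
  | load (x : Fin r) (e : Expr r)
  /-- `memory[e₁] := e₂` -/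
  | store (e₁ e₂ : Expr r)
  /-- `x :=` next symbol of the input stream -/
  | read (x : Fin r)
  /-- `x :=` fresh uniformly random word -/
  | rand (x : Fin r)
  /-- append the pair `(e₁, e₂)` to the output -/
  | emit (e₁ e₂ : Expr r)
  | seq (c₁ c₂ : Cmd r)
  /-- run `c₁` if `e ≠ 0`, and `c₂` otherwise -/
  | ite (e : Expr r) (c₁ c₂ : Cmd r)
  /-- run `c` as long as `e ≠ 0` -/
  | loop (e : Expr r) (c : Cmd r)

/-- Configurations of a machine with `r` registers. -/
structure State (r : ℕ) where
  /-- contents of the registers -/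
  reg : Fin r → ℕ
  /-- contents of the memory -/
  mem : ℕ → ℕ
  /-- number of memory cells in use: all addresses accessed so far are less than `cells` -/
  cells : ℕ
  /-- number of input symbols read so far -/
  pos : ℕ
  /-- number of random words drawn so far -/
  drawn : ℕ
  /-- output written so far -/
  out : List (ℕ × ℕ)

/-- The start: two registers hold the parameters `n` and `d`, everything else is `0`. -/
def State.init (r n d : ℕ) : State r where
  reg x := if x.val = 0 then n else if x.val = 1 then d else 0
  mem _ := 0
  cells := 0
  pos := 0
  drawn := 0
  out := []

/-- Number of words of workspace: registers and memory cells. The output is not counted. -/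
def State.space {r : ℕ} (s : State r) : ℕ := r + s.cells

/-- `Exec W S ω c s t s'`: with `W` words, input stream `S` and random words `ω 0, ω 1, …`, the
command `c` started in `s` halts after `t` steps in `s'`. After the end of the stream a read
gives `0`. -/
inductive Exec {r : ℕ} (W : ℕ) (S : List ℕ) (ω : ℕ → ℕ) :
    Cmd r → State r → ℕ → State r → Prop where
  | skip (s : State r) : Exec W S ω .skip s 1 s
  | assign (s : State r) (x : Fin r) (e : Expr r) :
      Exec W S ω (.assign x e) s (1 + e.cost)
        { s with reg := Function.update s.reg x (e.eval W s.reg) }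
  | load (s : State r) (x : Fin r) (e : Expr r) :
      Exec W S ω (.load x e) s (1 + e.cost)
        { s with
          reg := Function.update s.reg x (s.mem (e.eval W s.reg))
          cells := max s.cells (e.eval W s.reg + 1) }
  | store (s : State r) (e₁ e₂ : Expr r) :
      Exec W S ω (.store e₁ e₂) s (1 + e₁.cost + e₂.cost)
        { s with
          mem := Function.update s.mem (e₁.eval W s.reg) (e₂.eval W s.reg)
          cells := max s.cells (e₁.eval W s.reg + 1) }
  | read (s : State r) (x : Fin r) :
      Exec W S ω (.read x) s 1
        { s with
          reg := Function.update s.reg x (S.getD s.pos 0 % W)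
          pos := s.pos + 1 }
  | rand (s : State r) (x : Fin r) :
      Exec W S ω (.rand x) s 1
        { s with
          reg := Function.update s.reg x (ω s.drawn)
          drawn := s.drawn + 1 }
  | emit (s : State r) (e₁ e₂ : Expr r) :
      Exec W S ω (.emit e₁ e₂) s (1 + e₁.cost + e₂.cost)
        { s with out := s.out ++ [(e₁.eval W s.reg, e₂.eval W s.reg)] }
  | seq {s s' s'' : State r} {c₁ c₂ : Cmd r} {t₁ t₂ : ℕ} :
      Exec W S ω c₁ s t₁ s' → Exec W S ω c₂ s' t₂ s'' →
      Exec W S ω (.seq c₁ c₂) s (t₁ + t₂) s''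
  | ite_true {s s' : State r} {e : Expr r} {c₁ c₂ : Cmd r} {t : ℕ} :
      e.eval W s.reg ≠ 0 → Exec W S ω c₁ s t s' →
      Exec W S ω (.ite e c₁ c₂) s (1 + e.cost + t) s'
  | ite_false {s s' : State r} {e : Expr r} {c₁ c₂ : Cmd r} {t : ℕ} :
      e.eval W s.reg = 0 → Exec W S ω c₂ s t s' →
      Exec W S ω (.ite e c₁ c₂) s (1 + e.cost + t) s'
  | loop_true {s s' s'' : State r} {e : Expr r} {c : Cmd r} {t₁ t₂ : ℕ} :
      e.eval W s.reg ≠ 0 → Exec W S ω c s t₁ s' → Exec W S ω (.loop e c) s' t₂ s'' →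
      Exec W S ω (.loop e c) s (1 + e.cost + t₁ + t₂) s''
  | loop_false {s : State r} {e : Expr r} {c : Cmd r} :
      e.eval W s.reg = 0 → Exec W S ω (.loop e c) s (1 + e.cost) s

/-- The number of words if a word has `k · (number of binary digits of n)` bits. -/
def numWords (k n : ℕ) : ℕ := 2 ^ (k * Nat.size n)

/-- Sequences of random words. -/
abbrev Coins (k n : ℕ) : Type := ℕ → Fin (numWords k n)

/-- There is at least one word. -/
instance instNonemptyWord (k n : ℕ) : Nonempty (Fin (numWords k n)) :=
  ⟨⟨0, Nat.pow_pos Nat.two_pos⟩⟩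

/-- The law of a sequence of independent uniformly distributed random words. -/
noncomputable def coinMeasure (k n : ℕ) : MeasureTheory.Measure (Coins k n) :=
  MeasureTheory.Measure.infinitePi
    (fun _ : ℕ => (PMF.uniformOfFintype (Fin (numWords k n))).toMeasure)

end PalStream

/-! Fingerprints. Let `T` be the stream with every symbol increased by one, padded with zeros, and
let `r` be a random point of a field. The number H(m, x) = r^(m+x+1) · Σ_{j ≤ m-x} T(j) r^(m-x-j) +
Σ_{j ≤ m+x} T(j) r^j evaluates the first m-x symbols together with their mirror image at m, plus the
first m+x symbols. Replacing x by x+1 exchanges a mirrored symbol for an actual one, so H(m, x) =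
H(m, 0) whenever the arms of length x agree, and otherwise the difference is a nonzero polynomial in
r (`Par.dec_Hc`, `Par.Pal.Hc_eq`). H needs prefix data only at m-x and m+x. The right end is always
recent and lies in a ring buffer of O(√n) prefixes; the left end is taken from that buffer or from a
checkpoint, stored at the multiples of the spacing d = ⌊ε√n⌋. Testing arms in steps of d gives an
error below d.

Runs. Put s = ⌊√n⌋. Each midpoint m is examined at time m + 2s, by O(s/d) = O(1/ε) tests. This
settles every m whose arms are shorter than s. The other midpoints are long. Two palindromes whose
midpoints differ by p force the period 2p, and therefore consecutive long midpoints at distances at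
most s/2 are equally spaced (`PalZ.gap_eq`). In a maximal run with spacing p, the arms at the j-th
midpoint of the left half exceed those at the first midpoint by exactly j p, and the right half
mirrors this (`LongRun.left_half`, `LongRun.right_half`). The first and the last midpoint have arms
below s + p ≤ 2s, so they were settled by the examination. A whole run is thus described by a few
registers. Only an exact middle midpoint may reach further; it joins a list of single midpoints. A
new run starts more than s/2 after the end of the previous one, so the list has O(√n) entries. It is
updated once per d symbols, with O(1) tests per entry: in total O((n/d) √n) = O(n/ε).

Field. The polynomials have degree at most 2n, so the field must have more than n elements.
Bertrand's postulate only yields an interval of length about p in which to search for a prime p, so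
trial division in time O(n) cannot reach p > n. Instead p has order n^(5/8), and the field is
𝔽_p[√g] with p² of order n^(5/4); the least nonresidue g is at most about √p
(`exists_small_nonresidue`). A symbol is split into a+1 field elements, and this vector is repeated
twelve times with independent evaluation points. One wrong test then has probability at most
(2n/p²)^12, and the union over at most n² pairs (m, x) is at most 1/(2n). Reducing a random word to
the range of r costs another factor of two.

Machine. The invariant `Main` separates what holds for every outcome of the random words (each
midpoint is accounted for once, sizes are bounded) from what holds if no fingerprint lies
(`Par.Good`). The time and space bounds use only the first kind. -/

namespace PalStream

/-! ### Program logic for the word RAM -/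

/-! ### Total-correctness logic with a cost counter for the word RAM. -/

section Logic

variable {r : ℕ}

/-- Value of an operation on natural numbers of unbounded size. -/
def Op.nat : Op → ℕ → ℕ → ℕ
  | .add, a, b => a + b
  | .sub, a, b => a - b
  | .mul, a, b => a * b
  | .div, a, b => a / b
  | .mod, a, b => a % b
  | .lt, a, b => if a < b then 1 else 0
  | .eq, a, b => if a = b then 1 else 0

/-- Value of an expression over natural numbers of unbounded size. -/
def Expr.nat (ρ : Fin r → ℕ) : Expr r → ℕ
  | .const c => c
  | .reg x => ρ x
  | .bin o e₁ e₂ => o.nat (e₁.nat ρ) (e₂.nat ρ)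

/-- Number of leaves. -/
def Expr.size : Expr r → ℕ
  | .const _ => 1
  | .reg _ => 1
  | .bin _ e₁ e₂ => e₁.size + e₂.size

/-- All constants are at most `100`. -/
def Expr.small : Expr r → Bool
  | .const c => decide (c ≤ 100)
  | .reg _ => true
  | .bin _ e₁ e₂ => e₁.small && e₂.small

/-- Expressions with at most `24` leaves and constants at most `100`. -/
def Expr.ok (e : Expr r) : Bool := decide (e.size ≤ 24) && e.small

instance : Add (Expr r) := ⟨.bin .add⟩
instance : Sub (Expr r) := ⟨.bin .sub⟩
instance : Mul (Expr r) := ⟨.bin .mul⟩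
instance : Div (Expr r) := ⟨.bin .div⟩
instance : Mod (Expr r) := ⟨.bin .mod⟩

@[simp] lemma Expr.nat_add (ρ : Fin r → ℕ) (e f : Expr r) :
    (e + f).nat ρ = e.nat ρ + f.nat ρ := rfl
@[simp] lemma Expr.nat_sub (ρ : Fin r → ℕ) (e f : Expr r) :
    (e - f).nat ρ = e.nat ρ - f.nat ρ := rfl
@[simp] lemma Expr.nat_mul (ρ : Fin r → ℕ) (e f : Expr r) :
    (e * f).nat ρ = e.nat ρ * f.nat ρ := rfl
@[simp] lemma Expr.nat_div (ρ : Fin r → ℕ) (e f : Expr r) :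
    (e / f).nat ρ = e.nat ρ / f.nat ρ := rfl
@[simp] lemma Expr.nat_mod (ρ : Fin r → ℕ) (e f : Expr r) :
    (e % f).nat ρ = e.nat ρ % f.nat ρ := rfl
@[simp] lemma Expr.nat_lt (ρ : Fin r → ℕ) (e f : Expr r) :
    (Expr.bin .lt e f).nat ρ = if e.nat ρ < f.nat ρ then 1 else 0 := rfl
@[simp] lemma Expr.nat_eq (ρ : Fin r → ℕ) (e f : Expr r) :
    (Expr.bin .eq e f).nat ρ = if e.nat ρ = f.nat ρ then 1 else 0 := rfl
@[simp] lemma Expr.nat_reg (ρ : Fin r → ℕ) (x : Fin r) : (Expr.reg x).nat ρ = ρ x := rfl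
@[simp] lemma Expr.nat_const (ρ : Fin r → ℕ) (k : ℕ) : (Expr.const k).nat ρ = k := rfl
lemma Expr.one_le_size (e : Expr r) : 1 ≤ e.size := by
  induction e with
  | const => exact le_rfl
  | reg => exact le_rfl
  | bin o e f he hf => simp only [Expr.size]; omega

lemma Expr.nat_lt_pow {B : ℕ} (hB : 101 ≤ B) {ρ : Fin r → ℕ} (hρ : ∀ x, ρ x < B) (e : Expr r)
    (he : e.small = true) : e.nat ρ < B ^ e.size := by
  induction e with
  | const c =>
    simp only [Expr.small, decide_eq_true_eq] at he
    simp only [Expr.nat, Expr.size, pow_one]; omega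
  | reg x => simpa [Expr.nat, Expr.size] using hρ x
  | bin o e f ihe ihf =>
    simp only [Expr.small, Bool.and_eq_true] at he
    have h1 := ihe he.1
    have h2 := ihf he.2
    have hm : ∀ g : Expr r, 2 ≤ B ^ g.size := fun g =>
      le_trans (by rw [pow_one]; omega : 2 ≤ B ^ 1) (Nat.pow_le_pow_right (by omega) g.one_le_size)
    have ha := hm e
    have hb := hm f
    simp only [Expr.nat, Expr.size, pow_add]
    generalize e.nat ρ = a at *
    generalize f.nat ρ = b at *
    generalize B ^ e.size = x at *
    generalize B ^ f.size = y at *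
    have hx : x ≤ x * y := Nat.le_mul_of_pos_right _ (by omega)
    cases o
    · simp only [Op.nat]; nlinarith
    · simp only [Op.nat]; omega
    · simp only [Op.nat]; exact Nat.mul_lt_mul'' h1 h2
    · simp only [Op.nat]; exact lt_of_le_of_lt (Nat.div_le_self _ _) (by omega)
    · simp only [Op.nat]; exact lt_of_le_of_lt (Nat.mod_le _ _) (by omega)
    · simp only [Op.nat]; split_ifs <;> omega
    · simp only [Op.nat]; split_ifs <;> omega

/-- Each subexpression has a value below `B` to the number of its leaves, hence below `W`, so the
reductions modulo `W` never act. Programs can thus be reasoned about over unbounded natural numbers.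
-/
lemma Expr.eval_eq_nat {B W : ℕ} (hB : 101 ≤ B) {ρ : Fin r → ℕ} (hρ : ∀ x, ρ x < B) (e : Expr r)
    (he : e.small = true) (hW : B ^ e.size ≤ W) : e.eval W ρ = e.nat ρ := by
  induction e with
  | const c =>
    have h := Expr.nat_lt_pow hB hρ (.const c) he
    exact Nat.mod_eq_of_lt (lt_of_lt_of_le h hW)
  | reg x => rfl
  | bin o e f ihe ihf =>
    have h := lt_of_lt_of_le (Expr.nat_lt_pow hB hρ (.bin o e f) he) hW
    simp only [Expr.small, Bool.and_eq_true] at he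
    have hBp : 0 < B := by omega
    have h1 := ihe he.1 (le_trans (Nat.pow_le_pow_right hBp (by simp [Expr.size])) hW)
    have h2 := ihf he.2 (le_trans (Nat.pow_le_pow_right hBp (by simp [Expr.size])) hW)
    simp only [Expr.eval, h1, h2]
    simp only [Expr.nat] at h ⊢
    cases o <;> simp only [Op.nat, Op.eval] at h ⊢
    · exact Nat.mod_eq_of_lt h
    · exact Nat.mod_eq_of_lt h

lemma Expr.cost_le (e : Expr r) : e.cost + 1 ≤ 2 * e.size := by
  induction e with
  | const => exact le_rfl
  | reg => exact le_rfl
  | bin o e f he hf => simp only [Expr.size, Expr.cost]; omega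

/-- A machine together with a bound `B` on the words which a program uses and a bound `A` on its
memory. Expressions with at most `24` leaves do not overflow. -/
structure Env where
  W : ℕ
  S : List ℕ
  ω : ℕ → ℕ
  B : ℕ
  A : ℕ
  hB : 101 ≤ B
  hW : B ^ 24 ≤ W

/-- All words in use are less than `Γ.B`, and at most `Γ.A` memory cells are in use. -/
structure Ok (Γ : Env) (s : State r) : Prop where
  reg : ∀ y, s.reg y < Γ.B
  mem : ∀ a, s.mem a < Γ.B
  cells : s.cells ≤ Γ.A

/-- Weakest precondition: `c` halts from `s`, keeps `Ok`, and takes at most `50` steps per tick of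
the counter `t`. -/
def WP (Γ : Env) (c : Cmd r) (Q : State r → ℕ → Prop) (s : State r) (t : ℕ) : Prop :=
  Ok Γ s → ∃ t' s' u, Exec Γ.W Γ.S Γ.ω c s t' s' ∧ Ok Γ s' ∧ t ≤ u ∧ t' ≤ 50 * (u - t) ∧ Q s' u

/-- Assignment to a register. -/
def State.set (s : State r) (x : Fin r) (v : ℕ) : State r :=
  { s with reg := Function.update s.reg x v }

/-- Load of the value `v` from address `a`. -/
def State.ld (s : State r) (x : Fin r) (a v : ℕ) : State r :=
  { s with reg := Function.update s.reg x v, cells := max s.cells (a + 1) }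

/-- Store to the memory. -/
def State.st (s : State r) (a v : ℕ) : State r :=
  { s with mem := Function.update s.mem a v, cells := max s.cells (a + 1) }

/-- Output. -/
def State.put (s : State r) (q : ℕ × ℕ) : State r := { s with out := s.out ++ [q] }

/-- One more input symbol has been read. -/
def State.next (s : State r) : State r := { s with pos := s.pos + 1 }

section simps
variable (s : State r) (x y : Fin r) (v a b : ℕ) (q : ℕ × ℕ)

@[simp] lemma State.set_reg : (s.set x v).reg y = if y = x then v else s.reg y := by
  simp [State.set, Function.update_apply]
@[simp] lemma State.set_mem : (s.set x v).mem = s.mem := rfl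
@[simp] lemma State.set_out : (s.set x v).out = s.out := rfl
@[simp] lemma State.set_pos : (s.set x v).pos = s.pos := rfl
@[simp] lemma State.ld_reg : (s.ld x a v).reg y = if y = x then v else s.reg y := by
  simp [State.ld, Function.update_apply]
@[simp] lemma State.ld_mem : (s.ld x a v).mem = s.mem := rfl
@[simp] lemma State.ld_out : (s.ld x a v).out = s.out := rfl
@[simp] lemma State.ld_pos : (s.ld x a v).pos = s.pos := rfl
@[simp] lemma State.st_reg : (s.st a v).reg = s.reg := rfl
@[simp] lemma State.st_mem : (s.st a v).mem b = if b = a then v else s.mem b := by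
  simp [State.st, Function.update_apply]
@[simp] lemma State.st_out : (s.st a v).out = s.out := rfl
@[simp] lemma State.st_pos : (s.st a v).pos = s.pos := rfl
@[simp] lemma State.put_reg : (s.put q).reg = s.reg := rfl
@[simp] lemma State.put_mem : (s.put q).mem = s.mem := rfl
@[simp] lemma State.put_out : (s.put q).out = s.out ++ [q] := rfl
@[simp] lemma State.put_pos : (s.put q).pos = s.pos := rfl

@[simp] lemma State.next_reg : s.next.reg = s.reg := rfl
@[simp] lemma State.next_mem : s.next.mem = s.mem := rfl
@[simp] lemma State.next_out : s.next.out = s.out := rfl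
@[simp] lemma State.next_pos : s.next.pos = s.pos + 1 := rfl

end simps

variable {Γ : Env} {Q : State r → ℕ → Prop} {s : State r} {t : ℕ}

lemma Expr.ok_iff {e : Expr r} (he : e.ok = true) : e.size ≤ 24 ∧ e.small = true := by
  simpa [Expr.ok] using he

lemma Ok.eval (h : Ok Γ s) {e : Expr r} (he : e.ok = true) : e.eval Γ.W s.reg = e.nat s.reg :=
  Expr.eval_eq_nat Γ.hB h.reg e (Expr.ok_iff he).2
    (le_trans (Nat.pow_le_pow_right (by have := Γ.hB; omega) (Expr.ok_iff he).1) Γ.hW)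

/-- An expression with 24 leaves has 23 operations. With the step of the command itself this fits
into the 50 steps of one tick. -/
lemma Expr.cost_le_of_ok {e : Expr r} (he : e.ok = true) : e.cost ≤ 47 := by
  have := e.cost_le
  have := (Expr.ok_iff he).1
  omega

lemma Env.le_W (Γ : Env) : Γ.B ≤ Γ.W :=
  le_trans (Nat.le_self_pow (by norm_num) _) Γ.hW

lemma WP.ok (h : Ok Γ s → WP Γ c Q s t) : WP Γ c Q s t := fun ho => h ho ho

lemma WP.mono {c : Cmd r} {Q' : State r → ℕ → Prop} (h : WP Γ c Q s t)
    (hQ : ∀ s' t', Ok Γ s' → t ≤ t' → Q s' t' → Q' s' t') : WP Γ c Q' s t := by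
  intro ho
  obtain ⟨t', s', u, h1, h2, h3, h4, h5⟩ := h ho
  exact ⟨t', s', u, h1, h2, h3, h4, hQ _ _ h2 h3 h5⟩

lemma WP.skip (hQ : Q s (t + 1)) : WP Γ .skip Q s t := fun ho =>
  ⟨1, s, t + 1, .skip s, ho, by omega, by omega, hQ⟩

lemma WP.assign {x : Fin r} {e : Expr r} (v : ℕ) (he : e.ok = true) (hv : e.nat s.reg = v)
    (hvB : v < Γ.B) (hQ : Q (s.set x v) (t + 1)) : WP Γ (.assign x e) Q s t := by
  subst hv
  intro ho
  refine ⟨1 + e.cost, s.set x (e.nat s.reg), t + 1, ?_, ⟨?_, ho.mem, ho.cells⟩, by omega, ?_, hQ⟩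
  · rw [← ho.eval he]; exact Exec.assign s x e
  · intro y
    rw [State.set_reg]; split_ifs
    exacts [hvB, ho.reg y]
  · have := Expr.cost_le_of_ok he; omega

lemma WP.assign_const {x : Fin r} {c : ℕ} (hv : c < Γ.B)
    (hQ : Q (s.set x c) (t + 1)) : WP Γ (.assign x (.const c)) Q s t := by
  intro ho
  refine ⟨1 + 1, s.set x c, t + 1, ?_, ⟨?_, ho.mem, ho.cells⟩, by omega, by omega, hQ⟩
  · have := Exec.assign (W := Γ.W) (S := Γ.S) (ω := Γ.ω) s x (.const c)
    rwa [Expr.eval, Nat.mod_eq_of_lt (lt_of_lt_of_le hv Γ.le_W)] at this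
  · intro y
    rw [State.set_reg]; split_ifs
    exacts [hv, ho.reg y]

lemma WP.load {x : Fin r} {e : Expr r} (a v : ℕ) (he : e.ok = true) (ha : e.nat s.reg = a)
    (haA : a < Γ.A) (hv : s.mem a = v) (hQ : Q (s.ld x a v) (t + 1)) :
    WP Γ (.load x e) Q s t := by
  subst ha; subst hv
  intro ho
  refine ⟨1 + e.cost, s.ld x (e.nat s.reg) (s.mem (e.nat s.reg)), t + 1, ?_, ⟨?_, ho.mem, ?_⟩,
    by omega, ?_, hQ⟩
  · rw [← ho.eval he]; exact Exec.load s x e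
  · intro y
    rw [State.ld_reg]; split_ifs
    exacts [ho.mem _, ho.reg y]
  · have := ho.cells
    simp only [State.ld]; omega
  · have := Expr.cost_le_of_ok he; omega

lemma WP.store {e₁ e₂ : Expr r} (a v : ℕ) (he : e₁.ok = true) (hf : e₂.ok = true)
    (hc : e₁.cost + e₂.cost ≤ 49) (ha : e₁.nat s.reg = a) (haA : a < Γ.A)
    (hv : e₂.nat s.reg = v) (hvB : v < Γ.B) (hQ : Q (s.st a v) (t + 1)) :
    WP Γ (.store e₁ e₂) Q s t := by
  subst ha; subst hv
  intro ho
  refine ⟨1 + e₁.cost + e₂.cost, s.st (e₁.nat s.reg) (e₂.nat s.reg), t + 1, ?_,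
    ⟨ho.reg, ?_, ?_⟩, by omega, by omega, hQ⟩
  · rw [← ho.eval he, ← ho.eval hf]; exact Exec.store s e₁ e₂
  · intro y
    rw [State.st_mem]; split_ifs
    exacts [hvB, ho.mem _]
  · have := ho.cells
    simp only [State.st]; omega

lemma WP.emit {e₁ e₂ : Expr r} (he : e₁.ok = true) (hf : e₂.ok = true)
    (hc : e₁.cost + e₂.cost ≤ 49) (q : ℕ × ℕ) (hq : (e₁.nat s.reg, e₂.nat s.reg) = q)
    (hQ : Q (s.put q) (t + 1)) : WP Γ (.emit e₁ e₂) Q s t := by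
  subst hq
  intro ho
  refine ⟨1 + e₁.cost + e₂.cost, s.put (e₁.nat s.reg, e₂.nat s.reg), t + 1, ?_,
    ⟨ho.reg, ho.mem, ho.cells⟩, by omega, by omega, hQ⟩
  rw [← ho.eval he, ← ho.eval hf]; exact Exec.emit s e₁ e₂

lemma WP.read {x : Fin r} (hv : Γ.S.getD s.pos 0 < Γ.B)
    (hQ : Q (s.set x (Γ.S.getD s.pos 0)).next (t + 1)) :
    WP Γ (.read x) Q s t := by
  intro ho
  refine ⟨1, (s.set x (Γ.S.getD s.pos 0)).next, t + 1, ?_,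
    ⟨?_, ho.mem, ho.cells⟩, by omega, by omega, hQ⟩
  · have := Exec.read (W := Γ.W) (S := Γ.S) (ω := Γ.ω) s x
    rwa [Nat.mod_eq_of_lt (lt_of_lt_of_le hv Γ.le_W)] at this
  · intro y
    change (s.set x _).reg y < _
    rw [State.set_reg]; split_ifs
    exacts [hv, ho.reg y]

/-- A raw random word may be as large as `W - 1` and would violate `Ok`. Drawing and reducing
therefore form one unit, with no `Ok` demanded in between. -/
lemma WP.rand_mod {x y : Fin r} (hxy : y ≠ x) (hy : 0 < s.reg y)
    (hQ : ∀ s' : State r, s'.mem = s.mem → s'.out = s.out → s'.pos = s.pos →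
      (∀ z, s'.reg z = if z = x then Γ.ω s.drawn % s.reg y else s.reg z) → Q s' (t + 1)) :
    WP Γ (.seq (.rand x) (.assign x (.bin .mod (.reg x) (.reg y)))) Q s t := by
  intro ho
  refine ⟨_, _, t + 1, .seq (.rand s x) (.assign _ x _), ⟨fun z => ?_, ho.mem, ho.cells⟩, by omega,
    by simp [Expr.cost], hQ _ rfl rfl rfl fun z => ?_⟩
  · have := Nat.mod_lt (Γ.ω s.drawn) hy
    have := ho.reg y
    have := ho.reg z
    simp only [Expr.eval, Op.eval, Function.update_apply, if_true, if_neg hxy]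
    split_ifs <;> omega
  · simp only [Expr.eval, Op.eval, Function.update_apply, if_true, if_neg hxy]
    split_ifs <;> rfl

lemma WP.seq {c₁ c₂ : Cmd r} (h : WP Γ c₁ (fun s' t' => WP Γ c₂ Q s' t') s t) :
    WP Γ (.seq c₁ c₂) Q s t := by
  intro ho
  obtain ⟨t', s', u, h1, h2, h3, h4, h5⟩ := h ho
  obtain ⟨t'', s'', u', k1, k2, k3, k4, k5⟩ := h5 h2
  exact ⟨t' + t'', s'', u', .seq h1 k1, k2, by omega, by omega, k5⟩

lemma WP.ite {c₁ c₂ : Cmd r} {e : Expr r} (he : e.ok = true)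
    (h1 : e.nat s.reg ≠ 0 → WP Γ c₁ Q s (t + 1)) (h2 : e.nat s.reg = 0 → WP Γ c₂ Q s (t + 1)) :
    WP Γ (.ite e c₁ c₂) Q s t := by
  intro ho
  have hc := Expr.cost_le_of_ok he
  by_cases h : e.nat s.reg = 0
  · obtain ⟨t', s', u, k1, k2, k3, k4, k5⟩ := h2 h ho
    exact ⟨_, s', u, .ite_false (by rwa [ho.eval he]) k1, k2, by omega, by omega, k5⟩
  · obtain ⟨t', s', u, k1, k2, k3, k4, k5⟩ := h1 h ho
    exact ⟨_, s', u, .ite_true (by rwa [ho.eval he]) k1, k2, by omega, by omega, k5⟩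

/-- The index `j` is the variant that forces termination. Time enters through the invariant itself,
which may mention the counter and thus allows amortized bounds. -/
lemma WP.loop {c : Cmd r} {e : Expr r} (he : e.ok = true) (I : ℕ → State r → ℕ → Prop)
    (hstep : ∀ j s t, Ok Γ s → I j s t → e.nat s.reg ≠ 0 →
      WP Γ c (fun s' t' => ∃ j' < j, I j' s' t') s (t + 1))
    (hend : ∀ j s t, Ok Γ s → I j s t → e.nat s.reg = 0 → Q s (t + 1))
    {j : ℕ} (hI : I j s t) : WP Γ (.loop e c) Q s t := by
  induction j using Nat.strong_induction_on generalizing s t with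
  | _ j ih =>
    intro ho
    have hc := Expr.cost_le_of_ok he
    by_cases h : e.nat s.reg = 0
    · exact ⟨_, s, t + 1, .loop_false (by rwa [ho.eval he]), ho, by omega, by omega,
        hend j s t ho hI h⟩
    · obtain ⟨t', s', u, k1, k2, k3, k4, j', hj, k5⟩ := hstep j s t ho hI h ho
      obtain ⟨t'', s'', u', l1, l2, l3, l4, l5⟩ := ih j' hj k5 k2
      exact ⟨_, s'', u', .loop_true (by rwa [ho.eval he]) k1 l1, l2, by omega, by omega, l5⟩

/-- A loop which runs a fixed number of times. -/
lemma WP.for {c : Cmd r} {e : Expr r} (he : e.ok = true) (I : ℕ → State r → ℕ → Prop) (K : ℕ)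
    (hguard : ∀ j s t, j ≤ K → I j s t → (e.nat s.reg ≠ 0 ↔ j < K))
    (hstep : ∀ j s t, Ok Γ s → j < K → I j s t → WP Γ c (fun s' t' => I (j + 1) s' t') s (t + 1))
    (hI : I 0 s t) (hend : ∀ s t, Ok Γ s → I K s t → Q s (t + 1)) : WP Γ (.loop e c) Q s t := by
  refine WP.loop he (fun j s t => j ≤ K ∧ I (K - j) s t) ?_ ?_ (j := K) ?_
  · rintro j s t ho ⟨hj, hI⟩ hg
    have := (hguard _ _ _ (by omega) hI).1 hg
    refine (hstep _ _ _ ho this hI).mono fun s' t' _ _ h => ⟨j - 1, by omega, by omega, ?_⟩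
    rwa [show K - (j - 1) = K - j + 1 by omega]
  · rintro j s t ho ⟨hj, hI⟩ hg
    have h := hguard _ _ _ (by omega) hI
    have : ¬ (K - j < K) := fun hlt => (h.2 hlt) hg
    refine hend _ _ ho ?_
    rwa [show K - j = K by omega] at hI
  · simpa using hI

/-- Registers which a command may change. -/
def Cmd.writes : Cmd r → List (Fin r)
  | .skip => []
  | .assign x _ => [x]
  | .load x _ => [x]
  | .store _ _ => []
  | .read x => [x]
  | .rand x => [x]
  | .emit _ _ => []
  | .seq c₁ c₂ => c₁.writes ++ c₂.writes
  | .ite _ c₁ c₂ => c₁.writes ++ c₂.writes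
  | .loop _ c => c.writes

/-- The command contains no store. -/
def Cmd.noStore : Cmd r → Bool
  | .store _ _ => false
  | .seq c₁ c₂ => c₁.noStore && c₂.noStore
  | .ite _ c₁ c₂ => c₁.noStore && c₂.noStore
  | .loop _ c => c.noStore
  | _ => true

/-- The command produces no output. -/
def Cmd.noEmit : Cmd r → Bool
  | .emit _ _ => false
  | .seq c₁ c₂ => c₁.noEmit && c₂.noEmit
  | .ite _ c₁ c₂ => c₁.noEmit && c₂.noEmit
  | .loop _ c => c.noEmit
  | _ => true

/-- The command reads no input and draws no random words. -/
def Cmd.noInput : Cmd r → Bool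
  | .read _ => false
  | .rand _ => false
  | .seq c₁ c₂ => c₁.noInput && c₂.noInput
  | .ite _ c₁ c₂ => c₁.noInput && c₂.noInput
  | .loop _ c => c.noInput
  | _ => true

/-- What a command leaves unchanged. -/
structure Frame (c : Cmd r) (s s' : State r) : Prop where
  reg : ∀ y, y ∉ c.writes → s'.reg y = s.reg y
  mem : c.noStore = true → s'.mem = s.mem
  out : c.noEmit = true → s'.out = s.out
  pos : c.noInput = true → s'.pos = s.pos
  drawn : c.noInput = true → s'.drawn = s.drawn

/-- Frame conditions are read off the syntax of the command, so a specification has to mention only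
what actually changes; membership in `writes` is later settled by `decide`. -/
lemma Exec.frame {W : ℕ} {S : List ℕ} {ω : ℕ → ℕ} {c : Cmd r} {s s' : State r} {t : ℕ}
    (h : Exec W S ω c s t s') : Frame c s s' := by
  induction h with
  | skip | store | emit => constructor <;> simp [Cmd.noStore, Cmd.noEmit]
  | assign | load | read | rand =>
    constructor <;> simp +contextual [Cmd.noInput, Cmd.writes]
  | seq _ _ h1 h2 =>
    constructor <;> simp only [Cmd.noStore, Cmd.noEmit, Cmd.noInput, Cmd.writes, List.mem_append,
      not_or, Bool.and_eq_true]
    · exact fun y hy => (h2.reg y hy.2).trans (h1.reg y hy.1)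
    · exact fun hy => (h2.mem hy.2).trans (h1.mem hy.1)
    · exact fun hy => (h2.out hy.2).trans (h1.out hy.1)
    · exact fun hy => (h2.pos hy.2).trans (h1.pos hy.1)
    · exact fun hy => (h2.drawn hy.2).trans (h1.drawn hy.1)
  | ite_true _ _ h | ite_false _ _ h =>
    constructor <;> simp only [Cmd.noStore, Cmd.noEmit, Cmd.noInput, Cmd.writes, List.mem_append,
      not_or, Bool.and_eq_true]
    · exact fun y hy => h.reg y (by tauto)
    · exact fun hy => h.mem (by tauto)
    · exact fun hy => h.out (by tauto)
    · exact fun hy => h.pos (by tauto)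
    · exact fun hy => h.drawn (by tauto)
  | loop_true _ _ _ h1 h2 =>
    constructor
    · exact fun y hy => (h2.reg y hy).trans (h1.reg y hy)
    · exact fun hy => (h2.mem hy).trans (h1.mem hy)
    · exact fun hy => (h2.out hy).trans (h1.out hy)
    · exact fun hy => (h2.pos hy).trans (h1.pos hy)
    · exact fun hy => (h2.drawn hy).trans (h1.drawn hy)
  | loop_false => constructor <;> simp

lemma WP.frame {c : Cmd r} (h : WP Γ c Q s t) :
    WP Γ c (fun s' t' => Frame c s s' ∧ Q s' t') s t := by
  intro ho
  obtain ⟨t', s', u, h1, h2, h3, h4, h5⟩ := h ho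
  exact ⟨t', s', u, h1, h2, h3, h4, h1.frame, h5⟩

/-- Use of a specification `P` of `c` in a larger program. -/
lemma WP.use {c : Cmd r} {P : State r → ℕ → Prop} (h : WP Γ c P s t)
    (hQ : ∀ s' t', Frame c s s' → t ≤ t' → P s' t' → Q s' t') : WP Γ c Q s t :=
  h.frame.mono fun s' t' _ ht h' => hQ s' t' h'.1 ht h'.2

end Logic

end PalStream

/-! ### Palindrome fingerprints coded as words, and the commands that compute and compare them. -/

namespace PalStream

/-! ### Fingerprints as words -/

/-- The words below `(p * p) ^ k` code vectors of length `k` over `𝔽_p[√g]`, two base-`p` digits for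
each entry. This is the code of `x * y + w`. -/
def fmaCode (p g : ℕ) : ℕ → ℕ → ℕ → ℕ → ℕ
  | 0, _, _, _ => 0
  | k + 1, x, y, w =>
    (x % p * (y % p) + x / p % p * (y / p % p) * g + w % p) % p
      + (x % p * (y / p % p) + x / p % p * (y % p) + w / p % p) % p * p
      + p * p * fmaCode p g k (x / (p * p)) (y / (p * p)) (w / (p * p))

lemma add_mul_lt_mul_self {p z₀ z₁ : ℕ} (h0 : z₀ < p) (h1 : z₁ < p) : z₀ + z₁ * p < p * p := by
  nlinarith

lemma fmaCode_lt {p : ℕ} (hp : 0 < p) (g k x y w : ℕ) : fmaCode p g k x y w < (p * p) ^ k := by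
  induction k generalizing x y w with
  | zero => simp [fmaCode]
  | succ k ih =>
    rw [fmaCode, pow_succ]
    have h := ih (x / (p * p)) (y / (p * p)) (w / (p * p))
    have h0 := Nat.mod_lt (x % p * (y % p) + x / p % p * (y / p % p) * g + w % p) hp
    have h1 := Nat.mod_lt (x % p * (y / p % p) + x / p % p * (y % p) + w / p % p) hp
    have h2 := add_mul_lt_mul_self h0 h1
    generalize (x % p * (y % p) + x / p % p * (y / p % p) * g + w % p) % p = z₀ at *
    generalize (x % p * (y / p % p) + x / p % p * (y % p) + w / p % p) % p = z₁ at *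
    generalize fmaCode p g k (x / (p * p)) (y / (p * p)) (w / (p * p)) = f at *
    generalize (p * p) ^ k = M at *
    generalize p * p = q at *
    nlinarith

/-- The parameters of the algorithm: the length `n` of the stream `S`, the spacing `d` of the
checkpoints, `s = ⌊√n⌋`, the field `𝔽_p[√g]`, the multiplier `E` which turns a symbol into a code, the
random evaluation point `r` and the length `k` of the vectors. -/
structure Par where
  n : ℕ
  d : ℕ
  s : ℕ
  p : ℕ
  g : ℕ
  E : ℕ
  r : ℕ
  k : ℕ
  S : List ℕ

namespace Par

variable (π : Par)

/-- The symbols of the stream, increased by one and padded with zeros. -/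
def T (j : ℕ) : ℕ := if 1 ≤ j ∧ j ≤ π.n then symbol π.S j + 1 else 0

/-- Multiplication and addition of codes. -/
def fma (x y w : ℕ) : ℕ := fmaCode π.p π.g π.k x y w

/-- Code of `r ^ (i + 1)`. -/
def Pc : ℕ → ℕ
  | 0 => π.r
  | i + 1 => π.fma π.r (Pc i) 0

/-- Code of `∑ T j * r ^ j` over `j ≤ i`. -/
def Fc : ℕ → ℕ
  | 0 => 0
  | i + 1 => π.fma (π.T (i + 1) * π.E) (π.Pc i) (Fc i)

/-- Code of `∑ T j * r ^ (i - j)` over `j ≤ i`. -/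
def Gc : ℕ → ℕ
  | 0 => 0
  | i + 1 => π.fma π.r (Gc i) (π.T (i + 1) * π.E)

/-- The fingerprint of the word with midpoint `m` and arms of length `x`; it does not depend on `x`
as long as the word is a palindrome. -/
def Hc (m x : ℕ) : ℕ := π.fma (π.Pc (m + x)) (π.Gc (m - x)) (π.Fc (m + x))

/-- `T` has a palindrome with midpoint `m` and arms of length `x`. -/
def Pal (m x : ℕ) : Prop := x ≤ m ∧ ∀ i, 1 ≤ i → i ≤ x → π.T (m + 1 - i) = π.T (m + i)

/-- Fingerprints do not lie. -/
def Good : Prop := ∀ m x, 1 ≤ m → m ≤ π.n → x ≤ m → π.Hc m x = π.Hc m 0 → π.Pal m x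

/-- The parameters fit to each other and to the machine. -/
structure Valid (Γ : Env) : Prop where
  hn : 1 ≤ π.n
  hd : 1 ≤ π.d
  hds : π.d ≤ π.s
  hs : π.s * π.s ≤ π.n
  hp : 0 < π.p
  hr : π.r < (π.p * π.p) ^ π.k
  hT : ∀ j, π.T j * π.E < (π.p * π.p) ^ π.k
  hB : (π.p * π.p) ^ (π.k + 1) < Γ.B
  hnB : 100 * (π.n + 1) ≤ Γ.B
  hkB : π.k < Γ.B
  hS : Γ.S = π.S
  hTB : ∀ j, symbol π.S j + 1 < Γ.B
  hA1 : 7 * (4 * π.s + 4) + 7 ≤ Γ.A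
  hA2 : ∀ c, c * π.d ≤ π.n + 3 * π.s + 2 → 7 * c + 7 ≤ Γ.A
  hA3 : ∀ c, c * (π.s / 2 + 1) ≤ π.n + π.s / 2 + 2 → 7 * c + 7 ≤ Γ.A

end Par

variable {π : Par} {Γ : Env}

namespace Par.Valid

variable (h : π.Valid Γ)
include h

lemma fma_lt (x y w : ℕ) : π.fma x y w < (π.p * π.p) ^ π.k := fmaCode_lt h.hp _ _ _ _ _

lemma code_lt {x : ℕ} (hx : x < (π.p * π.p) ^ π.k) : x < Γ.B := by
  refine hx.trans (lt_of_le_of_lt ?_ h.hB)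
  exact Nat.pow_le_pow_right (Nat.mul_pos h.hp h.hp) (by omega)

lemma fma_lt_B (x y w : ℕ) : π.fma x y w < Γ.B := h.code_lt (h.fma_lt x y w)

lemma s_le : π.s ≤ π.n := le_trans (Nat.le_mul_self _) h.hs

end Par.Valid

/-! ### Registers and memory layout -/

/-- Expression which reads a register. -/
abbrev rg (x : Fin 40) : Expr 40 := .reg x

/-- Constant expression. -/
abbrev cn (c : ℕ) : Expr 40 := .const c

infixr:60 " ;; " => Cmd.seq

notation "Rn" => (0 : Fin 40)
notation "Rd" => (1 : Fin 40)
notation "Rs" => (2 : Fin 40)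
notation "Rp" => (3 : Fin 40)
notation "Rg" => (4 : Fin 40)
notation "RE" => (5 : Fin 40)
notation "Rr" => (6 : Fin 40)
notation "Rk" => (7 : Fin 40)
notation "Ri" => (8 : Fin 40)
notation "RF" => (9 : Fin 40)
notation "RG" => (10 : Fin 40)
notation "RP" => (11 : Fin 40)
notation "Rfst" => (12 : Fin 40)
notation "Rcnt" => (13 : Fin 40)
notation "Rgap" => (14 : Fin 40)
notation "Rlast" => (15 : Fin 40)
notation "Refst" => (16 : Fin 40)
notation "Relast" => (17 : Fin 40)
notation "Rns" => (18 : Fin 40)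
notation "Rm" => (19 : Fin 40)
notation "Rc" => (20 : Fin 40)
notation "Rx" => (21 : Fin 40)
notation "RH" => (22 : Fin 40)
notation "Rfl" => (23 : Fin 40)
notation "Rj" => (24 : Fin 40)
notation "Rq" => (25 : Fin 40)
notation "Rlong" => (26 : Fin 40)
notation "Rv" => (27 : Fin 40)
notation "Rfx" => (28 : Fin 40)
notation "Rfy" => (29 : Fin 40)
notation "Rfw" => (30 : Fin 40)
notation "Rfz" => (31 : Fin 40)
notation "Rfq" => (32 : Fin 40)
notation "Rfc" => (33 : Fin 40)

/-- The constant registers hold the parameters. -/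
structure Consts (π : Par) (σ : State 40) : Prop where
  n : σ.reg Rn = π.n
  d : σ.reg Rd = π.d
  s : σ.reg Rs = π.s
  p : σ.reg Rp = π.p
  g : σ.reg Rg = π.g
  E : σ.reg RE = π.E
  r : σ.reg Rr = π.r
  k : σ.reg Rk = π.k

lemma Consts.of_eq {s s' : State 40} (h : Consts π s)
    (he : ∀ y : Fin 40, y.val < 8 → s'.reg y = s.reg y) : Consts π s' where
  n := (he Rn (by decide)).trans h.n
  d := (he Rd (by decide)).trans h.d
  s := (he Rs (by decide)).trans h.s
  p := (he Rp (by decide)).trans h.p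
  g := (he Rg (by decide)).trans h.g
  E := (he RE (by decide)).trans h.E
  r := (he Rr (by decide)).trans h.r
  k := (he Rk (by decide)).trans h.k

lemma Consts.frame {s s' : State 40} {c : Cmd 40} (h : Consts π s) (hf : Frame c s s')
    (hc : ∀ y : Fin 40, y.val < 8 → y ∉ c.writes) : Consts π s' :=
  h.of_eq fun y hy => hf.reg y (hc y hy)

/-- The memory consists of seven interleaved arrays. The first three are ring buffers for the last
`4 s + 4` values of `Fc`, `Gc` and `Pc`, the fourth holds the values of `Gc` at checkpoints. -/
structure HashMem (π : Par) (i : ℕ) (mem : ℕ → ℕ) : Prop where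
  F : ∀ j, j ≤ i → i < j + (4 * π.s + 4) → mem (7 * (j % (4 * π.s + 4))) = π.Fc j
  G : ∀ j, j ≤ i → i < j + (4 * π.s + 4) → mem (7 * (j % (4 * π.s + 4)) + 1) = π.Gc j
  P : ∀ j, j ≤ i → i < j + (4 * π.s + 4) → mem (7 * (j % (4 * π.s + 4)) + 2) = π.Pc j
  C : ∀ c, c * π.d ≤ i → mem (7 * c + 3) = π.Gc (c * π.d)

/-! ### Multiplication of codes -/

/-- `Rfz := Rfx * Rfy + Rfw` for codes. -/
def fmaCmd : Cmd 40 :=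
  .assign Rfz (cn 0) ;; .assign Rfq (cn 1) ;; .assign Rfc (rg Rk) ;;
  .loop (rg Rfc) (
    .assign Rfz (rg Rfz + (rg Rfx % rg Rp * (rg Rfy % rg Rp)
      + rg Rfx / rg Rp % rg Rp * (rg Rfy / rg Rp % rg Rp) * rg Rg + rg Rfw % rg Rp) % rg Rp
      * rg Rfq) ;;
    .assign Rfz (rg Rfz + (rg Rfx % rg Rp * (rg Rfy / rg Rp % rg Rp)
      + rg Rfx / rg Rp % rg Rp * (rg Rfy % rg Rp) + rg Rfw / rg Rp % rg Rp) % rg Rp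
      * (rg Rfq * rg Rp)) ;;
    .assign Rfq (rg Rfq * (rg Rp * rg Rp)) ;;
    .assign Rfx (rg Rfx / (rg Rp * rg Rp)) ;;
    .assign Rfy (rg Rfy / (rg Rp * rg Rp)) ;;
    .assign Rfw (rg Rfw / (rg Rp * rg Rp)) ;;
    .assign Rfc (rg Rfc - cn 1))

set_option maxHeartbeats 1000000 in
-- Each round handles one field element: two digits are produced with weight `Rfq`, and the three
-- arguments are shifted by one base-`p * p` digit.
lemma fmaCmd_spec (hV : π.Valid Γ) {s : State 40} (hC : Consts π s) {t x y w : ℕ}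
    (hx : s.reg Rfx = x) (hy : s.reg Rfy = y) (hw : s.reg Rfw = w) :
    WP Γ fmaCmd (fun s' t' => s'.reg Rfz = π.fma x y w ∧ t' ≤ t + (8 * π.k + 4)) s t := by
  have hB := Γ.hB
  have hp := hV.hp
  have hpp : 0 < π.p * π.p := Nat.mul_pos hp hp
  refine WP.seq (WP.assign 0 rfl rfl (by omega) ?_)
  refine WP.seq (WP.assign 1 rfl rfl (by omega) ?_)
  refine WP.seq (WP.assign π.k rfl (by simp [hC.k]) hV.hkB ?_)
  -- The digits found so far plus their weight times the code of the remaining entries always equal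
  -- the final result.
  refine WP.for rfl (fun j s t' => s.reg Rp = π.p ∧ s.reg Rg = π.g ∧ s.reg Rfc = π.k - j ∧
    s.reg Rfq = (π.p * π.p) ^ j ∧ s.reg Rfz < s.reg Rfq ∧
    s.reg Rfz + s.reg Rfq * fmaCode π.p π.g (π.k - j) (s.reg Rfx) (s.reg Rfy) (s.reg Rfw)
      = π.fma x y w ∧ t' ≤ t + 3 + 8 * j) π.k ?_ ?_ ?_ ?_
  · rintro j s t hj ⟨-, -, h3, -⟩
    simp only [Expr.nat_reg, h3]
    omega
  · rintro j s t ho hj ⟨h1, h2, h3, h4, h5, h6, h7⟩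
    obtain ⟨K, hK⟩ : ∃ K, π.k - j = K + 1 := ⟨π.k - j - 1, by omega⟩
    rw [hK, fmaCode] at h6
    have hlt := hV.fma_lt x y w
    have hz0 := Nat.mod_lt (s.reg Rfx % π.p * (s.reg Rfy % π.p)
      + s.reg Rfx / π.p % π.p * (s.reg Rfy / π.p % π.p) * π.g + s.reg Rfw % π.p) hp
    have hz1 := Nat.mod_lt (s.reg Rfx % π.p * (s.reg Rfy / π.p % π.p)
      + s.reg Rfx / π.p % π.p * (s.reg Rfy % π.p) + s.reg Rfw / π.p % π.p) hp
    set z₀ := (s.reg Rfx % π.p * (s.reg Rfy % π.p)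
      + s.reg Rfx / π.p % π.p * (s.reg Rfy / π.p % π.p) * π.g + s.reg Rfw % π.p) % π.p with hz0e
    set z₁ := (s.reg Rfx % π.p * (s.reg Rfy / π.p % π.p)
      + s.reg Rfx / π.p % π.p * (s.reg Rfy % π.p) + s.reg Rfw / π.p % π.p) % π.p with hz1e
    have hz := add_mul_lt_mul_self hz0 hz1
    have hfB := hV.fma_lt_B x y w
    have h6' : s.reg Rfz + z₀ * s.reg Rfq + z₁ * (s.reg Rfq * π.p) + s.reg Rfq *
        (π.p * π.p * fmaCode π.p π.g K (s.reg Rfx / (π.p * π.p)) (s.reg Rfy / (π.p * π.p))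
          (s.reg Rfw / (π.p * π.p))) = π.fma x y w := by
      rw [← h6]; ring
    -- By `h6'` the partial sums are bounded by the final code, so they cannot overflow.
    have e1 : s.reg Rfz + z₀ * s.reg Rfq ≤ π.fma x y w := by omega
    have e2 : s.reg Rfz + z₀ * s.reg Rfq + z₁ * (s.reg Rfq * π.p) ≤ π.fma x y w := by omega
    have e3 : s.reg Rfq * (π.p * π.p) < Γ.B := by
      rw [h4, ← pow_succ]
      refine lt_of_le_of_lt (Nat.pow_le_pow_right hpp ?_) hV.hB
      omega
    refine WP.seq (WP.assign (s.reg Rfz + z₀ * s.reg Rfq) rfl ?_ (by omega) ?_)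
    · simp [h1, h2, ← hz0e]
    refine WP.seq (WP.assign (s.reg Rfz + z₀ * s.reg Rfq + z₁ * (s.reg Rfq * π.p)) rfl ?_
      (by omega) ?_)
    · simp [h1, ← hz1e]
    refine WP.seq (WP.assign (s.reg Rfq * (π.p * π.p)) rfl (by simp [h1]) e3 ?_)
    refine WP.seq (WP.assign (s.reg Rfx / (π.p * π.p)) rfl (by simp [h1])
      (lt_of_le_of_lt (Nat.div_le_self _ _) (ho.reg Rfx)) ?_)
    refine WP.seq (WP.assign (s.reg Rfy / (π.p * π.p)) rfl (by simp [h1])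
      (lt_of_le_of_lt (Nat.div_le_self _ _) (ho.reg Rfy)) ?_)
    refine WP.seq (WP.assign (s.reg Rfw / (π.p * π.p)) rfl (by simp [h1])
      (lt_of_le_of_lt (Nat.div_le_self _ _) (ho.reg Rfw)) ?_)
    refine WP.assign (π.k - (j + 1)) rfl (by simp [h3]; omega) (by have := hV.hkB; omega) ?_
    simp only [State.set_reg, Fin.reduceEq, if_true, if_false, h1, h2, true_and]
    refine ⟨by rw [h4, pow_succ], ?_, ?_, by omega⟩
    · calc s.reg Rfz + z₀ * s.reg Rfq + z₁ * (s.reg Rfq * π.p)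
          = s.reg Rfz + s.reg Rfq * (z₀ + z₁ * π.p) := by ring
        _ < s.reg Rfq * (z₀ + z₁ * π.p + 1) := by rw [Nat.mul_add_one]; omega
        _ ≤ s.reg Rfq * (π.p * π.p) := Nat.mul_le_mul_left _ hz
    · rw [show π.k - (j + 1) = K by omega, ← h6]; ring
  · simp [hC.p, hC.g, hx, hy, hw, Par.fma]
  · rintro s t ho ⟨-, -, -, -, -, h6, h7⟩
    simp only [Nat.sub_self, fmaCode, mul_zero, add_zero] at h6
    exact ⟨h6, by omega⟩

/-- `Rfz :=` fingerprint with right end `e`, where `f` is the address of the left part. -/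
def hashCmd (e f : Expr 40) : Cmd 40 :=
  .load Rfx (cn 7 * (e % (cn 4 * rg Rs + cn 4)) + cn 2) ;; .load Rfy f ;;
  .load Rfw (cn 7 * (e % (cn 4 * rg Rs + cn 4))) ;; fmaCmd

/-- The addresses are evaluated again after the scratch registers, numbered from 28 on, have
changed. This is why `hej` and `hfa` range over all register contents that agree with `s` below 28.
-/
lemma hashCmd_spec (hV : π.Valid Γ) {s : State 40} (hC : Consts π s) {i j a : ℕ}
    (hM : HashMem π i s.mem) {e f : Expr 40}
    (hok : (cn 7 * (e % (cn 4 * rg Rs + cn 4)) + cn 2).ok = true)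
    (hok' : (cn 7 * (e % (cn 4 * rg Rs + cn 4))).ok = true) (hf : f.ok = true)
    (hej : ∀ ρ : Fin 40 → ℕ, (∀ y, y.val < 28 → ρ y = s.reg y) → e.nat ρ = j)
    (hfa : ∀ ρ : Fin 40 → ℕ, (∀ y, y.val < 28 → ρ y = s.reg y) → f.nat ρ = a)
    (haA : a < Γ.A) (hji : j ≤ i) (hij : i < j + (4 * π.s + 4)) {t : ℕ} :
    WP Γ (hashCmd e f) (fun s' t' => s'.reg Rfz = π.fma (π.Pc j) (s.mem a) (π.Fc j) ∧
      t' ≤ t + (8 * π.k + 7)) s t := by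
  have hA := hV.hA1
  have hlt := Nat.mod_lt j (show 0 < 4 * π.s + 4 by omega)
  refine WP.seq (WP.load (7 * (j % (4 * π.s + 4)) + 2) (π.Pc j) hok ?_ (by omega)
    (hM.P j hji hij) ?_)
  · simp [hej s.reg fun _ _ => rfl, hC.s]
  refine WP.seq (WP.load a (s.mem a) hf (hfa _ ?_) haA rfl ?_)
  · intro y hy
    have : y ≠ Rfx := by rintro rfl; revert hy; decide
    simp [this]
  refine WP.seq (WP.load (7 * (j % (4 * π.s + 4))) (π.Fc j) hok' ?_ (by omega)
    (hM.F j hji hij) ?_)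
  · rw [Expr.nat_mul, Expr.nat_mod, hej]
    · simp [hC.s]
    · intro y hy
      have h1 : y ≠ Rfx := by rintro rfl; revert hy; decide
      have h2 : y ≠ Rfy := by rintro rfl; revert hy; decide
      simp [h1, h2]
  refine (fmaCmd_spec hV (x := π.Pc j) (y := s.mem a) (w := π.Fc j) ?_ (by simp) (by simp)
    (by simp)).mono fun s' t' _ _ h => ⟨h.1, by omega⟩
  refine hC.of_eq fun y hy => ?_
  have h1 : y ≠ Rfx := by rintro rfl; revert hy; decide
  have h2 : y ≠ Rfy := by rintro rfl; revert hy; decide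
  have h3 : y ≠ Rfw := by rintro rfl; revert hy; decide
  simp [h1, h2, h3]

/-- Increase the arm length `Rx` in steps of `Rd` as long as the fingerprint of the word with
midpoint `Rc` equals `RH`. -/
def scanCmd : Cmd 40 :=
  .assign Rfl (cn 1) ;;
  .loop (rg Rfl)
    (.ite (.bin .lt (rg Rx) (rg Rc + cn 1) * .bin .lt (rg Rc + rg Rx) (rg Ri + cn 1))
      (hashCmd (rg Rc + rg Rx) (cn 7 * ((rg Rc - rg Rx) / rg Rd) + cn 3) ;;
        .ite (.bin .eq (rg Rfz) (rg RH)) (.assign Rx (rg Rx + rg Rd)) (.assign Rfl (cn 0)))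
      (.assign Rfl (cn 0)))

/-- Result of scanning from arm length `x` to `x'` at time `i`. -/
structure ScanRes (π : Par) (i m H x x' : ℕ) : Prop where
  le : x ≤ x'
  pass : x' = x ∨ x + π.d ≤ x' ∧ x' ≤ m + π.d ∧ m + x' ≤ i + π.d ∧ π.Hc m (x' - π.d) = H
  dvd : x' ≤ m → π.d ∣ m - x'
  halt : m < x' ∨ i < m + x' ∨ π.Hc m x' ≠ H

set_option maxHeartbeats 1000000 in
-- Steps of `d` preserve `d ∣ m - x`, so the left end is always a checkpoint, while `hring` keeps
-- the right end inside the ring buffer. No correctness of fingerprints is assumed: `ScanRes` speaks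
-- of values of `Hc` only.
lemma scanCmd_spec (hV : π.Valid Γ) {s : State 40} (hC : Consts π s) {i m x H t : ℕ}
    (hM : HashMem π i s.mem) (hi : s.reg Ri = i) (hm : s.reg Rc = m) (hx : s.reg Rx = x)
    (hH : s.reg RH = H) (hin : i ≤ π.n + 3 * π.s + 2)
    (hring : i < m + x + (4 * π.s + 4)) (hdvd : x ≤ m → π.d ∣ m - x) :
    WP Γ scanCmd (fun s' t' => (∃ x', s'.reg Rx = x' ∧ ScanRes π i m H x x') ∧
      t' ≤ t + (8 * π.k + 15) * ((i + π.d - (m + x)) / π.d + 2)) s t := by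
  have hB := Γ.hB
  have hnB := hV.hnB
  have hds := hV.hds
  have hd := hV.hd
  have hsn := hV.s_le
  refine WP.seq (WP.assign 1 rfl rfl (by omega) ?_)
  -- The variant counts the arms that can still be tested and becomes 0 when the flag is cleared.
  -- The last clause prepays `8 * π.k + 15` ticks for each of the remaining rounds.
  refine WP.loop rfl (fun j s' t' => Consts π s' ∧ HashMem π i s'.mem ∧ s'.reg Ri = i ∧
    s'.reg Rc = m ∧ s'.reg RH = H ∧ ∃ x' fl, s'.reg Rx = x' ∧ s'.reg Rfl = fl ∧
      x ≤ x' ∧ (x' = x ∨ x + π.d ≤ x' ∧ x' ≤ m + π.d ∧ m + x' ≤ i + π.d ∧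
        π.Hc m (x' - π.d) = H) ∧ (x' ≤ m → π.d ∣ m - x') ∧
      (fl = 0 → m < x' ∨ i < m + x' ∨ π.Hc m x' ≠ H) ∧ fl ≤ 1 ∧
      j = fl * ((i + π.d - (m + x')) / π.d + 1) ∧
      t' + (8 * π.k + 15) * j ≤ t + 1 + (8 * π.k + 15) * ((i + π.d - (m + x)) / π.d + 1)) ?_ ?_ ?_
    (j := (i + π.d - (m + x)) / π.d + 1)
  · rintro j s t' ho ⟨hC, hM, hi, hm, hH, x', fl, hx, hfl, h1, h2, h3, h4, h5, rfl, h7⟩ hg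
    have hx'B : x' < Γ.B := hx ▸ ho.reg Rx
    have hfl1 : fl = 1 := by
      rw [Expr.nat_reg, hfl] at hg; omega
    subst hfl1
    have hhalt : m < x' ∨ i < m + x' ∨ π.Hc m x' ≠ H → ∀ s1 : State 40, ∀ t1, Consts π s1 →
        HashMem π i s1.mem → s1.reg Ri = i → s1.reg Rc = m → s1.reg RH = H → s1.reg Rx = x' →
        t1 ≤ t' + (8 * π.k + 13) → WP Γ (.assign Rfl (cn 0)) (fun s' t'' => ∃ j' <
          1 * ((i + π.d - (m + x')) / π.d + 1), Consts π s' ∧ HashMem π i s'.mem ∧ s'.reg Ri = i ∧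
          s'.reg Rc = m ∧ s'.reg RH = H ∧ ∃ x' fl, s'.reg Rx = x' ∧ s'.reg Rfl = fl ∧
          x ≤ x' ∧ (x' = x ∨ x + π.d ≤ x' ∧ x' ≤ m + π.d ∧ m + x' ≤ i + π.d ∧
            π.Hc m (x' - π.d) = H) ∧ (x' ≤ m → π.d ∣ m - x') ∧
          (fl = 0 → m < x' ∨ i < m + x' ∨ π.Hc m x' ≠ H) ∧ fl ≤ 1 ∧
          j' = fl * ((i + π.d - (m + x')) / π.d + 1) ∧
          t'' + (8 * π.k + 15) * j' ≤ t + 1 + (8 * π.k + 15) * ((i + π.d - (m + x)) / π.d + 1))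
          s1 t1 := by
      intro hs s1 t1 hC hM hi hm hH hx ht
      refine WP.assign 0 rfl rfl (by omega) ⟨0, by rw [one_mul]; exact Nat.succ_pos _, hC.of_eq ?_, by simpa using hM,
        by simpa using hi, by simpa using hm, by simpa using hH, x', 0, by simpa using hx,
        by simp, h1, h2, h3, fun _ => hs, by omega, by omega, ?_⟩
      · intro y hy
        have : y ≠ Rfl := by rintro rfl; revert hy; decide
        simp [this]
      · have : (8 * π.k + 15) * 1 ≤ (8 * π.k + 15) * (1 * ((i + π.d - (m + x')) / π.d + 1)) :=
          Nat.mul_le_mul_left _ (by rw [one_mul]; exact Nat.succ_pos _)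
        omega
    refine WP.ite rfl (fun hcond => ?_) (fun hcond => ?_)
    · have hcond : x' ≤ m ∧ m + x' ≤ i := by
        simp [hx, hm, hi] at hcond
        omega
      have hq : (m - x') / π.d * π.d = m - x' := Nat.div_mul_cancel (h3 hcond.1)
      refine WP.seq ((hashCmd_spec hV hC hM (j := m + x') (a := 7 * ((m - x') / π.d) + 3)
        rfl rfl rfl ?_ ?_ ?_ hcond.2 (by omega)).use ?_)
      · intro ρ hρ
        simp [hρ, hm, hx]
      · intro ρ hρ
        simp [hρ, hm, hx, hC.d]
      · have := hV.hA2 ((m - x') / π.d) (by omega)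
        omega
      intro s1 t1 hf _ ⟨hz, ht1⟩
      have hC1 := hC.frame hf (by decide)
      have hM1 : HashMem π i s1.mem := by rwa [hf.mem rfl]
      rw [hM.C _ (by omega), hq] at hz
      have hz : s1.reg Rfz = π.Hc m x' := hz
      have hx1 := (hf.reg Rx (by decide)).trans hx
      have hm1 := (hf.reg Rc (by decide)).trans hm
      have hi1 := (hf.reg Ri (by decide)).trans hi
      have hH1 := (hf.reg RH (by decide)).trans hH
      have hfl1 := (hf.reg Rfl (by decide)).trans hfl
      refine WP.ite rfl (fun he => ?_) (fun he => ?_)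
      · have he : π.Hc m x' = H := by simpa [hz, hH1] using he
        have hdiv : (i + π.d - (m + x')) / π.d = (i + π.d - (m + (x' + π.d))) / π.d + 1 := by
          rw [← Nat.add_div_right _ hd]; congr 1; omega
        refine WP.assign (x' + π.d) rfl (by simp [hx1, hC1.d]) (by omega)
          ⟨1 * ((i + π.d - (m + (x' + π.d))) / π.d + 1), by omega, hC1.of_eq ?_, by simpa using hM1,
          by simpa using hi1, by simpa using hm1, by simpa using hH1, x' + π.d, 1, by simp,
          by simpa using hfl1, by omega, Or.inr ⟨by omega, by omega, by omega, by simpa using he⟩,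
          ?_, by omega, le_rfl, rfl, ?_⟩
        · intro y hy
          have : y ≠ Rx := by rintro rfl; revert hy; decide
          simp [this]
        · intro hle
          have := Nat.dvd_sub (h3 hcond.1) (dvd_refl π.d)
          rwa [Nat.sub_sub] at this
        · rw [hdiv, one_mul, Nat.mul_add_one (8 * π.k + 15)] at h7
          rw [one_mul]
          omega
      · have he : π.Hc m x' ≠ H := by simpa [hz, hH1] using he
        exact hhalt (Or.inr (Or.inr he)) s1 _ hC1 hM1 hi1 hm1 hH1 hx1 (by omega)
    · have hcond : ¬ (x' ≤ m ∧ m + x' ≤ i) := by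
        simp [hx, hm, hi] at hcond
        omega
      exact hhalt (by omega) s _ hC hM hi hm hH hx (by omega)
  · rintro j s t' ho ⟨hC, hM, hi, hm, hH, x', fl, hx, hfl, h1, h2, h3, h4, h5, rfl, h7⟩ hg
    have hfl0 : fl = 0 := by rw [Expr.nat_reg, hfl] at hg; exact hg
    subst hfl0
    refine ⟨⟨x', hx, h1, h2, h3, h4 rfl⟩, ?_⟩
    generalize (i + π.d - (m + x)) / π.d = D at h7 ⊢
    rw [zero_mul, mul_zero, Nat.mul_add (8 * π.k + 15) D 1] at h7
    rw [Nat.mul_add (8 * π.k + 15) D 2]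
    omega
  · refine ⟨hC.of_eq ?_, by simpa using hM, by simpa using hi, by simpa using hm,
      by simpa using hH, x, 1, by simpa using hx, by simp, le_rfl, Or.inl rfl, hdvd, by omega,
      le_rfl, by omega, by omega⟩
    intro y hy
    have : y ≠ Rfl := by rintro rfl; revert hy; decide
    simp [this]

end PalStream

/-! ### Combinatorics of palindromes with close midpoints. -/

namespace PalStream

/-! ### Long palindromes with close midpoints -/

section Structure

variable {α : Type*}

/-- The two-sided infinite word `T` has an even palindrome with midpoint `m` and arms of
length `x`. -/
def PalZ (T : ℤ → α) (m x : ℤ) : Prop := ∀ i, 1 ≤ i → i ≤ x → T (m + 1 - i) = T (m + i)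

/-- `T` has period `p` on the interval `[a, b]`. -/
def PeriodOn (T : ℤ → α) (p a b : ℤ) : Prop := ∀ i, a ≤ i → i + p ≤ b → T i = T (i + p)

variable {T : ℤ → α} {m x p s : ℤ}

lemma PalZ.mono {y : ℤ} (h : PalZ T m x) (hy : y ≤ x) : PalZ T m y :=
  fun i h1 h2 => h i h1 (h2.trans hy)

lemma PalZ.eq (h : PalZ T m x) {a b : ℤ} (hab : a + b = 2 * m + 1) (h1 : b ≤ m + x)
    (h2 : a ≤ m + x) : T a = T b := by
  rcases le_or_gt a m with ha | ha
  · have := h (m + 1 - a) (by omega) (by omega)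
    rwa [show m + 1 - (m + 1 - a) = a by ring, show m + (m + 1 - a) = b by omega] at this
  · have := h (a - m) (by omega) (by omega)
    rw [show m + 1 - (a - m) = b by omega, show m + (a - m) = a by omega] at this
    exact this.symm

lemma PalZ.reflect : PalZ (fun i => T (1 - i)) (-m) x ↔ PalZ T m x := by
  unfold PalZ
  refine forall_congr' fun i => ?_
  beta_reduce
  rw [show 1 - (-m + 1 - i) = m + i by ring, show 1 - (-m + i) = m + 1 - i by ring]
  exact ⟨fun h h1 h2 => (h h1 h2).symm, fun h h1 h2 => (h h1 h2).symm⟩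

/-- The reflections at `m` and at `m + p` compose to the translation by `2 * p`. The two
inequalities keep the intermediate point inside both palindromes. -/
lemma PeriodOn.of_pal {y : ℤ} (h1 : PalZ T m x) (h2 : PalZ T (m + p) y)
    (hxy : x - p ≤ y) (hyx : y - p ≤ x) :
    PeriodOn T (2 * p) (m - x + 1) (m + p + y) := by
  intro i hi hi2
  have e1 : T i = T (2 * m + 1 - i) := by
    refine h1.eq (by ring) (by omega) (by omega)
  rw [e1]
  exact h2.eq (by ring) (by omega) (by omega)

/-- A pair outside the core of radius `s` is moved inwards by one period on each side, which
preserves its symmetry about `m`; as `2 * p ≤ s`, the pair does not cross the midpoint. -/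
lemma PeriodOn.pal (hT : PeriodOn T (2 * p) (m + 1 - x) (m + x)) (hs : PalZ T m s)
    (hp : 1 ≤ p) (hps : 2 * p ≤ s) : PalZ T m x := by
  have key : ∀ k : ℕ, ∀ i : ℤ, i.toNat = k → 1 ≤ i → i ≤ x → T (m + 1 - i) = T (m + i) := by
    intro k
    induction k using Nat.strong_induction_on with
    | _ k ih =>
      intro i hk h1 h2
      rcases le_or_gt i s with his | his
      · exact hs i h1 his
      · have e := ih (i - 2 * p).toNat (by omega) (i - 2 * p) rfl (by omega) (by omega)
        have e1 := hT (m + 1 - i) (by omega) (by omega)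
        have e2 := hT (m + (i - 2 * p)) (by omega) (by omega)
        rw [e1, show m + i = m + (i - 2 * p) + 2 * p by ring, ← e2, ← e]
        congr 1; ring
  exact fun i h1 h2 => key _ i rfl h1 h2

lemma PeriodOn.mul {a b : ℤ} (hT : PeriodOn T p a b) (hp : 0 ≤ p) (k : ℕ) {i : ℤ} (hi : a ≤ i)
    (hi2 : i + k * p ≤ b) : T i = T (i + k * p) := by
  induction k with
  | zero => simp
  | succ k ih =>
    push_cast at hi2 ⊢
    have hk : 0 ≤ (k : ℤ) * p := mul_nonneg (by positivity) hp
    have h1 := ih (by nlinarith)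
    have h2 := hT (i + k * p) (by omega) (by nlinarith)
    rw [h1, h2]
    congr 1; ring

lemma PeriodOn.mono {a b a' b' : ℤ} (hT : PeriodOn T p a b) (ha : a ≤ a') (hb : b' ≤ b) :
    PeriodOn T p a' b' := fun i h1 h2 => hT i (ha.trans h1) (h2.trans hb)

/-- Three long palindromes in a row: if the first gap is smaller than the second, there is another
long palindrome in the second gap. -/
lemma PalZ.between {m' m'' q : ℤ} (h1 : PalZ T m s) (h2 : PalZ T m' s) (h3 : PalZ T m'' s)
    (hp : m' = m + p) (hq : m'' = m' + q) (hp0 : 1 ≤ p) (hpq : p < q) (hqs : 2 * q ≤ s) :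
    PalZ T (m' + p) s := by
  subst hp; subst hq
  have P1 : PeriodOn T (2 * p) (m - s + 1) (m + p + s) :=
    PeriodOn.of_pal h1 h2 (by omega) (by omega)
  have P2 : PeriodOn T (2 * q) (m + p - s + 1) (m + p + q + s) :=
    PeriodOn.of_pal h2 h3 (by omega) (by omega)
  -- The right partner is shifted left by the period `2 * p` of the first two palindromes and then
  -- reflected at `m'`. This works while it stays within reach of the palindrome at `m'`.
  have near : ∀ a b : ℤ, a + b = 2 * (m + p + p) + 1 → a ≤ b → b ≤ m + p + s → T a = T b := by
    intro a b hab hle hb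
    have e1 : T (b - 2 * p) = T b := by
      have := P1 (b - 2 * p) (by omega) (by omega)
      rwa [show b - 2 * p + 2 * p = b by ring] at this
    rw [← e1]
    exact h2.eq (by omega) (by omega) (by omega)
  intro i hi1 hi2
  rcases le_or_gt (p + i) s with hc | hc
  · exact near _ _ (by ring) (by omega) (by omega)
  -- A pair that reaches too far is moved inwards by the period `2 * q` of the last two palindromes.
  -- Its members may change sides, whence the two cases.
  · have e1 := P2 (m + p + p + 1 - i) (by omega) (by omega)
    have e2 : T (m + p + p + i - 2 * q) = T (m + p + p + i) := by
      have := P2 (m + p + p + i - 2 * q) (by omega) (by omega)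
      rwa [show m + p + p + i - 2 * q + 2 * q = m + p + p + i by ring] at this
    rw [e1, ← e2]
    rcases le_total (m + p + p + 1 - i + 2 * q) (m + p + p + i - 2 * q) with hle | hle
    · exact near _ _ (by ring) hle (by omega)
    · exact (near _ _ (by ring) hle (by omega)).symm

/-- If the gaps differ, the larger one contains another long midpoint, by `PalZ.between` or by its
mirror image. This is what makes a run an arithmetic progression. -/
lemma PalZ.gap_eq {m' m'' q : ℤ} (h1 : PalZ T m s) (h2 : PalZ T m' s) (h3 : PalZ T m'' s)
    (hp : m' = m + p) (hq : m'' = m' + q) (hp0 : 1 ≤ p) (hq0 : 1 ≤ q) (hps : 2 * p ≤ s)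
    (hqs : 2 * q ≤ s) (hn1 : ∀ c, m < c → c < m' → ¬ PalZ T c s)
    (hn2 : ∀ c, m' < c → c < m'' → ¬ PalZ T c s) : p = q := by
  rcases lt_trichotomy p q with h | h | h
  · exact absurd (PalZ.between h1 h2 h3 hp hq hp0 h hqs) (hn2 _ (by omega) (by omega))
  · exact h
  · have := PalZ.between (T := fun i => T (1 - i)) (m := -m'') (m' := -m') (m'' := -m) (p := q)
      (q := p) (PalZ.reflect.2 h3) (PalZ.reflect.2 h2) (PalZ.reflect.2 h1) (by omega) (by omega)
      hq0 h hps
    rw [show -m' + q = -(m' - q) by ring, PalZ.reflect] at this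
    exact absurd this (hn1 _ (by omega) (by omega))

/-- A maximal run of long palindromes with midpoints `m, m + p, …, m + (k - 1) p`. -/
structure LongRun (T : ℤ → α) (s m p : ℤ) (k : ℕ) : Prop where
  long : ∀ j : ℕ, j < k → PalZ T (m + j * p) s
  step : 1 ≤ p
  close : 2 * p ≤ s
  left : ¬ PalZ T (m - p) s
  right : ¬ PalZ T (m + k * p) s

variable {k : ℕ}

/-- Adjacent palindromes give period `2 * p` on intervals that overlap so much that every pair at
distance `2 * p` lies in one of them. Longer arms `x` at the first midpoint extend the period to the
left, up to `s + p`, beyond which `PeriodOn.of_pal` does not apply. -/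
lemma periodOn_of_long (hl : ∀ j : ℕ, j < k → PalZ T (m + j * p) s)
    (h2 : 2 * p ≤ s) (hx : PalZ T m x) (hsx : s ≤ x) (hxs : x ≤ s + p) (hk : 2 ≤ k) :
    PeriodOn T (2 * p) (m - x + 1) (m + (k - 1) * p + s) := by
  induction k, hk using Nat.le_induction with
  | base =>
    have := hl 1 (by omega)
    norm_num at this ⊢
    exact PeriodOn.of_pal hx this (by omega) (by omega)
  | succ k hk ih =>
    have P1 := ih fun j hj => hl j (by omega)
    have h3 := hl (k - 1) (by omega)
    have h4 := hl k (by omega)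
    push_cast [Nat.cast_sub (show 1 ≤ k by omega)] at h3
    have P2 := PeriodOn.of_pal (p := p) h3 (y := s)
      (by rwa [show m + ((k : ℤ) - 1) * p + p = m + k * p by ring]) (by omega)
      (by omega)
    intro i hi hi2
    push_cast at hi2
    rcases le_or_gt (i + 2 * p) (m + (k - 1) * p + s) with hc | hc
    · exact P1 i hi hc
    · refine P2 i (by omega) ?_
      linarith

/-- Arms of length `s + p` at `m`, together with the period `2 * p`, would make `m - p` long as
well, against the maximality of the run on the left. -/
lemma LongRun.first_lt (h : LongRun T s m p k) (hk : 2 ≤ k) (hx : PalZ T m x) : x < s + p := by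
  by_contra hcon
  push Not at hcon
  have h1 := h.step
  have h2 := h.close
  have P := periodOn_of_long h.long h2 (by simpa using h.long 0 (by omega) : PalZ T m s) le_rfl
    (by omega) hk
  refine h.left fun i hi1 hi2 => ?_
  have hkp : p ≤ ((k : ℤ) - 1) * p := by
    have : (2 : ℤ) ≤ k := by exact_mod_cast hk
    nlinarith
  have e := P (m - p + i) (by omega) (by omega)
  rw [e]
  exact hx.eq (by ring) (by omega) (by omega)

/-- The palindromes at `m` and at `m + j * p` end at the same left position, where the period breaks
off; `2 * j + 1 < k` keeps the right end inside the periodic part. Hence one estimate, at `m`,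
serves the whole left half. -/
lemma LongRun.left_half (h : LongRun T s m p k) {j : ℕ} (hj : 2 * j + 1 < k) (y : ℕ) :
    PalZ T (m + j * p) (y + j * p) ↔ PalZ T m y := by
  have h1 := h.step
  have h2 := h.close
  have hk : 2 ≤ k := by omega
  have h0 : PalZ T m s := by simpa using h.long 0 (by omega)
  have hjp : 0 ≤ (j : ℤ) * p := by positivity
  have hjk : 2 * (j * p) + p ≤ ((k : ℤ) - 1) * p := by
    have : (2 * j + 2 : ℤ) ≤ k := by exact_mod_cast hj
    nlinarith
  constructor
  · intro hy
    induction y with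
    | zero => intro i hi1 hi2; simp at hi2; omega
    | succ y ih =>
      push_cast at hy ⊢
      have ih := ih (hy.mono (by omega))
      have hlt := h.first_lt hk ih
      intro i hi1 hi2
      rcases lt_or_eq_of_le hi2 with hi | rfl
      · exact ih i hi1 (by omega)
      have P := periodOn_of_long h.long h2 h0 le_rfl (by omega) hk
      have e1 := hy (y + 1 + j * p) (by omega) le_rfl
      -- The outermost right symbol of the palindrome at `m` is moved `j` periods to the right, onto
      -- the outermost right symbol of the palindrome at `m + j * p`; both palindromes share the
      -- left symbol.
      have e2 := P.mul (by omega) j (i := m + (y + 1)) (by omega) (by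
        rw [show (j : ℤ) * (2 * p) = 2 * (j * p) by ring]; omega)
      rw [e2, show m + 1 - ((y : ℤ) + 1) = m + j * p + 1 - (y + 1 + j * p) by ring, e1]
      congr 1; ring
  · intro hy
    have hlt := h.first_lt hk hy
    rcases le_total s y with hsy | hsy
    · have P := periodOn_of_long h.long h2 hy hsy (by omega) hk
      refine PeriodOn.pal (P.mono (by omega) (by omega)) (h.long j (by omega)) h1 h2
    · have P := periodOn_of_long h.long h2 h0 le_rfl (by omega) hk
      refine PeriodOn.pal (P.mono (by omega) (by omega)) (h.long j (by omega)) h1 h2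

lemma LongRun.reflect (h : LongRun T s m p k) :
    LongRun (fun i => T (1 - i)) s (-(m + (k - 1) * p)) p k where
  long j hj := by
    have := h.long (k - 1 - j) (by omega)
    rw [← PalZ.reflect] at this
    convert this using 1
    push_cast [Nat.cast_sub (show j ≤ k - 1 by omega), Nat.cast_sub (show 1 ≤ k by omega)]
    ring
  step := h.step
  close := h.close
  left := by
    rw [show -(m + ((k : ℤ) - 1) * p) - p = -(m + k * p) by ring, PalZ.reflect]
    exact h.right
  right := by
    rw [show -(m + ((k : ℤ) - 1) * p) + k * p = -(m - p) by ring, PalZ.reflect]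
    exact h.left

lemma LongRun.last_lt (h : LongRun T s m p k) (hk : 2 ≤ k) (hx : PalZ T (m + (k - 1) * p) x) :
    x < s + p := h.reflect.first_lt hk (PalZ.reflect.2 hx)

lemma LongRun.right_half (h : LongRun T s m p k) {j : ℕ} (hj : j < k) (hj' : k < 2 * j + 1)
    (y : ℕ) :
    PalZ T (m + j * p) (y + (k - 1 - j : ℕ) * p) ↔ PalZ T (m + (k - 1) * p) y := by
  have := h.reflect.left_half (j := k - 1 - j) (by omega) y
  rw [PalZ.reflect] at this
  rw [← this, ← PalZ.reflect]
  push_cast [Nat.cast_sub (show j ≤ k - 1 by omega), Nat.cast_sub (show 1 ≤ k by omega)]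
  rw [show -(m + (j : ℤ) * p) = -(m + (k - 1) * p) + (k - 1 - j) * p by ring]

/-- The periodic interval is symmetric about the middle midpoint, so it yields arms that reach both
of its ends. There is no upper bound: the two ends are mirror images, and the palindrome may
continue beyond them. -/
lemma middle_of_long (hl : ∀ j : ℕ, j < k → PalZ T (m + j * p) s) (h1 : 2 ≤ k → 1 ≤ p)
    (h2 : 2 ≤ k → 2 * p ≤ s) {j : ℕ} (hj : 2 * j + 1 = k) : PalZ T (m + j * p) (s + j * p) := by
  rcases Nat.lt_or_ge k 2 with hk | hk
  · have hj0 : j = 0 := by omega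
    subst hj0
    simpa using hl 0 (by omega)
  · have h0 : PalZ T m s := by simpa using hl 0 (by omega)
    have h1 := h1 hk
    have P := periodOn_of_long hl (h2 hk) h0 le_rfl (by omega) hk
    have e : ((k : ℤ) - 1) * p = 2 * (j * p) := by
      rw [← hj]; push_cast; ring
    exact PeriodOn.pal (P.mono (by omega) (by omega)) (hl j (by omega)) h1 (h2 hk)

end Structure

end PalStream

/-! ### Fingerprints as polynomials over a quadratic extension, and counting of bad evaluation
points. -/

namespace PalStream

/-! ### Fingerprints as polynomials -/

section Decode

variable (p g : ℕ)

/-- Entry `l` of the vector coded by `x`. -/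
def dec (l x : ℕ) : QuadraticAlgebra (ZMod p) (g : ZMod p) 0 :=
  ⟨(x / (p * p) ^ l : ℕ), (x / (p * p) ^ l / p : ℕ)⟩

variable {p g}

lemma dec_succ (l x : ℕ) : dec p g (l + 1) x = dec p g l (x / (p * p)) := by
  simp only [dec, pow_succ', Nat.div_div_eq_div_mul]

lemma dec_add (l l' x : ℕ) : dec p g (l + l') x = dec p g l (x / (p * p) ^ l') := by
  simp only [dec, pow_add, Nat.div_div_eq_div_mul, mul_comm ((p * p) ^ l)]

lemma dec_zero_right (l : ℕ) : dec p g l 0 = 0 := by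
  ext <;> simp [dec]

/-- With respect to 1 and √g, the two sums in `fmaCode` are the components of product plus addend.
Reductions modulo `p` and higher digits, which are multiples of `p`, vanish in `ZMod p`. -/
lemma dec_fmaCode (hp : 0 < p) {k l : ℕ} (hl : l < k) (x y w : ℕ) :
    dec p g l (fmaCode p g k x y w) = dec p g l x * dec p g l y + dec p g l w := by
  induction k generalizing l x y w with
  | zero => omega
  | succ k ih =>
    rw [fmaCode]
    have h0 := Nat.mod_lt (x % p * (y % p) + x / p % p * (y / p % p) * g + w % p) hp
    have h1 := Nat.mod_lt (x % p * (y / p % p) + x / p % p * (y % p) + w / p % p) hp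
    cases l with
    | zero =>
      ext
      · simp only [dec, pow_zero, Nat.div_one, QuadraticAlgebra.re_add, QuadraticAlgebra.re_mul]
        push_cast
        simp only [ZMod.natCast_mod, CharP.cast_eq_zero, mul_zero, zero_mul, add_zero]
        push_cast
        simp only [ZMod.natCast_mod]
        ring
      · have e : ((x % p * (y % p) + x / p % p * (y / p % p) * g + w % p) % p
            + (x % p * (y / p % p) + x / p % p * (y % p) + w / p % p) % p * p
            + p * p * fmaCode p g k (x / (p * p)) (y / (p * p)) (w / (p * p))) / p
            = (x % p * (y / p % p) + x / p % p * (y % p) + w / p % p) % p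
              + p * fmaCode p g k (x / (p * p)) (y / (p * p)) (w / (p * p)) := by
          rw [add_assoc, mul_assoc p p, mul_comm _ p, ← mul_add, Nat.add_mul_div_left _ _ hp,
            Nat.div_eq_of_lt h0, zero_add]
        simp only [dec, pow_zero, Nat.div_one, QuadraticAlgebra.im_add, QuadraticAlgebra.im_mul, e]
        push_cast
        simp only [ZMod.natCast_mod, CharP.cast_eq_zero, zero_mul, add_zero]
        push_cast
        simp only [ZMod.natCast_mod]
    | succ l =>
      have e : ((x % p * (y % p) + x / p % p * (y / p % p) * g + w % p) % p
            + (x % p * (y / p % p) + x / p % p * (y % p) + w / p % p) % p * p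
            + p * p * fmaCode p g k (x / (p * p)) (y / (p * p)) (w / (p * p))) / (p * p)
            = fmaCode p g k (x / (p * p)) (y / (p * p)) (w / (p * p)) := by
        rw [Nat.add_mul_div_left _ _ (Nat.mul_pos hp hp),
          Nat.div_eq_of_lt (add_mul_lt_mul_self h0 h1), zero_add]
      simp only [dec_succ, e]
      exact ih (by omega) _ _ _

lemma dec_injOn {k x y : ℕ} (hx : x < (p * p) ^ k) (hy : y < (p * p) ^ k)
    (h : ∀ l < k, dec p g l x = dec p g l y) : x = y := by
  induction k generalizing x y with
  | zero => simp at hx hy; omega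
  | succ k ih =>
    have h0 := h 0 (by omega)
    simp only [dec, pow_zero, Nat.div_one, QuadraticAlgebra.mk.injEq, ZMod.natCast_eq_natCast_iff']
      at h0
    have e : x / (p * p) = y / (p * p) := by
      refine ih (Nat.div_lt_of_lt_mul (by rwa [pow_succ'] at hx))
        (Nat.div_lt_of_lt_mul (by rwa [pow_succ'] at hy)) fun l hl => ?_
      rw [← dec_succ, ← dec_succ]
      exact h _ (by omega)
    have e1 := Nat.div_add_mod x (p * p)
    have e2 := Nat.div_add_mod y (p * p)
    rw [Nat.mod_mul] at e1 e2
    rw [← e1, ← e2, e, h0.1, h0.2]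

end Decode

namespace Par

variable (π : Par)

lemma dec_Pc (hp : 0 < π.p) {l : ℕ} (hl : l < π.k) (i : ℕ) :
    dec π.p π.g l (π.Pc i) = dec π.p π.g l π.r ^ (i + 1) := by
  induction i with
  | zero => simp [Pc]
  | succ i ih => rw [Pc, fma, dec_fmaCode hp hl, ih, dec_zero_right, add_zero, pow_succ' _ (i + 1)]

/-- When the arm grows by one, `Gc` loses the symbol at `m - x`, which was mirrored to exponent `m +
x + 1`, and `Fc` gains the actual symbol at position `m + x + 1`. All other terms keep their
exponents. -/
lemma dec_Hc (hp : 0 < π.p) {l : ℕ} (hl : l < π.k) {m x : ℕ} (hx : x ≤ m) :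
    dec π.p π.g l (π.Hc m x) = dec π.p π.g l (π.Hc m 0) + ∑ i ∈ Finset.range x,
      (dec π.p π.g l (π.T (m + i + 1) * π.E) - dec π.p π.g l (π.T (m - i) * π.E))
        * dec π.p π.g l π.r ^ (m + i + 1) := by
  induction x with
  | zero => simp
  | succ x ih =>
    rw [Finset.sum_range_succ, ← add_assoc, ← ih (by omega)]
    obtain ⟨c, hc⟩ : ∃ c, m - x = c + 1 := ⟨m - x - 1, by omega⟩
    rw [Hc, Hc, show m - (x + 1) = c by omega, hc, Gc, ← add_assoc m x 1, Fc]
    simp only [fma, dec_fmaCode hp hl]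
    rw [dec_Pc π hp hl, dec_Pc π hp hl]
    ring

variable {π}

lemma Hc_lt (hp : 0 < π.p) (m x : ℕ) : π.Hc m x < (π.p * π.p) ^ π.k := fmaCode_lt hp _ _ _ _ _

/-- The error is one-sided: a palindrome passes its test for every evaluation point, so `Par.Good`
only has to state the converse. -/
lemma Pal.Hc_eq (hp : 0 < π.p) {m x : ℕ} (h : π.Pal m x) : π.Hc m x = π.Hc m 0 := by
  refine dec_injOn (g := π.g) (Hc_lt hp _ _) (Hc_lt hp _ _) fun l hl => ?_
  rw [dec_Hc π hp hl h.1, Finset.sum_eq_zero, add_zero]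
  intro i hi
  have := h.2 (i + 1) (by omega) (by simpa using hi)
  rw [Nat.add_sub_add_right, ← add_assoc] at this
  rw [this, sub_self, zero_mul]

/-- `E` repeats a word of `L` digits `t` times. -/
def rep (Q : ℕ) : ℕ → ℕ
  | 0 => 0
  | t + 1 => rep Q t * Q + 1

lemma mul_rep_lt {Q T : ℕ} (hT : T < Q) (t : ℕ) : T * rep Q t < Q ^ t := by
  induction t with
  | zero => simp [rep]
  | succ t ih => rw [rep, pow_succ]; nlinarith

lemma mul_rep_div {Q T : ℕ} (hT : T < Q) {c t : ℕ} (hc : c ≤ t) :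
    T * rep Q t / Q ^ c = T * rep Q (t - c) := by
  induction c generalizing t with
  | zero => simp
  | succ c ih =>
    obtain ⟨t, rfl⟩ : ∃ u, t = u + 1 := ⟨t - 1, by omega⟩
    have e : T * rep Q (t + 1) / Q = T * rep Q t := by
      rw [rep, show T * (rep Q t * Q + 1) = T + Q * (T * rep Q t) by ring,
        Nat.add_mul_div_left _ _ (by omega), Nat.div_eq_of_lt hT, zero_add]
    rw [pow_succ', ← Nat.div_div_eq_div_mul, e, ih (by omega), Nat.add_sub_add_right]

lemma dec_mod_pow {p g L l x : ℕ} (hl : l < L) :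
    dec p g l (x % (p * p) ^ L) = dec p g l x := by
  obtain ⟨u, rfl⟩ : ∃ u, L = l + (u + 1) := ⟨L - l - 1, by omega⟩
  rw [pow_add, pow_succ']
  simp only [dec]
  rw [Nat.mod_mul_right_div_self]
  congr 1
  · rw [ZMod.natCast_eq_natCast_iff', mul_assoc, Nat.mod_mul_right_mod]
  · rw [ZMod.natCast_eq_natCast_iff', mul_assoc, Nat.mod_mul_right_div_self,
      Nat.mod_mul_right_mod]

/-- Multiplication by `E` places `t` copies of the digits of `T` side by side. Digit `l` then meets
`t` coordinates of the random point, which are independent of each other. -/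
lemma dec_mul_rep {p g L t T l c : ℕ} (hT : T < (p * p) ^ L) (hl : l < L) (hc : c < t) :
    dec p g (l + L * c) (T * rep ((p * p) ^ L) t) = dec p g l T := by
  rw [dec_add, pow_mul, mul_rep_div hT hc.le, ← dec_mod_pow hl]
  obtain ⟨u, hu⟩ : ∃ u, t - c = u + 1 := ⟨t - c - 1, by omega⟩
  rw [hu, rep, show T * (rep ((p * p) ^ L) u * (p * p) ^ L + 1)
    = T + (p * p) ^ L * (T * rep ((p * p) ^ L) u) by ring, Nat.add_mul_mod_self_left,
    Nat.mod_eq_of_lt hT]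

end Par

/-! ### Few evaluation points are bad -/

section Count

open Polynomial

noncomputable instance {R : Type*} [Fintype R] (a b : R) : Fintype (QuadraticAlgebra R a b) :=
  Fintype.ofEquiv _ (QuadraticAlgebra.equivProd a b).symm

lemma card_quadraticAlgebra {R : Type*} [Fintype R] (a b : R) :
    Fintype.card (QuadraticAlgebra R a b) = Fintype.card R * Fintype.card R := by
  rw [Fintype.card_congr (QuadraticAlgebra.equivProd a b), Fintype.card_prod]

lemma prod_range_ite_mod (a b : ℕ) {L l : ℕ} (hl : l < L) (t : ℕ) :
    ∏ j ∈ Finset.range (t * L), (if j % L = l then a else b) = (a * b ^ (L - 1)) ^ t := by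
  induction t with
  | zero => simp
  | succ t ih =>
    rw [Nat.add_one_mul, Finset.prod_range_add, ih, pow_succ]
    congr 1
    have : ∀ j ∈ Finset.range L, (if (t * L + j) % L = l then a else b)
        = if j = l then a else b := by
      intro j hj
      rw [mul_comm, Nat.mul_add_mod, Nat.mod_eq_of_lt (by simpa using hj)]
    rw [Finset.prod_congr rfl this, Finset.prod_ite, Finset.prod_const, Finset.prod_const,
      Finset.filter_eq' , if_pos (by simpa using hl), Finset.card_singleton, pow_one,
      Finset.filter_ne', Finset.card_erase_of_mem (by simpa using hl), Finset.card_range]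

variable {p g : ℕ} [Fact p.Prime]

/-- The coordinates determine `r`. Of the `t * L` coordinates, `t` are confined to `Z`, and each of
the others has `p * p` values. -/
lemma card_dec_mem_le {L l t z : ℕ} (hl : l < L)
    (Z : Finset (QuadraticAlgebra (ZMod p) (g : ZMod p) 0)) (hZ : Z.card ≤ z) :
    ((Finset.range ((p * p) ^ (t * L))).filter
      fun r => ∀ c < t, dec p g (l + L * c) r ∈ Z).card ≤ (z * (p * p) ^ (L - 1)) ^ t := by
  classical
  have hp : 0 < p := (Fact.out : p.Prime).pos
  let B : Fin (t * L) → Finset (QuadraticAlgebra (ZMod p) (g : ZMod p) 0) :=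
    fun j => if j.val % L = l then Z else Finset.univ
  calc _ ≤ (Fintype.piFinset B).card := by
        refine Finset.card_le_card_of_injOn (fun r j => dec p g j r) ?_ ?_
        · intro r hr
          simp only [Finset.coe_filter, Finset.mem_range, Set.mem_ofPred_eq] at hr
          simp only [Finset.mem_coe, Fintype.mem_piFinset, B]
          intro j
          split_ifs with hj
          · have := hr.2 (j / L) (Nat.div_lt_of_lt_mul (lt_of_lt_of_eq j.2 (mul_comm _ _)))
            rwa [← hj, Nat.mod_add_div] at this
          · simp
        · intro x hx y hy hxy
          simp only [Finset.coe_filter, Finset.mem_range, Set.mem_ofPred_eq] at hx hy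
          exact dec_injOn (g := g) hx.1 hy.1 fun l hl => congrFun hxy ⟨l, hl⟩
    _ = ∏ j ∈ Finset.range (t * L), (if j % L = l then Z.card else p * p) := by
        rw [Fintype.card_piFinset, Finset.prod_range]
        refine Finset.prod_congr rfl fun j _ => ?_
        simp only [B]
        split_ifs
        · rfl
        · rw [Finset.card_univ, card_quadraticAlgebra, ZMod.card]
    _ ≤ _ := by
        rw [prod_range_ite_mod _ _ hl]
        gcongr

variable [hns : Fact (∀ r : ZMod p, r ^ 2 ≠ (g : ZMod p) + 0 * r)]

/-- The evaluation points for which the words of length `x` on both sides of `m` have the same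
fingerprint though they are no palindrome. -/
lemma card_not_pal_le {π : Par} (hp : π.p = p) (hg : π.g = g) {L t : ℕ}
    (hE : π.E = Par.rep ((p * p) ^ L) t) (hk : π.k = t * L) (hT : ∀ j, π.T j < (p * p) ^ L)
    {m x : ℕ} (hx : x ≤ m) (hm : m ≤ π.n) (hpal : ¬ π.Pal m x) :
    ((Finset.range ((p * p) ^ (t * L))).filter
      fun r => ({π with r := r} : Par).Hc m x = ({π with r := r} : Par).Hc m 0).card
      ≤ (2 * π.n * (p * p) ^ (L - 1)) ^ t := by
  classical
  have hp0 : 0 < p := (Fact.out : p.Prime).pos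
  obtain ⟨i, hi1, hi2, hi⟩ : ∃ i, 1 ≤ i ∧ i ≤ x ∧ π.T (m + 1 - i) ≠ π.T (m + i) := by
    by_contra hcon
    push Not at hcon
    exact hpal ⟨hx, hcon⟩
  obtain ⟨l, hl, hne⟩ : ∃ l < L, dec p g l (π.T (m + 1 - i)) ≠ dec p g l (π.T (m + i)) := by
    by_contra hcon
    push Not at hcon
    exact hi (dec_injOn (hT _) (hT _) hcon)
  -- The difference of the two fingerprints in the digit `l` where the symbols differ. Distinct
  -- indices have distinct exponents, so the mismatch at `i` gives a nonzero coefficient.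
  let D : (QuadraticAlgebra (ZMod p) (g : ZMod p) 0)[X] := ∑ i ∈ Finset.range x,
    C (dec p g l (π.T (m + i + 1)) - dec p g l (π.T (m - i))) * X ^ (m + i + 1)
  have hD0 : D ≠ 0 := by
    intro h0
    have hc : D.coeff (m + i) = 0 := by rw [h0, coeff_zero]
    simp only [D, finsetSum_coeff, coeff_C_mul, coeff_X_pow] at hc
    rw [Finset.sum_eq_single (i - 1)] at hc
    · rw [if_pos (by omega), mul_one, sub_eq_zero, show m + (i - 1) + 1 = m + i by omega,
        show m - (i - 1) = m + 1 - i by omega] at hc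
      exact hne hc.symm
    · intro b _ hb
      rw [if_neg (by omega), mul_zero]
    · intro hb
      simp at hb
      omega
  have hdeg : D.natDegree ≤ 2 * π.n := by
    refine natDegree_sum_le_of_forall_le _ _ fun j hj => ?_
    refine (natDegree_C_mul_X_pow_le _ _).trans ?_
    have := Finset.mem_range.1 hj
    omega
  refine le_trans (Finset.card_le_card ?_) (card_dec_mem_le hl D.roots.toFinset
    (z := 2 * π.n) ?_)
  · intro r hr
    simp only [Finset.mem_filter] at hr ⊢
    -- Equality of the fingerprints forces each of the `t` coordinates `l + L * c` of `r` to be a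
    -- root of the same polynomial `D`.
    refine ⟨hr.1, fun c hc => ?_⟩
    rw [Multiset.mem_toFinset, mem_roots hD0, IsRoot.def, eval_finsetSum]
    have hlk : l + L * c < π.k := by rw [hk]; nlinarith
    have := Par.dec_Hc {π with r := r} (by rw [← hp] at hp0; exact hp0) hlk hx
    rw [hr.2, left_eq_add] at this
    subst hp hg
    rw [← this]
    refine Finset.sum_congr rfl fun j _ => ?_
    have hTE : ∀ j, dec π.p π.g (l + L * c) (({π with r := r} : Par).T j *
        ({π with r := r} : Par).E) = dec π.p π.g l (π.T j) := by
      intro j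
      change dec π.p π.g (l + L * c) (π.T j * π.E) = _
      rw [hE, Par.dec_mul_rep (hT j) hl hc]
    simp only [eval_mul, eval_C, eval_pow, eval_X, hTE]
  · exact (Multiset.toFinset_card_le _).trans ((card_roots' _).trans hdeg)

end Count

end PalStream

/-! ### From palindromes of the padded stream to the invariants of a run, and the closing of a run.
-/

namespace PalStream

/-! ### Palindromes of the padded stream -/

namespace Par

variable (π : Par)

/-- The padded stream as a two-sided word which has no palindrome across its left end. -/
def TZ (j : ℤ) : ℤ := if j ≤ 0 then j - 1 else π.T j.toNat

variable {π}

lemma TZ_natCast {j : ℕ} (hj : 1 ≤ j) : π.TZ j = π.T j := by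
  rw [TZ, if_neg (by omega), Int.toNat_natCast]

lemma palZ_iff {m x : ℕ} : PalZ π.TZ m x ↔ π.Pal m x := by
  constructor
  · intro h
    have hx : x ≤ m := by
      by_contra hcon
      -- Arms longer than `m` would compare position 0, which carries -1, with a position whose
      -- value is nonnegative.
      have := h (m + 1) (by omega) (by omega)
      rw [sub_self, TZ, if_pos le_rfl, TZ, if_neg (by omega)] at this
      omega
    refine ⟨hx, fun i h1 h2 => ?_⟩
    have := h i (by omega) (by omega)
    rw [show (m : ℤ) + 1 - i = ((m + 1 - i : ℕ) : ℤ) by omega, ← Nat.cast_add,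
      TZ_natCast (by omega), TZ_natCast (by omega)] at this
    exact_mod_cast this
  · rintro ⟨hx, h⟩ i h1 h2
    obtain ⟨j, rfl⟩ := Int.eq_ofNat_of_zero_le (by omega : 0 ≤ i)
    have := h j (by omega) (by omega)
    rw [show (m : ℤ) + 1 - j = ((m + 1 - j : ℕ) : ℤ) by omega, ← Nat.cast_add,
      TZ_natCast (by omega), TZ_natCast (by omega), this]

lemma Pal.mono {m x y : ℕ} (h : π.Pal m x) (hy : y ≤ x) : π.Pal m y :=
  ⟨hy.trans h.1, fun i h1 h2 => h.2 i h1 (h2.trans hy)⟩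

lemma pal_zero (m : ℕ) : π.Pal m 0 := ⟨Nat.zero_le _, fun i h1 h2 => by omega⟩

/-- Palindromes do not cross the right end: position `n + 1` carries 0, while its mirror image
carries a symbol increased by one. -/
lemma Pal.add_le {m x : ℕ} (h : π.Pal m x) (hm : m ≤ π.n) : m + x ≤ π.n := by
  by_contra hcon
  have := h.2 (π.n + 1 - m) (by omega) (by omega)
  have h1 := h.1
  rw [T, if_pos (by omega), T, if_neg (by omega)] at this
  omega

/-- The estimate `q.2` for the midpoint `q.1` is accurate. -/
def Acc (π : Par) (q : ℕ × ℕ) : Prop := π.Pal q.1 q.2 ∧ ¬ π.Pal q.1 (q.2 + π.d)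

lemma gap_eq {m p q s : ℕ} (h1 : π.Pal m s) (h2 : π.Pal (m + p) s) (h3 : π.Pal (m + p + q) s)
    (hp0 : 1 ≤ p) (hq0 : 1 ≤ q) (hps : 2 * p ≤ s) (hqs : 2 * q ≤ s)
    (hn1 : ∀ c, m < c → c < m + p → ¬ π.Pal c s)
    (hn2 : ∀ c, m + p < c → c < m + p + q → ¬ π.Pal c s) : p = q := by
  have := PalZ.gap_eq (palZ_iff.2 h1) (palZ_iff.2 h2) (palZ_iff.2 h3) (p := p) (q := q)
    (by push_cast; ring) (by push_cast; ring) (by omega) (by omega) (by omega) (by omega) ?_ ?_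
  · exact_mod_cast this
  · intro c hc1 hc2
    obtain ⟨c, rfl⟩ := Int.eq_ofNat_of_zero_le (by omega : 0 ≤ c)
    rw [palZ_iff]
    exact hn1 c (by omega) (by omega)
  · intro c hc1 hc2
    obtain ⟨c, rfl⟩ := Int.eq_ofNat_of_zero_le (by omega : 0 ≤ c)
    rw [palZ_iff]
    exact hn2 c (by omega) (by omega)

end Par

/-! ### Runs of long palindromes -/

variable {π : Par} {Γ : Env}

/-- Bounds for the current run of long palindromes after the midpoints up to `c`. There are `k`
midpoints, from `a` to `b`, with spacing `p`. -/
structure RunOk (π : Par) (c k a p b : ℕ) : Prop where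
  last : 0 < k → b = a + (k - 1) * p
  sfst : 0 < k → π.s ≤ a
  lastc : 0 < k → b ≤ c
  cle : 0 < k → c ≤ b + π.s / 2
  lastn : 0 < k → b ≤ π.n

/-- The estimate `e` for `m` is accurate unless it is large. -/
def Est (π : Par) (m e : ℕ) : Prop := π.Pal m e ∧ (π.Pal m (e + π.d) → 2 * π.s < e + π.d)

/-- The current run consists of all long palindromes since its start. -/
structure RunGood (π : Par) (c k a p b ea eb : ℕ) : Prop where
  none : k = 0 → ∀ m, m ≤ c → m ≤ π.n → π.Pal m π.s → m + π.s / 2 ≤ c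
  long : ∀ j < k, π.Pal (a + j * p) π.s
  all : 0 < k → ∀ m, a ≤ m → m ≤ c → m ≤ π.n → π.Pal m π.s → ∃ j < k, m = a + j * p
  before : 0 < k → ∀ m, m < a → π.Pal m π.s → m + π.s / 2 + 1 ≤ a
  gap : 2 ≤ k → 1 ≤ p ∧ p ≤ π.s / 2
  efst : 0 < k → Est π a ea
  elast : 0 < k → Est π b eb

/-- Maximality on the left comes from `before`, as `p ≤ s / 2`. On the right, `b + p` does not
exceed `c = b + s / 2`, so it has already been examined and would belong to the run. -/
lemma RunGood.longRun {c k a p b ea eb : ℕ} (hO : RunOk π c k a p b)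
    (hG : RunGood π c k a p b ea eb) (hk : 2 ≤ k) (hc : c = b + π.s / 2) :
    LongRun π.TZ π.s a p k := by
  have hg := hG.gap hk
  have ha := hO.sfst (by omega)
  have hb := hO.last (by omega)
  refine ⟨fun j hj => ?_, by omega, by omega, ?_, ?_⟩
  · have := hG.long j hj
    rw [← Par.palZ_iff] at this
    exact_mod_cast this
  · rw [show (a : ℤ) - p = ((a - p : ℕ) : ℤ) by omega, Par.palZ_iff]
    intro h
    have := hG.before (by omega) _ (by omega) h
    omega
  · have e : a + k * p = b + p := by
      obtain ⟨k, rfl⟩ : ∃ u, k = u + 1 := ⟨k - 1, by omega⟩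
      rw [hb, Nat.add_sub_cancel]; ring
    rw [← Nat.cast_mul, ← Nat.cast_add, Par.palZ_iff, e]
    intro h
    have hbn := (hG.long (k - 1) (by omega)).add_le (by rw [← hb]; exact hO.lastn (by omega))
    rw [← hb] at hbn
    obtain ⟨j, hj, hj'⟩ := hG.all (by omega) (b + p) (by omega) (by omega) (by omega) h
    have : (j + 1) * p ≤ k * p := Nat.mul_le_mul_right _ hj
    rw [Nat.add_one_mul] at this
    omega

/-- The examination reaches arms of length `2 * s`, so its result is accurate as soon as some length
within that range is refuted. -/
lemma Est.acc {m e : ℕ} (h : Est π m e) {y : ℕ} (hy : ¬ π.Pal m y) (hys : y ≤ 2 * π.s) :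
    Par.Acc π (m, e) :=
  ⟨h.1, fun h' => hy (h'.mono (hys.trans (h.2 h').le))⟩

/-- `LongRun.first_lt` refutes the length `s + p ≤ 2 * s` at the first midpoint, so its estimate is
accurate there; `LongRun.left_half` carries it over to the left half. -/
lemma RunGood.left_acc {c k a p b ea eb : ℕ} (hO : RunOk π c k a p b)
    (hG : RunGood π c k a p b ea eb) (hc : c = b + π.s / 2) {j : ℕ} (hj : 2 * j + 1 < k) :
    Par.Acc π (a + j * p, ea + j * p) := by
  have hR := hG.longRun hO (by omega) hc
  have hg := hG.gap (by omega)
  have h1 : Par.Acc π (a, ea) := by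
    refine (hG.efst (by omega)).acc (y := π.s + p) (fun h => ?_) (by omega)
    have := hR.first_lt (by omega) (Par.palZ_iff.2 h)
    push_cast at this
    omega
  have key : ∀ y : ℕ, π.Pal (a + j * p) (y + j * p) ↔ π.Pal a y := by
    intro y
    rw [← Par.palZ_iff, ← Par.palZ_iff]
    push_cast
    exact hR.left_half hj y
  refine ⟨(key _).2 h1.1, fun h => h1.2 ((key _).1 ?_)⟩
  rwa [add_right_comm] at h

lemma RunGood.right_acc {c k a p b ea eb : ℕ} (hO : RunOk π c k a p b)
    (hG : RunGood π c k a p b ea eb) (hc : c = b + π.s / 2) {j : ℕ} (hj : j < k)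
    (hj' : k < 2 * j + 1) : Par.Acc π (a + j * p, eb + (k - 1 - j) * p) := by
  have hR := hG.longRun hO (by omega) hc
  have hg := hG.gap (by omega)
  have hb := hO.last (by omega)
  have hb' : (a : ℤ) + (k - 1) * p = (b : ℕ) := by
    rw [hb]; push_cast [Nat.cast_sub (show 1 ≤ k by omega)]; ring
  have h1 : Par.Acc π (b, eb) := by
    refine (hG.elast (by omega)).acc (y := π.s + p) (fun h => ?_) (by omega)
    have := hR.last_lt (by omega) (x := (π.s + p : ℕ)) (by rw [hb', Par.palZ_iff]; exact h)
    push_cast at this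
    omega
  have key : ∀ y : ℕ, π.Pal (a + j * p) (y + (k - 1 - j) * p) ↔ π.Pal b y := by
    intro y
    rw [← Par.palZ_iff, ← Par.palZ_iff, ← hb', ← hR.right_half hj hj' y]
    push_cast
    rfl
  refine ⟨(key _).2 h1.1, fun h => h1.2 ((key _).1 ?_)⟩
  rwa [add_right_comm] at h

lemma RunGood.middle {c k a p b ea eb : ℕ} (hG : RunGood π c k a p b ea eb) {j : ℕ}
    (hj : 2 * j + 1 = k) : π.Pal (a + j * p) (π.s + j * p) := by
  rw [← Par.palZ_iff]
  push_cast
  refine middle_of_long (k := k) (fun i hi => ?_) (fun h => ?_) (fun h => ?_) hj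
  · have := hG.long i hi
    rw [← Par.palZ_iff] at this
    exact_mod_cast this
  · have := (hG.gap h).1; omega
  · have := (hG.gap h).2; omega

/-! ### The invariant of the main loop -/

/-- Midpoints of a run. -/
def runList (k a p : ℕ) : List ℕ := (List.range k).map fun j => a + j * p

/-- Bounds for an entry `(m, x, H)` of the list of single midpoints; arms of length `x` have to be
tested next. -/
structure SingleOk (π : Par) (e : ℕ × ℕ × ℕ) : Prop where
  pos : 1 ≤ e.1
  le : e.1 ≤ π.n
  dx : π.d ≤ e.2.1
  xle : e.2.1 ≤ e.1 + π.d
  dvd : e.2.1 ≤ e.1 → π.d ∣ e.1 - e.2.1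

/-- Meaning of an entry of the list of single midpoints at time `b`. -/
structure SingleGood (π : Par) (b : ℕ) (e : ℕ × ℕ × ℕ) : Prop where
  hash : e.2.2 = π.Hc e.1 0
  pal : π.Pal e.1 (e.2.1 - π.d)
  halt : e.1 + e.2.1 ≤ b → ¬ π.Pal e.1 e.2.1

/-- The arrays of single midpoints in the memory. -/
def SinglesMem (L : List (ℕ × ℕ × ℕ)) (mem : ℕ → ℕ) : Prop :=
  ∀ q e, L[q]? = some e → mem (7 * q + 4) = e.1 ∧ mem (7 * q + 5) = e.2.1 ∧
    mem (7 * q + 6) = e.2.2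

/-- State at time `i` after the midpoints up to `c` have been looked at; single midpoints have been
updated at time `b`. -/
structure Main (π : Par) (i c b : ℕ) (L : List (ℕ × ℕ × ℕ)) (σ : State 40) : Prop where
  consts : Consts π σ
  hash : HashMem π i σ.mem
  i : σ.reg Ri = i
  ns : σ.reg Rns = L.length
  arr : SinglesMem L σ.mem
  sok : ∀ e ∈ L, SingleOk π e
  rok : RunOk π c (σ.reg Rcnt) (σ.reg Rfst) (σ.reg Rgap) (σ.reg Rlast)
  perm : (σ.out.map Prod.fst ++ (L.map Prod.fst ++
    runList (σ.reg Rcnt) (σ.reg Rfst) (σ.reg Rgap))).Perm (List.range' 1 (min c π.n))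
  count : L.length * (π.s / 2 + 1) ≤ if σ.reg Rcnt = 0 then c + 1 else σ.reg Rfst
  good : π.Good → (∀ q ∈ σ.out, Par.Acc π q) ∧ (∀ e ∈ L, SingleGood π b e) ∧
    RunGood π c (σ.reg Rcnt) (σ.reg Rfst) (σ.reg Rgap) (σ.reg Rlast) (σ.reg Refst)
      (σ.reg Relast)

lemma HashMem.of_eq {i : ℕ} {mem mem' : ℕ → ℕ} (h : HashMem π i mem)
    (he : ∀ q a, a < 4 → mem' (7 * q + a) = mem (7 * q + a)) : HashMem π i mem' where
  F j h1 h2 := (he _ 0 (by omega)).trans (h.F j h1 h2)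
  G j h1 h2 := (he _ 1 (by omega)).trans (h.G j h1 h2)
  P j h1 h2 := (he _ 2 (by omega)).trans (h.P j h1 h2)
  C c h1 := (he _ 3 (by omega)).trans (h.C c h1)

lemma SinglesMem.of_eq {L : List (ℕ × ℕ × ℕ)} {mem mem' : ℕ → ℕ} (h : SinglesMem L mem)
    (he : ∀ q a, 4 ≤ a → a < 7 → mem' (7 * q + a) = mem (7 * q + a)) : SinglesMem L mem' := by
  intro q e hq
  rw [he q 4 (by omega) (by omega), he q 5 (by omega) (by omega), he q 6 (by omega) (by omega)]
  exact h q e hq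

lemma Main.frame {i c b : ℕ} {L : List (ℕ × ℕ × ℕ)} {s s' : State 40} {cm : Cmd 40}
    (h : Main π i c b L s) (hf : Frame cm s s')
    (hw : ∀ y : Fin 40, y.val < 19 → y ∉ cm.writes) (hm : cm.noStore = true)
    (he : cm.noEmit = true) : Main π i c b L s' where
  consts := h.consts.frame hf fun y hy => hw y (by omega)
  hash := by rw [hf.mem hm]; exact h.hash
  i := (hf.reg _ (hw _ (by decide))).trans h.i
  ns := (hf.reg _ (hw _ (by decide))).trans h.ns
  arr := by rw [hf.mem hm]; exact h.arr
  sok := h.sok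
  rok := by
    rw [hf.reg Rcnt (hw _ (by decide)), hf.reg Rfst (hw _ (by decide)),
      hf.reg Rgap (hw _ (by decide)), hf.reg Rlast (hw _ (by decide))]
    exact h.rok
  perm := by
    rw [hf.out he, hf.reg Rcnt (hw _ (by decide)), hf.reg Rfst (hw _ (by decide)),
      hf.reg Rgap (hw _ (by decide))]
    exact h.perm
  count := by
    rw [hf.reg Rcnt (hw _ (by decide)), hf.reg Rfst (hw _ (by decide))]
    exact h.count
  good := by
    rw [hf.out he, hf.reg Rcnt (hw _ (by decide)), hf.reg Rfst (hw _ (by decide)),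
      hf.reg Rgap (hw _ (by decide)), hf.reg Rlast (hw _ (by decide)),
      hf.reg Refst (hw _ (by decide)), hf.reg Relast (hw _ (by decide))]
    exact h.good

/-! ### Closing a run -/

/-- Append the midpoint `Rc = Rfst + Rj * Rgap` in the middle of a run to the list of single
midpoints. -/
def pushCmd : Cmd 40 :=
  .assign Rc (rg Rfst + rg Rj * rg Rgap) ;;
  .assign Rx (rg Rc - (rg Rfst - rg Rs + rg Rd - cn 1) / rg Rd * rg Rd) ;;
  hashCmd (rg Rc + rg Rx) (cn 7 * ((rg Rc - rg Rx) / rg Rd) + cn 3) ;;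
  .assign RH (rg Rfz) ;;
  .assign Rx (rg Rx + rg Rd) ;;
  scanCmd ;;
  .store (cn 7 * rg Rns + cn 4) (rg Rc) ;;
  .store (cn 7 * rg Rns + cn 5) (rg Rx) ;;
  .store (cn 7 * rg Rns + cn 6) (rg RH) ;;
  .assign Rns (rg Rns + cn 1)

lemma singleGood_of_scan (hp : 0 < π.p) (hgood : π.Good) {i b m H x x' : ℕ} (hm : 1 ≤ m)
    (hmn : m ≤ π.n) (hH : H = π.Hc m 0) (hx : π.Pal m (x - π.d)) (hb : b ≤ i)
    (hR : ScanRes π i m H x x') : SingleGood π b (m, x', H) := by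
  refine ⟨hH, ?_, fun h1 h2 => ?_⟩
  · rcases hR.pass with h | ⟨h1, h2, h3, h4⟩
    · simpa only [h] using hx
    · exact hgood m _ hm hmn (show x' - π.d ≤ m by omega) (h4.trans hH)
  · have hxm : x' ≤ m := h2.1
    simp only at h1
    rcases hR.halt with h | h | h
    · omega
    · omega
    · exact h ((h2.Hc_eq hp).trans hH.symm)

/-- This multiple of `d` is the first checkpoint at or after `a - s`, where the palindrome in the
middle of the run is known to begin. -/
lemma middle_cand {a s d : ℕ} (hd : 1 ≤ d) (ha : s ≤ a) :
    a - s ≤ (a - s + d - 1) / d * d ∧ (a - s + d - 1) / d * d < a - s + d := by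
  have h1 := Nat.div_add_mod (a - s + d - 1) d
  have h2 := Nat.mod_lt (a - s + d - 1) (show 0 < d by omega)
  rw [mul_comm] at h1
  generalize (a - s + d - 1) / d * d = z at *
  omega

set_option maxHeartbeats 1000000 in
-- The middle of a run may have left the ring buffer long ago, so H(m, 0) cannot be computed
-- directly. Arms `y ≤ s + j * p` are known to agree, start at a checkpoint and end close to the
-- last midpoint of the run; so `Hc m y` is available and has the same value.
lemma pushCmd_spec (hV : π.Valid Γ) {s : State 40} (hC : Consts π s) {i a j p b t : ℕ}
    {L : List (ℕ × ℕ × ℕ)} (hM : HashMem π i s.mem) (hi : s.reg Ri = i) (hns : s.reg Rns = L.length)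
    (hL : SinglesMem L s.mem)
    (ha : s.reg Rfst = a) (hj : s.reg Rj = j) (hp : s.reg Rgap = p) (hsa : π.s ≤ a)
    (hin : i = a + 2 * (j * p) + π.s / 2 + 1 + 2 * π.s) (hn : a + 2 * (j * p) ≤ π.n)
    (hcount : L.length * (π.s / 2 + 1) ≤ π.n) (hb : b ≤ i) :
    WP Γ pushCmd (fun s' t' => ∃ x' H, s'.reg Rns = L.length + 1 ∧
      SingleOk π (a + j * p, x', H) ∧ SinglesMem (L ++ [(a + j * p, x', H)]) s'.mem ∧
      HashMem π i s'.mem ∧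
      (π.Good → π.Pal (a + j * p) (π.s + j * p) → SingleGood π b (a + j * p, x', H)) ∧
      t' ≤ t + (8 * π.k + 15) * (2 * π.s / π.d + 5)) s t := by
  have hB := Γ.hB
  have hnB := hV.hnB
  have hds := hV.hds
  have hd := hV.hd
  have hsn := hV.s_le
  obtain ⟨hc1, hc2⟩ := middle_cand hd hsa
  have hdiv : (a - π.s + π.d - 1) / π.d * π.d / π.d = (a - π.s + π.d - 1) / π.d :=
    Nat.mul_div_cancel _ (by omega)
  have hdvd : π.d ∣ (a - π.s + π.d - 1) / π.d * π.d := Nat.dvd_mul_left _ _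
  set c0 := (a - π.s + π.d - 1) / π.d * π.d with hc0
  set jp := j * p with hjp
  set y := a + jp - c0 with hy
  refine WP.seq (WP.assign (a + jp) rfl (by simp [ha, hj, hp, hjp]) (by omega) ?_)
  refine WP.seq (WP.assign y rfl (by simp [ha, hC.s, hC.d, hy, hc0]) (by omega) ?_)
  have hC1 : Consts π ((s.set Rc (a + jp)).set Rx y) := by
    refine hC.of_eq fun z hz => ?_
    have h1 : z ≠ Rc := by rintro rfl; revert hz; decide
    have h2 : z ≠ Rx := by rintro rfl; revert hz; decide
    simp [h1, h2]
  refine WP.seq ((hashCmd_spec hV hC1 (j := a + jp + y)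
    (a := 7 * ((a - π.s + π.d - 1) / π.d) + 3) (by simpa using hM) rfl rfl rfl ?_ ?_ ?_ ?_ ?_).use
    ?_)
  · intro ρ hρ
    simp [hρ]
  · intro ρ hρ
    have : a + jp - y = c0 := by omega
    simp [hρ, hC.d, this, hdiv]
  · have := hV.hA2 ((a - π.s + π.d - 1) / π.d) (by omega)
    omega
  · omega
  · omega
  intro s1 t1 hf1 _ ⟨hz, ht1⟩
  have hC1 := hC1.frame hf1 (by decide)
  have hmem1 : s1.mem = s.mem := by rw [hf1.mem rfl]; simp
  have hz : s1.reg Rfz = π.Hc (a + jp) y := by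
    rw [hz, State.set_mem, State.set_mem, hM.C _ (by omega), Par.Hc,
      show a + jp - y = c0 by omega]
  have hreg1 : ∀ z : Fin 40, z.val < 28 → z ≠ Rc → z ≠ Rx → s1.reg z = s.reg z := by
    intro z hz h1 h2
    rw [hf1.reg z (by revert z; decide)]
    simp [h1, h2]
  have hx1 : s1.reg Rx = y := by rw [hf1.reg Rx (by decide)]; simp
  have hc1' : s1.reg Rc = a + jp := by rw [hf1.reg Rc (by decide)]; simp
  have hHB : π.Hc (a + jp) y < Γ.B := hV.fma_lt_B _ _ _
  refine WP.seq (WP.assign (π.Hc (a + jp) y) rfl (by simp [hz]) hHB ?_)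
  refine WP.seq (WP.assign (y + π.d) rfl (by simp [hx1, hC1.d]) (by omega) ?_)
  refine WP.seq ((scanCmd_spec hV (i := i) (m := a + jp) (x := y + π.d) (H := π.Hc (a + jp) y)
    ?_ ?_ ?_ ?_ ?_ ?_ ?_ ?_ ?_).use ?_)
  · refine hC1.of_eq fun z hz => ?_
    have h1 : z ≠ RH := by rintro rfl; revert hz; decide
    have h2 : z ≠ Rx := by rintro rfl; revert hz; decide
    simp [h1, h2]
  · simpa [hmem1] using hM
  · simpa [hreg1] using hi
  · simpa using hc1'
  · simp
  · simp
  · omega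
  · omega
  · intro hle
    rw [show a + jp - (y + π.d) = c0 - π.d by omega]
    exact Nat.dvd_sub hdvd (dvd_refl _)
  intro s2 t2 hf2 _ ⟨⟨x', hx', hR⟩, ht2⟩
  have hmem2 : s2.mem = s.mem := by rw [hf2.mem rfl]; simpa using hmem1
  have hns2 : s2.reg Rns = L.length := by
    rw [hf2.reg Rns (by decide)]; simp [hreg1, hns]
  have hc2' : s2.reg Rc = a + jp := by rw [hf2.reg Rc (by decide)]; simpa using hc1'
  have hH2 : s2.reg RH = π.Hc (a + jp) y := by rw [hf2.reg RH (by decide)]; simp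
  have hx'le : x' ≤ a + jp + π.d := by
    rcases hR.pass with h | h <;> omega
  have hA := hV.hA3 _ (hcount.trans (by omega))
  have hLB : L.length ≤ π.n := le_trans (Nat.le_mul_of_pos_right _ (by omega)) hcount
  refine WP.seq (WP.store (7 * L.length + 4) (a + jp) rfl rfl (by decide) (by simp [hns2])
    (by omega) (by simp [hc2']) (by omega) ?_)
  refine WP.seq (WP.store (7 * L.length + 5) x' rfl rfl (by decide) (by simp [hns2])
    (by omega) (by simp [hx']) (by omega) ?_)
  refine WP.seq (WP.store (7 * L.length + 6) (π.Hc (a + jp) y) rfl rfl (by decide)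
    (by simp [hns2]) (by omega) (by simp [hH2]) hHB ?_)
  refine WP.assign (L.length + 1) rfl (by simp [hns2]) (by omega) ?_
  refine ⟨x', π.Hc (a + jp) y, by simp, ⟨?_, ?_, ?_, hx'le, hR.dvd⟩, ?_, ?_, ?_, ?_⟩
  · simp only; omega
  · simp only; omega
  · have := hR.le
    simp only; omega
  · intro q e hq
    simp only [State.set_mem, State.st_mem, hmem2]
    rw [List.getElem?_append] at hq
    split_ifs at hq with hlt
    · rw [if_neg (by omega), if_neg (by omega), if_neg (by omega), if_neg (by omega),
        if_neg (by omega), if_neg (by omega), if_neg (by omega), if_neg (by omega),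
        if_neg (by omega)]
      exact hL q e hq
    · have hqL : q = L.length := by
        by_contra hne
        rw [List.getElem?_eq_none (by simp; omega)] at hq
        simp at hq
      subst hqL
      simp at hq
      subst hq
      simp
  · refine hM.of_eq fun q z hz => ?_
    simp only [State.set_mem, State.st_mem, hmem2]
    rw [if_neg (by omega), if_neg (by omega), if_neg (by omega)]
  · intro hgood hpal
    have hy1 : π.Pal (a + jp) y := hpal.mono (by omega)
    refine singleGood_of_scan hV.hp hgood (by omega) (by omega) (hy1.Hc_eq hV.hp)
      ?_ hb hR
    rwa [Nat.add_sub_cancel]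
  · have h1 : (i + π.d - (a + jp + (y + π.d))) / π.d ≤ 2 * π.s / π.d + 1 := by
      rw [← Nat.add_div_right _ hd]
      exact Nat.div_le_div_right (by omega)
    have h2 := Nat.mul_le_mul_left (8 * π.k + 15) (Nat.add_le_add_right h1 2)
    have h3 : (8 * π.k + 15) * (2 * π.s / π.d + 5)
      = (8 * π.k + 15) * (2 * π.s / π.d + 1 + 2) + (8 * π.k + 15) * 2 := by ring
    omega

/-- Close the current run: report its midpoints, except for the one in the middle, which becomes a
single midpoint. -/
def finishCmd : Cmd 40 :=
  .assign Rj (cn 0) ;;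
  .loop (.bin .lt (rg Rj) (rg Rcnt))
    (.ite (.bin .lt (cn 2 * rg Rj + cn 1) (rg Rcnt))
      (.emit (rg Rfst + rg Rj * rg Rgap) (rg Refst + rg Rj * rg Rgap))
      (.ite (.bin .lt (rg Rcnt) (cn 2 * rg Rj + cn 1))
        (.emit (rg Rfst + rg Rj * rg Rgap)
          (rg Relast + (rg Rcnt - cn 1 - rg Rj) * rg Rgap))
        pushCmd) ;;
    .assign Rj (rg Rj + cn 1)) ;;
  .assign Rcnt (cn 0)

/-- Invariant of the loop in `finishCmd` which starts from `σ₀`. -/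
structure Closing (π : Par) (i b : ℕ) (L : List (ℕ × ℕ × ℕ)) (σ₀ : State 40) (t₀ j : ℕ)
    (σ : State 40) (t : ℕ) : Prop where
  consts : Consts π σ
  hash : HashMem π i σ.mem
  run : ∀ y ∈ [Ri, Rcnt, Rfst, Rgap, Rlast, Refst, Relast], σ.reg y = σ₀.reg y
  idx : σ.reg Rj = j
  singles : ∃ L' : List (ℕ × ℕ × ℕ), σ.reg Rns = L'.length ∧ SinglesMem L' σ.mem ∧
    (∀ e ∈ L', SingleOk π e) ∧ (σ.out.map Prod.fst ++ L'.map Prod.fst).Perm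
      (σ₀.out.map Prod.fst ++ (L.map Prod.fst ++ runList j (σ₀.reg Rfst) (σ₀.reg Rgap))) ∧
    L'.length ≤ L.length + (if σ₀.reg Rcnt < 2 * j then 1 else 0) ∧
    (π.Good → (∀ q ∈ σ.out, Par.Acc π q) ∧ ∀ e ∈ L', SingleGood π b e)
  time : t ≤ t₀ + (8 * π.k + 15) * j +
    (if σ₀.reg Rcnt < 2 * j then (8 * π.k + 15) * (2 * π.s / π.d + 5) else 0)

lemma runList_succ (j a p : ℕ) : runList (j + 1) a p = runList j a p ++ [a + j * p] := by
  simp [runList, List.range_succ]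

lemma Closing.emit {i b : ℕ} {L : List (ℕ × ℕ × ℕ)} {σ₀ σ : State 40} {t₀ j t e : ℕ}
    (h : Closing π i b L σ₀ t₀ j σ t)
    (he : π.Good → Par.Acc π (σ₀.reg Rfst + j * σ₀.reg Rgap, e)) :
    Closing π i b L σ₀ t₀ (j + 1)
      ((σ.put (σ₀.reg Rfst + j * σ₀.reg Rgap, e)).set Rj (j + 1)) (t + 5) where
  consts := h.consts.of_eq fun y hy => by
    have : y ≠ Rj := by rintro rfl; revert hy; decide
    simp [this]
  hash := by simpa using h.hash
  run y hy := by
    have : y ≠ Rj := by rintro rfl; revert hy; decide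
    simpa [this] using h.run y hy
  idx := by simp
  singles := by
    obtain ⟨L', h1, h2, h3, h4, h5, h6⟩ := h.singles
    refine ⟨L', by simpa using h1, by simpa using h2, h3, ?_, ?_, fun hg => ⟨?_, (h6 hg).2⟩⟩
    · simp only [State.set_out, State.put_out, List.map_append, List.map_cons, List.map_nil,
        runList_succ]
      refine List.Perm.trans ?_ (List.Perm.trans (h4.append_right
        [σ₀.reg Rfst + j * σ₀.reg Rgap]) ?_)
      · simp only [List.append_assoc]
        exact List.Perm.append_left _ List.perm_append_comm
      · simp
    · split_ifs at h5 ⊢ <;> omega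
    · simp only [State.set_out, State.put_out, List.mem_append, List.mem_singleton]
      rintro q (hq | rfl)
      exacts [(h6 hg).1 q hq, he hg]
  time := by
    have := h.time
    rw [Nat.mul_add_one]
    split_ifs at this ⊢ <;> omega

lemma Closing.tick {i b : ℕ} {L : List (ℕ × ℕ × ℕ)} {σ₀ σ : State 40} {t₀ j t t' : ℕ}
    (h : Closing π i b L σ₀ t₀ j σ t) (ht : t' ≤ t) : Closing π i b L σ₀ t₀ j σ t' where
  consts := h.consts
  hash := h.hash
  run := h.run
  idx := h.idx
  singles := h.singles
  time := ht.trans h.time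

lemma length_runList (k a p : ℕ) : (runList k a p).length = k := by simp [runList]

set_option maxHeartbeats 1000000 in
-- The loop is as long as the run. Its rounds are charged to the midpoints that move from the run to
-- the output or to the list, which is why both lengths occur on both sides of the time bound. The
-- remaining term pays for the single call of `pushCmd`.
lemma finishCmd_spec (hV : π.Valid Γ) {s : State 40} {i c b t : ℕ} {L : List (ℕ × ℕ × ℕ)}
    (h : Main π i c b L s) (hk : s.reg Rcnt ≠ 0) (hc : c = s.reg Rlast + π.s / 2)
    (hi : i = c + 1 + 2 * π.s) (hb : b ≤ i) :
    WP Γ finishCmd (fun s' t' => ∃ L', Main π i c b L' s' ∧ s'.reg Rcnt = 0 ∧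
      t' + (8 * π.k + 15) * (s.out.length + L.length) ≤
        t + (8 * π.k + 15) * (s'.out.length + L'.length) +
          (8 * π.k + 15) * (2 * π.s / π.d + 6)) s t := by
  have hB := Γ.hB
  have hnB := hV.hnB
  have hkpos : 0 < s.reg Rcnt := Nat.pos_of_ne_zero hk
  have hlast := h.rok.last hkpos
  have hlastn := h.rok.lastn hkpos
  have hsfst := h.rok.sfst hkpos
  have hds := hV.hds
  have hd := hV.hd
  have hcount := h.count
  rw [if_neg hk] at hcount
  have hkn : s.reg Rcnt ≤ π.n := by
    rcases Nat.lt_or_ge (s.reg Rcnt) 2 with h2 | h2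
    · have := hV.hn; omega
    · have hp1 : 1 ≤ s.reg Rgap ∨ s.reg Rgap = 0 := by omega
      rcases hp1 with hp1 | hp1
      · have : (s.reg Rcnt - 1) * 1 ≤ (s.reg Rcnt - 1) * s.reg Rgap := Nat.mul_le_mul_left _ hp1
        omega
      -- `RunOk` alone does not exclude the spacing 0, but it would list the same midpoint twice,
      -- against `perm`.
      · have h1 := h.perm.nodup_iff.2 List.nodup_range'
        have h2' := (List.nodup_append.1 (List.nodup_append.1 h1).2.1).2.1
        exfalso
        have := List.nodup_iff_injective_getElem.1 h2'
          (a₁ := ⟨0, by rw [length_runList]; omega⟩) (a₂ := ⟨1, by rw [length_runList]; omega⟩)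
          (by simp [runList, hp1])
        simp at this
  refine WP.seq (WP.assign 0 rfl rfl (by omega) ?_)
  refine WP.seq (WP.for rfl (Closing π i b L s (t + 1)) (s.reg Rcnt) ?_ ?_ ?_ ?_)
  · intro j s' t' hj hI
    have := hI.run Rcnt (by simp)
    simp [hI.idx, this]
  · intro j s' t' ho hj hI
    have e1 := hI.run Rcnt (by simp)
    have e2 := hI.run Rfst (by simp)
    have e3 := hI.run Rgap (by simp)
    have e4 := hI.run Refst (by simp)
    have e5 := hI.run Relast (by simp)
    have e6 := hI.run Ri (by simp)
    refine WP.seq (WP.ite rfl (fun hcond => ?_) (fun hcond => WP.ite rfl (fun hcond' => ?_)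
      (fun hcond' => ?_)))
    · have hcond : 2 * j + 1 < s.reg Rcnt := by simpa [hI.idx, e1] using hcond
      refine WP.emit rfl rfl (by decide)
        (s.reg Rfst + j * s.reg Rgap, s.reg Refst + j * s.reg Rgap)
        (by simp [e2, e3, e4, hI.idx]) ?_
      refine WP.assign (j + 1) rfl (by simp [hI.idx]) (by omega) ?_
      exact (hI.emit fun hg => ((h.good hg).2.2.left_acc h.rok hc hcond)).tick (by omega)
    · have hcond' : s.reg Rcnt < 2 * j + 1 := by simpa [hI.idx, e1] using hcond'
      refine WP.emit rfl rfl (by decide)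
        (s.reg Rfst + j * s.reg Rgap, s.reg Relast + (s.reg Rcnt - 1 - j) * s.reg Rgap)
        (by simp [e1, e2, e3, e5, hI.idx]) ?_
      refine WP.assign (j + 1) rfl (by simp [hI.idx]) (by omega) ?_
      exact (hI.emit fun hg => ((h.good hg).2.2.right_acc h.rok hc hj hcond')).tick (by omega)
    · have hjk : 2 * j + 1 = s.reg Rcnt := by
        simp [hI.idx, e1] at hcond hcond'; omega
      obtain ⟨L', h1, h2, h3, h4, h5, h6⟩ := hI.singles
      rw [if_neg (by omega), add_zero] at h5
      have ht := hI.time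
      rw [if_neg (by omega), add_zero] at ht
      have e7 : 2 * (j * s.reg Rgap) = (s.reg Rcnt - 1) * s.reg Rgap := by
        rw [← hjk, Nat.add_sub_cancel, mul_assoc]
      refine (pushCmd_spec hV hI.consts hI.hash (e6.trans h.i) h1 h2 e2 hI.idx e3 hsfst
        (by omega) (by omega) ?_ hb).use ?_
      · exact le_trans (Nat.mul_le_mul_right _ h5) (by omega)
      rintro s1 t1 hf1 _ ⟨x', H, k1, k2, k3, k4, k5, k6⟩
      have hj1 := (hf1.reg Rj (by decide)).trans hI.idx
      have hout := hf1.out rfl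
      refine WP.assign (j + 1) rfl (by simp [hj1]) (by omega) ?_
      refine ⟨?_, by simpa using k4, ?_, by simp, ⟨L' ++ [(s.reg Rfst + j * s.reg Rgap, x', H)],
        by simpa using k1, by simpa using k3, ?_, ?_, ?_, fun hg => ⟨?_, ?_⟩⟩, ?_⟩
      · refine (hI.consts.frame hf1 (by decide)).of_eq fun z hz => ?_
        have h1 : z ≠ Rj := by rintro rfl; revert hz; decide
        simp [h1]
      · intro z hz
        have h1 : z ≠ Rj := by rintro rfl; revert hz; decide
        have h2 : z ∉ pushCmd.writes := by
          clear h1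
          revert z
          decide
        rw [State.set_reg, if_neg h1, hf1.reg z h2]
        exact hI.run z hz
      · intro e he
        rw [List.mem_append, List.mem_singleton] at he
        rcases he with he | rfl
        exacts [h3 e he, k2]
      · simp only [State.set_out, hout, List.map_append, List.map_cons, List.map_nil,
          runList_succ, ← List.append_assoc] at h4 ⊢
        exact h4.append_right _
      · rw [if_pos (by omega), List.length_append, List.length_singleton]
        omega
      · simp only [State.set_out, hout]
        exact (h6 hg).1
      · intro e he
        rw [List.mem_append, List.mem_singleton] at he
        rcases he with he | rfl
        exacts [(h6 hg).2 e he, k5 hg ((h.good hg).2.2.middle hjk)]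
      · rw [if_pos (by omega), Nat.mul_add_one]
        omega
  · refine ⟨?_, by simpa using h.hash, ?_, by simp, ⟨L, by simpa using h.ns, by simpa using h.arr,
      h.sok, ?_, by simp, fun hg => ⟨?_, (h.good hg).2.1⟩⟩, by simp⟩
    · refine h.consts.of_eq fun z hz => ?_
      have h1 : z ≠ Rj := by rintro rfl; revert hz; decide
      simp [h1]
    · intro z hz
      have h1 : z ≠ Rj := by rintro rfl; revert hz; decide
      simp [h1]
    · simp [runList]
    · simpa using (h.good hg).1
  · intro s' t' ho hI
    obtain ⟨L', h1, h2, h3, h4, h5, h6⟩ := hI.singles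
    have ht := hI.time
    rw [if_pos (by omega)] at h5 ht
    refine WP.assign 0 rfl rfl (by omega) ⟨L', ⟨?_, by simpa using hI.hash, ?_,
      by simpa using h1, by simpa using h2, h3, ?_, ?_, ?_, fun hg => ⟨?_, (h6 hg).2, ?_⟩⟩,
      by simp, ?_⟩
    · refine hI.consts.of_eq fun z hz => ?_
      have h1 : z ≠ Rcnt := by rintro rfl; revert hz; decide
      simp [h1]
    · simpa using (hI.run Ri (by simp)).trans h.i
    · constructor <;> simp
    · simp only [State.set_out, State.set_reg, if_true]
      rw [show runList 0 _ _ = [] from rfl, List.append_nil]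
      exact h4.trans h.perm
    · simp only [State.set_reg, if_true]
      have hac := h.rok.lastc hkpos
      calc L'.length * (π.s / 2 + 1) ≤ (L.length + 1) * (π.s / 2 + 1) := Nat.mul_le_mul_right _ h5
        _ ≤ c + 1 := by rw [Nat.add_one_mul]; omega
    · simpa using (h6 hg).1
    · have hG := (h.good hg).2.2
      constructor <;> simp only [State.set_reg, if_true, lt_irrefl, false_imp_iff, not_lt_zero,
        imp_true_iff]
      · intro _ m hm hmn hmp
        by_cases hma : m < s.reg Rfst
        · have := hG.before hkpos m hma hmp
          have := h.rok.lastc hkpos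
          omega
        · obtain ⟨j, hj, hj'⟩ := hG.all hkpos m (by omega) hm hmn hmp
          have : j * s.reg Rgap ≤ (s.reg Rcnt - 1) * s.reg Rgap :=
            Nat.mul_le_mul_right _ (by omega)
          omega
      · intro h2; omega
    · have hlen := h4.length_eq
      simp only [List.length_append, List.length_map, length_runList] at hlen
      have e1 : s'.out.length + L'.length = s.out.length + L.length + s.reg Rcnt := by omega
      simp only [State.set_out, e1]
      rw [Nat.mul_add (8 * π.k + 15) (s.out.length + L.length)]
      have : (8 * π.k + 15) * (2 * π.s / π.d + 6) =
        (8 * π.k + 15) * (2 * π.s / π.d + 5) + (8 * π.k + 15) := by ring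
      omega

end PalStream

/-! ### Examination of a new midpoint and its place relative to the current run. -/

namespace PalStream

variable {π : Par} {Γ : Env}

/-! ### Handling a new midpoint -/

/-- Estimate the arm length for the midpoint `Rm` up to `2 * Rs`: the result is in `Rx`. The register
`Rlong` tells whether it is at least `Rs`. -/
def probeCmd : Cmd 40 :=
  .assign Rc (rg Rm) ;;
  hashCmd (rg Rc) (cn 7 * (rg Rc % (cn 4 * rg Rs + cn 4)) + cn 1) ;;
  .assign RH (rg Rfz) ;;
  .assign Rlong (cn 0) ;;
  .ite (.bin .lt (rg Rc) (rg Rs)) .skip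
    (hashCmd (rg Rc + rg Rs) (cn 7 * ((rg Rc - rg Rs) % (cn 4 * rg Rs + cn 4)) + cn 1) ;;
      .assign Rlong (.bin .eq (rg Rfz) (rg RH))) ;;
  .assign Rx (rg Rc % rg Rd) ;;
  scanCmd ;;
  .assign Rx (rg Rx - rg Rd)

set_option maxHeartbeats 1000000 in
-- The scan starts from `m % d`, so that left ends are checkpoints, and it can go up to arms `2 *
-- s`, as `i = m + 2 * s`. The length `s` is tested separately and exactly: both of its ends are in
-- the ring buffer.
lemma probeCmd_spec (hV : π.Valid Γ) {s : State 40} (hC : Consts π s) {i m t : ℕ}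
    (hM : HashMem π i s.mem) (hi : s.reg Ri = i) (hm : s.reg Rm = m) (him : i = m + 2 * π.s)
    (hm1 : 1 ≤ m) (hmn : m ≤ π.n) :
    WP Γ probeCmd (fun s' t' => ∃ e l, s'.reg Rc = m ∧ s'.reg Rx = e ∧ s'.reg Rlong = l ∧
      (l ≠ 0 → π.s ≤ m) ∧ (π.Good → (l ≠ 0 ↔ π.Pal m π.s) ∧ Est π m e) ∧
      t' ≤ t + (8 * π.k + 15) * (2 * π.s / π.d + 6)) s t := by
  have hB := Γ.hB
  have hnB := hV.hnB
  have hds := hV.hds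
  have hd := hV.hd
  have hsn := hV.s_le
  have hA := hV.hA1
  have hR : 0 < 4 * π.s + 4 := by omega
  have hlt1 := Nat.mod_lt m hR
  have hlt2 := Nat.mod_lt (m - π.s) hR
  refine WP.seq (WP.assign m rfl (by simp [hm]) (by omega) ?_)
  have hC0 : Consts π (s.set Rc m) := hC.of_eq fun z hz => by
    have h1 : z ≠ Rc := by rintro rfl; revert hz; decide
    simp [h1]
  refine WP.seq ((hashCmd_spec hV hC0 (i := i) (j := m) (a := 7 * (m % (4 * π.s + 4)) + 1)
    (by simpa using hM) rfl rfl rfl ?_ ?_ (by omega) (by omega) (by omega)).use ?_)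
  · intro ρ hρ
    simp [hρ]
  · intro ρ hρ
    simp [hρ, hC.s]
  intro s1 t1 hf1 _ ⟨hz, ht1⟩
  have hz : s1.reg Rfz = π.Hc m 0 := by
    rw [hz, State.set_mem, hM.G m (by omega) (by omega)]; rfl
  have hC1 := hC0.frame hf1 (by decide)
  have hM1 : HashMem π i s1.mem := by rw [hf1.mem rfl]; exact hM
  have hc1 : s1.reg Rc = m := by rw [hf1.reg Rc (by decide)]; simp
  have hi1 : s1.reg Ri = i := by rw [hf1.reg Ri (by decide)]; simpa using hi
  have hHB : π.Hc m 0 < Γ.B := hV.fma_lt_B _ _ _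
  refine WP.seq (WP.assign (π.Hc m 0) rfl (by simp [hz]) hHB ?_)
  refine WP.seq (WP.assign 0 rfl rfl (by omega) ?_)
  have hC2 : Consts π ((s1.set RH (π.Hc m 0)).set Rlong 0) := hC1.of_eq fun z hz => by
    have h1 : z ≠ RH := by rintro rfl; revert hz; decide
    have h2 : z ≠ Rlong := by rintro rfl; revert hz; decide
    simp [h1, h2]
  refine WP.seq ?_
  suffices hmid : ∀ s2 t2, Consts π s2 → HashMem π i s2.mem → s2.reg Ri = i → s2.reg Rc = m →
      s2.reg RH = π.Hc m 0 → (s2.reg Rlong ≠ 0 → π.s ≤ m) →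
      (π.Good → (s2.reg Rlong ≠ 0 ↔ π.Pal m π.s)) → t2 ≤ t + 16 * π.k + 25 →
      WP Γ (.assign Rx (rg Rc % rg Rd) ;; scanCmd ;; .assign Rx (rg Rx - rg Rd))
        (fun s' t' => ∃ e l, s'.reg Rc = m ∧ s'.reg Rx = e ∧ s'.reg Rlong = l ∧
          (l ≠ 0 → π.s ≤ m) ∧ (π.Good → (l ≠ 0 ↔ π.Pal m π.s) ∧ Est π m e) ∧
          t' ≤ t + (8 * π.k + 15) * (2 * π.s / π.d + 6)) s2 t2 by
    refine WP.ite rfl (fun hcond => WP.skip ?_) (fun hcond => ?_)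
    · have hcond : m < π.s := by simpa [hc1, hC1.s] using hcond
      refine hmid _ _ hC2 (by simpa using hM1) (by simpa using hi1) (by simpa using hc1)
        (by simp) (by simp) (fun _ => ?_) (by omega)
      simp only [State.set_reg, if_true, ne_eq, not_true_eq_false, false_iff]
      intro h
      have := h.1
      omega
    · have hcond : π.s ≤ m := by simpa [hc1, hC1.s] using hcond
      refine WP.seq ((hashCmd_spec hV hC2 (i := i) (j := m + π.s)
        (a := 7 * ((m - π.s) % (4 * π.s + 4)) + 1)
        (by simpa using hM1) rfl rfl rfl ?_ ?_ (by omega) (by omega) (by omega)).use ?_)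
      · intro ρ hρ
        simp [hρ, hc1, hC1.s]
      · intro ρ hρ
        simp [hρ, hc1, hC1.s]
      intro s3 t3 hf3 _ ⟨hz3, ht3⟩
      have hz3 : s3.reg Rfz = π.Hc m π.s := by
        rw [hz3, State.set_mem, State.set_mem, hM1.G _ (by omega) (by omega)]; rfl
      have hH3 : s3.reg RH = π.Hc m 0 := by rw [hf3.reg RH (by decide)]; simp
      have hC3 := hC2.frame hf3 (by decide)
      refine WP.assign (if π.Hc m π.s = π.Hc m 0 then 1 else 0) rfl (by simp [hz3, hH3])
        (by split_ifs <;> omega) ?_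
      refine hmid _ _ ?_ ?_ ?_ ?_ ?_ (fun _ => hcond) (fun hg => ?_) (by omega)
      · refine hC3.of_eq fun z hz => ?_
        have h1 : z ≠ Rlong := by rintro rfl; revert hz; decide
        simp [h1]
      · rw [State.set_mem, hf3.mem rfl]; exact hM1
      · simp [hf3.reg Ri (by decide), hi1]
      · simp [hf3.reg Rc (by decide), hc1]
      · simpa using hH3
      · have h1 : π.Pal m π.s → π.Hc m π.s = π.Hc m 0 := fun h => h.Hc_eq hV.hp
        have h2 := hg m π.s hm1 hmn hcond
        simp only [State.set_reg, if_true]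
        constructor
        · intro h
          by_contra hcon
          exact h (if_neg fun he => hcon (h2 he))
        · intro h
          rw [if_pos (h1 h)]
          exact one_ne_zero
  intro s2 t2 hC2 hM2 hi2 hc2 hH2 hl1 hl2 ht2
  have hmd := Nat.mod_lt m (show 0 < π.d by omega)
  have hmd' := Nat.mod_le m π.d
  refine WP.seq (WP.assign (m % π.d) rfl (by simp [hc2, hC2.d]) (by omega) ?_)
  refine WP.seq ((scanCmd_spec hV (i := i) (m := m) (x := m % π.d) (H := π.Hc m 0)
    ?_ ?_ ?_ ?_ ?_ ?_ ?_ ?_ ?_).use ?_)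
  · refine hC2.of_eq fun z hz => ?_
    have h1 : z ≠ Rx := by rintro rfl; revert hz; decide
    simp [h1]
  · simpa using hM2
  · simpa using hi2
  · simpa using hc2
  · simp
  · simpa using hH2
  · omega
  · omega
  · exact fun _ => Nat.dvd_sub_mod m
  intro s3 t3 hf3 _ ⟨⟨x', hx', hR⟩, ht3⟩
  have hx'le : x' ≤ m + π.d := by
    rcases hR.pass with h | h <;> omega
  have hC3 := (hC2.of_eq (s' := s2.set Rx (m % π.d)) fun z hz => by
    have h1 : z ≠ Rx := by rintro rfl; revert hz; decide
    simp [h1]).frame hf3 (by decide)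
  refine WP.assign (x' - π.d) rfl (by simp [hx', hC3.d]) (by omega) ?_
  refine ⟨x' - π.d, s2.reg Rlong, ?_, by simp, ?_, hl1, fun hg => ⟨hl2 hg, ?_, fun hpal => ?_⟩, ?_⟩
  · simp [hf3.reg Rc (by decide), hc2]
  · simp [hf3.reg Rlong (by decide)]
  · rcases hR.pass with h | ⟨h1, h2, h3, h4⟩
    -- If already the first test fails, then `x' = m % d < d` and truncated subtraction gives the
    -- estimate 0, which is always valid.
    · rw [show x' - π.d = 0 by omega]
      exact Par.pal_zero m
    · exact hg m _ hm1 hmn (by omega) h4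
  · have hpal' : π.Pal m x' := hpal.mono (by omega)
    have := hpal'.1
    rcases hR.halt with h | h | h
    · omega
    · omega
    · exact absurd (hpal'.Hc_eq hV.hp) h
  · have h1 : (i + π.d - (m + m % π.d)) / π.d ≤ 2 * π.s / π.d + 1 := by
      rw [← Nat.add_div_right _ hd]
      exact Nat.div_le_div_right (by omega)
    have h2 := Nat.mul_le_mul_left (8 * π.k + 15) (Nat.add_le_add_right h1 2)
    have h3 : (8 * π.k + 15) * (2 * π.s / π.d + 6)
      = (8 * π.k + 15) * (2 * π.s / π.d + 1 + 2) + (8 * π.k + 15) * 3 := by ring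
    omega

/-- Report the midpoint `Rc`, or add it to the current run if it is long. -/
def sortCmd : Cmd 40 :=
  .ite (rg Rlong)
    (.ite (rg Rcnt)
      (.ite (.bin .eq (rg Rcnt) (cn 1) + .bin .eq (rg Rc - rg Rlast) (rg Rgap))
        (.assign Rgap (rg Rc - rg Rlast) ;; .assign Rcnt (rg Rcnt + cn 1) ;;
          .assign Rlast (rg Rc) ;; .assign Relast (rg Rx))
        (.emit (rg Rc) (cn 0)))
      (.assign Rfst (rg Rc) ;; .assign Rgap (cn 0) ;; .assign Rcnt (cn 1) ;;
        .assign Rlast (rg Rc) ;; .assign Refst (rg Rx) ;; .assign Relast (rg Rx)))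
    (.emit (rg Rc) (rg Rx))

lemma RunGood.skip {c k a p b ea eb : ℕ} (h : RunGood π c k a p b ea eb)
    (hs : c + 1 ≤ π.n → ¬ π.Pal (c + 1) π.s) : RunGood π (c + 1) k a p b ea eb where
  none hk m hm hmn hp := by
    rcases Nat.lt_or_ge c m with h1 | h1
    · obtain rfl : m = c + 1 := by omega
      exact absurd hp (hs hmn)
    · exact (h.none hk m h1 hmn hp).trans (Nat.le_succ c)
  long := h.long
  all hk m hm1 hm hmn hp := by
    rcases Nat.lt_or_ge c m with h1 | h1
    · obtain rfl : m = c + 1 := by omega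
      exact absurd hp (hs hmn)
    · exact h.all hk m hm1 h1 hmn hp
  before := h.before
  gap := h.gap
  efst := h.efst
  elast := h.elast

lemma RunGood.start {c k a p b ea eb e : ℕ} (h : RunGood π c k a p b ea eb) (hk : k = 0)
    (hn : c + 1 ≤ π.n) (hp : π.Pal (c + 1) π.s) (he : Est π (c + 1) e) :
    RunGood π (c + 1) 1 (c + 1) 0 (c + 1) e e where
  none hk := by omega
  long j hj := by
    obtain rfl : j = 0 := by omega
    simpa using hp
  all _ m hm1 hm _ _ := ⟨0, by omega, by omega⟩
  before _ m hm hp := by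
    have := h.none hk m (by omega) (by omega) hp
    omega
  gap h2 := by omega
  efst _ := he
  elast _ := he

lemma RunGood.extend {c k a p b ea eb e : ℕ} (hO : RunOk π c k a p b)
    (h : RunGood π c k a p b ea eb) (hk : 0 < k) (hfit : k = 1 ∨ c + 1 - b = p)
    (hc : c + 1 ≤ b + π.s / 2) (hp : π.Pal (c + 1) π.s) (he : Est π (c + 1) e) :
    RunGood π (c + 1) (k + 1) a (c + 1 - b) (c + 1) ea e := by
  have hl := hO.last hk
  have hlc := hO.lastc hk
  have hmul : ∀ j < k, a + j * (c + 1 - b) = a + j * p := by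
    intro j hj
    rcases hfit with rfl | hfit
    · obtain rfl : j = 0 := by omega
      simp
    · rw [hfit]
  have hend : a + k * (c + 1 - b) = c + 1 := by
    obtain ⟨u, rfl⟩ : ∃ u, k = u + 1 := ⟨k - 1, by omega⟩
    rw [Nat.add_one_mul, ← add_assoc, hmul u (by omega)]
    rw [Nat.add_sub_cancel] at hl
    omega
  refine ⟨by omega, fun j hj => ?_, fun _ m hm1 hm hmn hmp => ?_, fun _ => h.before hk,
    fun _ => by omega, fun _ => h.efst hk, fun _ => he⟩
  · rcases Nat.lt_succ_iff_lt_or_eq.1 hj with hj | rfl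
    · rw [hmul j hj]; exact h.long j hj
    · rwa [hend]
  · rcases Nat.lt_or_ge c m with h1 | h1
    · exact ⟨k, by omega, by omega⟩
    · obtain ⟨j, hj, hj'⟩ := h.all hk m hm1 h1 hmn hmp
      exact ⟨j, by omega, by rw [hmul j hj, hj']⟩

/-- `Par.gap_eq` for the last two midpoints of the run and the new one; `all` excludes long
midpoints in between. -/
lemma RunGood.fit {c k a p b ea eb : ℕ} (hO : RunOk π c k a p b)
    (h : RunGood π c k a p b ea eb) (hk : 2 ≤ k) (hn : c + 1 ≤ π.n)
    (hc : c + 1 ≤ b + π.s / 2) (hp : π.Pal (c + 1) π.s) : c + 1 - b = p := by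
  have hl := hO.last (by omega)
  have hlc := hO.lastc (by omega)
  have hg := h.gap hk
  obtain ⟨u, rfl⟩ : ∃ u, k = u + 2 := ⟨k - 2, by omega⟩
  have hb : b = a + u * p + p := by
    rw [hl, show u + 2 - 1 = u + 1 from rfl]; ring
  have h1 := h.long u (by omega)
  have h2 := h.long (u + 1) (by omega)
  rw [Nat.add_one_mul, ← add_assoc] at h2
  refine (Par.gap_eq h1 h2 (q := c + 1 - b) ?_ hg.1 (by omega) (by omega) (by omega) ?_ ?_).symm
  · rwa [show a + u * p + p + (c + 1 - b) = c + 1 by omega]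
  · intro m hm1 hm2 hm
    obtain ⟨j, hj, hj'⟩ := h.all (by omega) m (by omega) (by omega) (by omega) hm
    have e1 : u * p < j * p := by omega
    have e2 : j * p < (u + 1) * p := by rw [Nat.add_one_mul]; omega
    have := Nat.lt_of_mul_lt_mul_right e1
    have := Nat.lt_of_mul_lt_mul_right e2
    omega
  · intro m hm1 hm2 hm
    obtain ⟨j, hj, hj'⟩ := h.all (by omega) m (by omega) (by omega) (by omega) hm
    have : j * p ≤ (u + 1) * p := Nat.mul_le_mul_right _ (by omega)
    rw [Nat.add_one_mul] at this
    omega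

lemma range'_min_succ {c n : ℕ} (h : c + 1 ≤ n) :
    List.range' 1 (min (c + 1) n) = List.range' 1 (min c n) ++ [c + 1] := by
  rw [min_eq_left h, min_eq_left (by omega), List.range'_concat, one_mul, add_comm 1 c]

lemma Main.put {i c b e : ℕ} {L : List (ℕ × ℕ × ℕ)} {s : State 40} (h : Main π i c b L s)
    (hn : c + 1 ≤ π.n) (hk : s.reg Rcnt = 0 ∨ c + 1 ≤ s.reg Rlast + π.s / 2)
    (hg : π.Good → ¬ π.Pal (c + 1) π.s ∧ Par.Acc π (c + 1, e)) :
    Main π i (c + 1) b L (s.put (c + 1, e)) where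
  consts := h.consts.of_eq fun y _ => by simp
  hash := h.hash
  i := h.i
  ns := h.ns
  arr := h.arr
  sok := h.sok
  rok := by
    refine ⟨h.rok.last, h.rok.sfst, fun hk => (h.rok.lastc hk).trans (Nat.le_succ c), fun hk' => ?_,
      h.rok.lastn⟩
    rw [State.put_reg] at *
    omega
  perm := by
    rw [range'_min_succ hn, State.put_out, State.put_reg, List.map_append, List.map_cons,
      List.map_nil]
    refine List.Perm.trans ?_ (h.perm.append_right [c + 1])
    simp only [List.append_assoc]
    refine List.Perm.append_left _ ?_
    rw [← List.append_assoc (List.map _ L)]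
    exact List.perm_append_comm
  count := by
    have := h.count
    rw [State.put_reg]
    split_ifs at this ⊢ <;> omega
  good hgood := by
    obtain ⟨h1, h2, h3⟩ := h.good hgood
    refine ⟨?_, h2, h3.skip fun _ => (hg hgood).1⟩
    simp only [State.put_out, List.mem_append, List.mem_singleton]
    rintro q (hq | rfl)
    exacts [h1 q hq, (hg hgood).2]

set_option maxHeartbeats 1000000 in
lemma sortCmd_spec (hV : π.Valid Γ) {s : State 40} {i c b t e l : ℕ} {L : List (ℕ × ℕ × ℕ)}
    (h : Main π i c b L s) (hn : c + 1 ≤ π.n)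
    (hk : s.reg Rcnt = 0 ∨ c + 1 ≤ s.reg Rlast + π.s / 2)
    (hc : s.reg Rc = c + 1) (he : s.reg Rx = e) (hl : s.reg Rlong = l)
    (hls : l ≠ 0 → π.s ≤ c + 1)
    (hgood : π.Good → (l ≠ 0 ↔ π.Pal (c + 1) π.s) ∧ Est π (c + 1) e) :
    WP Γ sortCmd (fun s' t' => Main π i (c + 1) b L s' ∧ s.out.length ≤ s'.out.length ∧
      t' ≤ t + 9) s t := by
  refine WP.ok fun ho => ?_
  have hB := Γ.hB
  have hnB := hV.hnB
  have heB : e < Γ.B := he ▸ ho.reg Rx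
  refine WP.ite rfl (fun hlong => ?_) (fun hlong => ?_)
  · have hlong : l ≠ 0 := by simpa [hl] using hlong
    refine WP.ite rfl (fun hcnt => ?_) (fun hcnt => ?_)
    · have hcnt : s.reg Rcnt ≠ 0 := hcnt
      have hk := hk.resolve_left hcnt
      have hpos := Nat.pos_of_ne_zero hcnt
      have hlast := h.rok.last hpos
      have hlastc := h.rok.lastc hpos
      refine WP.ite rfl (fun hcond => ?_) (fun hcond => ?_)
      · have hcond : s.reg Rcnt = 1 ∨ c + 1 - s.reg Rlast = s.reg Rgap := by
          by_contra hcon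
          rw [not_or] at hcon
          simp [hc, hcon.1, hcon.2] at hcond
        have hcB : s.reg Rcnt + 1 < Γ.B := by
          have hlen := h.perm.length_eq
          simp only [List.length_append, List.length_map, length_runList, List.length_range'] at hlen
          omega
        have hrun : runList (s.reg Rcnt + 1) (s.reg Rfst) (c + 1 - s.reg Rlast)
            = runList (s.reg Rcnt) (s.reg Rfst) (s.reg Rgap) ++ [c + 1] := by
          rw [runList_succ]
          rcases hcond with h1 | h1
          · rw [h1] at hlast ⊢
            simp only [Nat.sub_self, zero_mul, add_zero] at hlast
            simp [runList]
            omega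
          · rw [h1]
            have : (s.reg Rcnt - 1) * s.reg Rgap + s.reg Rgap = s.reg Rcnt * s.reg Rgap := by
              rw [← Nat.add_one_mul]; congr 1; omega
            congr 2
            omega
        refine WP.seq (WP.assign (c + 1 - s.reg Rlast) rfl (by simp [hc]) (by omega) ?_)
        refine WP.seq (WP.assign (s.reg Rcnt + 1) rfl (by simp) hcB ?_)
        refine WP.seq (WP.assign (c + 1) rfl (by simp [hc]) (by omega) ?_)
        refine WP.assign e rfl (by simp [he]) heB ?_
        refine ⟨⟨?_, by simpa using h.hash, by simpa using h.i, by simpa using h.ns,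
          by simpa using h.arr, h.sok, ?_, ?_, ?_, fun hg => ?_⟩, by simp, by omega⟩
        · refine h.consts.of_eq fun z hz => ?_
          have h1 : z ≠ Rgap := by rintro rfl; revert hz; decide
          have h2 : z ≠ Rcnt := by rintro rfl; revert hz; decide
          have h3 : z ≠ Rlast := by rintro rfl; revert hz; decide
          have h4 : z ≠ Relast := by rintro rfl; revert hz; decide
          simp [h1, h2, h3, h4]
        · simp only [State.set_reg, Fin.reduceEq, if_true, if_false]
          refine ⟨fun _ => ?_, fun _ => h.rok.sfst hpos, fun _ => le_rfl, fun _ => by omega,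
            fun _ => hn⟩
          rw [Nat.add_sub_cancel]
          rcases hcond with h1 | h1
          · rw [h1] at hlast ⊢
            simp only [Nat.sub_self, zero_mul, add_zero] at hlast
            omega
          · rw [h1]
            have : (s.reg Rcnt - 1) * s.reg Rgap + s.reg Rgap = s.reg Rcnt * s.reg Rgap := by
              rw [← Nat.add_one_mul]; congr 1; omega
            omega
        · simp only [State.set_reg, State.set_out, Fin.reduceEq, if_true, if_false]
          rw [hrun, range'_min_succ hn, ← List.append_assoc, ← List.append_assoc,
            List.append_assoc (List.map _ s.out)]
          exact h.perm.append_right _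
        · have := h.count
          simp only [State.set_reg, Fin.reduceEq, if_true, if_false]
          rw [if_neg hcnt] at this
          rw [if_neg (by omega)]
          exact this
        · obtain ⟨h1, h2, h3⟩ := h.good hg
          simp only [State.set_reg, State.set_out, Fin.reduceEq, if_true, if_false]
          exact ⟨h1, h2, h3.extend h.rok hpos hcond hk ((hgood hg).1.1 hlong) (hgood hg).2⟩
      · have hcond : s.reg Rcnt ≠ 1 ∧ c + 1 - s.reg Rlast ≠ s.reg Rgap := by
          constructor <;> intro hcon <;> simp [hc, hcon] at hcond
        -- This branch is reached only after a fingerprint error. The midpoint is still reported, so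
        -- that every midpoint occurs exactly once for every outcome.
        refine WP.emit rfl rfl (by decide) (c + 1, 0) (by simp [hc]) ?_
        refine ⟨h.put hn (Or.inr hk) fun hg => ?_, by simp, by omega⟩
        exact absurd ((h.good hg).2.2.fit h.rok (by omega) hn hk ((hgood hg).1.1 hlong)) hcond.2
    · have hcnt : s.reg Rcnt = 0 := hcnt
      refine WP.seq (WP.assign (c + 1) rfl (by simp [hc]) (by omega) ?_)
      refine WP.seq (WP.assign 0 rfl rfl (by omega) ?_)
      refine WP.seq (WP.assign 1 rfl rfl (by omega) ?_)
      refine WP.seq (WP.assign (c + 1) rfl (by simp [hc]) (by omega) ?_)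
      refine WP.seq (WP.assign e rfl (by simp [he]) heB ?_)
      refine WP.assign e rfl (by simp [he]) heB ?_
      refine ⟨⟨?_, by simpa using h.hash, by simpa using h.i, by simpa using h.ns,
        by simpa using h.arr, h.sok, ?_, ?_, ?_, fun hg => ?_⟩, by simp, by omega⟩
      · refine h.consts.of_eq fun z hz => ?_
        have h1 : z ≠ Rfst := by rintro rfl; revert hz; decide
        have h2 : z ≠ Rgap := by rintro rfl; revert hz; decide
        have h3 : z ≠ Rcnt := by rintro rfl; revert hz; decide
        have h4 : z ≠ Rlast := by rintro rfl; revert hz; decide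
        have h5 : z ≠ Refst := by rintro rfl; revert hz; decide
        have h6 : z ≠ Relast := by rintro rfl; revert hz; decide
        simp [h1, h2, h3, h4, h5, h6]
      · simp only [State.set_reg, Fin.reduceEq, if_true, if_false]
        exact ⟨fun _ => by simp, fun _ => hls hlong, fun _ => le_rfl, fun _ => by omega,
          fun _ => hn⟩
      · have hperm := h.perm
        simp only [State.set_reg, State.set_out, Fin.reduceEq, if_true, if_false]
        rw [hcnt, show runList 0 _ _ = [] from rfl, List.append_nil] at hperm
        rw [range'_min_succ hn, ← List.append_assoc, show runList 1 (c + 1) 0 = [c + 1] by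
          simp [runList]]
        exact hperm.append_right _
      · have := h.count
        simp only [State.set_reg, Fin.reduceEq, if_true, if_false]
        rw [if_pos hcnt] at this
        rw [if_neg one_ne_zero]
        exact this
      · obtain ⟨h1, h2, h3⟩ := h.good hg
        simp only [State.set_reg, State.set_out, Fin.reduceEq, if_true, if_false]
        exact ⟨h1, h2, h3.start hcnt hn ((hgood hg).1.1 hlong) (hgood hg).2⟩
  · have hlong : l = 0 := by simpa [hl] using hlong
    refine WP.emit rfl rfl (by decide) (c + 1, e) (by simp [hc, he]) ?_
    refine ⟨h.put hn hk fun hg => ?_, by simp, by omega⟩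
    have hnp : ¬ π.Pal (c + 1) π.s := fun hp => (hgood hg).1.2 hp hlong
    exact ⟨hnp, (hgood hg).2.acc hnp (by omega)⟩

/-- Look at the midpoint `Ri - 2 * Rs`. -/
def midpointCmd : Cmd 40 :=
  .assign Rm (rg Ri - cn 2 * rg Rs) ;;
  .ite (rg Rcnt * .bin .eq (rg Rm) (rg Rlast + rg Rs / cn 2 + cn 1)) finishCmd .skip ;;
  .ite (.bin .lt (rg Rm) (rg Rn + cn 1)) (probeCmd ;; sortCmd) .skip

lemma Main.skip {i c b : ℕ} {L : List (ℕ × ℕ × ℕ)} {s : State 40} (h : Main π i c b L s)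
    (hn : π.n ≤ c) (hk : s.reg Rcnt = 0 ∨ c + 1 ≤ s.reg Rlast + π.s / 2) :
    Main π i (c + 1) b L s where
  consts := h.consts
  hash := h.hash
  i := h.i
  ns := h.ns
  arr := h.arr
  sok := h.sok
  rok := ⟨h.rok.last, h.rok.sfst, fun hk => (h.rok.lastc hk).trans (Nat.le_succ c),
    fun hk' => by omega, h.rok.lastn⟩
  perm := by
    have := h.perm
    rw [min_eq_right hn] at this
    rwa [min_eq_right (show π.n ≤ c + 1 by omega)]
  count := by
    have := h.count
    split_ifs at this ⊢ <;> omega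
  good hg := ⟨(h.good hg).1, (h.good hg).2.1, (h.good hg).2.2.skip fun _ => by omega⟩

set_option maxHeartbeats 1000000 in
-- The same step may close a run and examine a midpoint. Each of the two may scan up to about `2 * s
-- / d` arms, whence the factor two.
lemma midpointCmd_spec (hV : π.Valid Γ) {s : State 40} {i c b t : ℕ} {L : List (ℕ × ℕ × ℕ)}
    (h : Main π i c b L s) (hi : i = c + 1 + 2 * π.s) (hb : b ≤ i)
    (hin : i ≤ π.n + 3 * π.s + 2) :
    WP Γ midpointCmd (fun s' t' => ∃ L', Main π i (c + 1) b L' s' ∧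
      t' + (8 * π.k + 15) * (s.out.length + L.length) ≤
        t + (8 * π.k + 15) * (s'.out.length + L'.length) +
          (8 * π.k + 15) * (2 * (2 * π.s / π.d) + 14)) s t := by
  have hB := Γ.hB
  have hnB := hV.hnB
  have hsn := hV.s_le
  refine WP.seq ((WP.assign (c + 1) rfl (by simp [h.i, h.consts.s]; omega) (by omega)
    (Q := fun s' t' => s'.reg Rm = c + 1 ∧ t' = t + 1) ⟨by simp, rfl⟩).use ?_)
  rintro s1 t1 hf1 - ⟨hm1, rfl⟩
  have h1 := h.frame hf1 (by decide) rfl rfl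
  have hout1 := hf1.out rfl
  clear hf1
  refine WP.seq ?_
  suffices hmid : ∀ s2 t2 L2, Main π i c b L2 s2 → s2.reg Rm = c + 1 →
      (s2.reg Rcnt = 0 ∨ c + 1 ≤ s2.reg Rlast + π.s / 2) →
      t2 + (8 * π.k + 15) * (s.out.length + L.length) ≤
        t + (8 * π.k + 15) * (s2.out.length + L2.length) +
          (8 * π.k + 15) * (2 * π.s / π.d + 7) →
      WP Γ (.ite (.bin .lt (rg Rm) (rg Rn + cn 1)) (probeCmd ;; sortCmd) .skip)
        (fun s' t' => ∃ L', Main π i (c + 1) b L' s' ∧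
          t' + (8 * π.k + 15) * (s.out.length + L.length) ≤
          t + (8 * π.k + 15) * (s'.out.length + L'.length) +
          (8 * π.k + 15) * (2 * (2 * π.s / π.d) + 14)) s2 t2 by
    have e7 : (8 * π.k + 15) * (2 * π.s / π.d + 7)
      = (8 * π.k + 15) * (2 * π.s / π.d + 6) + (8 * π.k + 15) := by ring
    refine WP.ite rfl (fun hcond => ?_) (fun hcond => WP.skip ?_)
    · have hcond : s1.reg Rcnt ≠ 0 ∧ c = s1.reg Rlast + π.s / 2 := by
        simp [hm1, h1.consts.s] at hcond
        omega
      refine ((finishCmd_spec hV h1 hcond.1 hcond.2 hi hb)).use ?_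
      rintro s2 t2 hf2 - ⟨L2, hM2, hk2, ht2⟩
      refine hmid s2 t2 L2 hM2 ((hf2.reg Rm (by decide)).trans hm1) (Or.inl hk2) ?_
      rw [hout1] at ht2
      omega
    · refine hmid s1 _ L h1 hm1 ?_ (by rw [hout1]; omega)
      by_cases hk : s1.reg Rcnt = 0
      · exact Or.inl hk
      · have := h1.rok.cle (by omega)
        simp [hm1, h1.consts.s, hk] at hcond
        omega
  intro s2 t2 L2 hM2 hm2 hk2 ht2
  have e14 : (8 * π.k + 15) * (2 * (2 * π.s / π.d) + 14)
      = (8 * π.k + 15) * (2 * π.s / π.d + 7) + (8 * π.k + 15) * (2 * π.s / π.d + 6)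
        + (8 * π.k + 15) := by ring
  refine WP.ite rfl (fun hcond => ?_) (fun hcond => WP.skip ?_)
  · have hcond : c + 1 ≤ π.n := by
      simp [hm2, hM2.consts.n] at hcond
      omega
    refine WP.seq ((probeCmd_spec hV hM2.consts hM2.hash hM2.i hm2 hi (by omega) hcond).use ?_)
    rintro s3 t3 hf3 - ⟨e, l, k1, k2, k3, k4, k5, k6⟩
    have hM3 := hM2.frame hf3 (by decide) rfl rfl
    have hk3 : s3.reg Rcnt = 0 ∨ c + 1 ≤ s3.reg Rlast + π.s / 2 := by
      rwa [hf3.reg Rcnt (by decide), hf3.reg Rlast (by decide)]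
    refine (sortCmd_spec hV hM3 hcond hk3 k1 k2 k3 k4 k5).mono ?_
    rintro s4 t4 - - ⟨hM4, hlen, ht4⟩
    refine ⟨L2, hM4, ?_⟩
    rw [hf3.out rfl] at hlen
    have := Nat.mul_le_mul_left (8 * π.k + 15) (Nat.add_le_add_right hlen L2.length)
    omega
  · have hcond : π.n ≤ c := by
      simp [hm2, hM2.consts.n] at hcond
      omega
    refine ⟨L2, hM2.skip hcond hk2, ?_⟩
    omega

end PalStream

/-! ### Advance of the prefix fingerprints and periodic update of the single midpoints. -/

namespace PalStream

variable {π : Par} {Γ : Env}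

/-! ### Reading the next symbol -/

/-- `x := a * b + c` for codes. -/
def setFma (x : Fin 40) (a b c : Expr 40) : Cmd 40 :=
  .assign Rfx a ;; .assign Rfy b ;; .assign Rfw c ;; fmaCmd ;; .assign x (rg Rfz)

lemma setFma_spec (hV : π.Valid Γ) {s : State 40} (hC : Consts π s) {z : Fin 40}
    {a b c : Expr 40} {x y w t : ℕ} (ha : a.ok = true) (hb : b.ok = true) (hc : c.ok = true)
    (hx : a.nat s.reg = x)
    (hy : ∀ ρ : Fin 40 → ℕ, (∀ y, y.val < 28 → ρ y = s.reg y) → b.nat ρ = y)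
    (hw : ∀ ρ : Fin 40 → ℕ, (∀ y, y.val < 28 → ρ y = s.reg y) → c.nat ρ = w)
    (hxB : x < Γ.B) (hyB : y < Γ.B) (hwB : w < Γ.B) :
    WP Γ (setFma z a b c) (fun s' t' => s'.reg z = π.fma x y w ∧ t' ≤ t + (8 * π.k + 8)) s t := by
  refine WP.seq (WP.assign x ha hx hxB ?_)
  refine WP.seq (WP.assign y hb (hy _ fun u hu => ?_) hyB ?_)
  · have h1 : u ≠ Rfx := by rintro rfl; revert hu; decide
    simp [h1]
  refine WP.seq (WP.assign w hc (hw _ fun u hu => ?_) hwB ?_)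
  · have h1 : u ≠ Rfx := by rintro rfl; revert hu; decide
    have h2 : u ≠ Rfy := by rintro rfl; revert hu; decide
    simp [h1, h2]
  refine WP.seq ((fmaCmd_spec hV (x := x) (y := y) (w := w) ?_ (by simp) (by simp)
    (by simp)).mono ?_)
  · refine hC.of_eq fun u hu => ?_
    have h1 : u ≠ Rfx := by rintro rfl; revert hu; decide
    have h2 : u ≠ Rfy := by rintro rfl; revert hu; decide
    have h3 : u ≠ Rfw := by rintro rfl; revert hu; decide
    simp [h1, h2, h3]
  rintro s' t' - - ⟨h, ht⟩
  exact WP.assign _ rfl h (hV.fma_lt_B x y w) ⟨by simp, by omega⟩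

/-- Read a symbol and update the fingerprints and their arrays. -/
def advanceCmd : Cmd 40 :=
  .assign Ri (rg Ri + cn 1) ;;
  .assign Rv (cn 0) ;;
  .ite (.bin .lt (rg Ri) (rg Rn + cn 1))
    (.read Rv ;; .assign Rv ((rg Rv + cn 1) * rg RE)) .skip ;;
  setFma RF (rg Rv) (rg RP) (rg RF) ;;
  setFma RG (rg Rr) (rg RG) (rg Rv) ;;
  setFma RP (rg Rr) (rg RP) (cn 0) ;;
  .store (cn 7 * (rg Ri % (cn 4 * rg Rs + cn 4))) (rg RF) ;;
  .store (cn 7 * (rg Ri % (cn 4 * rg Rs + cn 4)) + cn 1) (rg RG) ;;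
  .store (cn 7 * (rg Ri % (cn 4 * rg Rs + cn 4)) + cn 2) (rg RP) ;;
  .ite (rg Ri % rg Rd) .skip (.store (cn 7 * (rg Ri / rg Rd) + cn 3) (rg RG))

/-- The fingerprints of the prefix of length `i`, and the position in the input. -/
structure Cur (π : Par) (i : ℕ) (σ : State 40) : Prop where
  F : σ.reg RF = π.Fc i
  G : σ.reg RG = π.Gc i
  P : σ.reg RP = π.Pc i
  pos : σ.pos = min i π.n

lemma Cur.frame {i : ℕ} {s s' : State 40} {cm : Cmd 40} (h : Cur π i s) (hf : Frame cm s s')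
    (h1 : RF ∉ cm.writes) (h2 : RG ∉ cm.writes) (h3 : RP ∉ cm.writes)
    (h4 : cm.noInput = true) : Cur π i s' :=
  ⟨(hf.reg _ h1).trans h.F, (hf.reg _ h2).trans h.G, (hf.reg _ h3).trans h.P,
    (hf.pos h4).trans h.pos⟩

lemma HashMem.succ {i : ℕ} {mem mem' : ℕ → ℕ} (h : HashMem π i mem) (hd : 1 ≤ π.d)
    (hF : mem' (7 * ((i + 1) % (4 * π.s + 4))) = π.Fc (i + 1))
    (hG : mem' (7 * ((i + 1) % (4 * π.s + 4)) + 1) = π.Gc (i + 1))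
    (hP : mem' (7 * ((i + 1) % (4 * π.s + 4)) + 2) = π.Pc (i + 1))
    (hC : π.d ∣ i + 1 → mem' (7 * ((i + 1) / π.d) + 3) = π.Gc (i + 1))
    (hring : ∀ q a, a < 3 → q ≠ (i + 1) % (4 * π.s + 4) → mem' (7 * q + a) = mem (7 * q + a))
    (hcheck : ∀ q, ¬ (π.d ∣ i + 1 ∧ q = (i + 1) / π.d) → mem' (7 * q + 3) = mem (7 * q + 3)) :
    HashMem π (i + 1) mem' := by
  -- Indices less than `4 * s + 4` apart have different residues, so the new entry overwrites only
  -- one that leaves the window.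
  have key : ∀ j, j < i + 1 → i + 1 < j + (4 * π.s + 4) →
      j % (4 * π.s + 4) ≠ (i + 1) % (4 * π.s + 4) := by
    intro j h1 h2 h3
    have := (Nat.modEq_iff_dvd' h1.le).1 h3
    have := Nat.le_of_dvd (by omega) this
    omega
  refine ⟨fun j h1 h2 => ?_, fun j h1 h2 => ?_, fun j h1 h2 => ?_, fun c h1 => ?_⟩
  · rcases h1.eq_or_lt with rfl | h1
    · exact hF
    · rw [← h.F j (by omega) (by omega)]
      exact hring _ 0 (by omega) (key j h1 h2)
  · rcases h1.eq_or_lt with rfl | h1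
    · exact hG
    · rw [← h.G j (by omega) (by omega)]
      exact hring _ 1 (by omega) (key j h1 h2)
  · rcases h1.eq_or_lt with rfl | h1
    · exact hP
    · rw [← h.P j (by omega) (by omega)]
      exact hring _ 2 (by omega) (key j h1 h2)
  · rcases h1.eq_or_lt with h1 | h1
    · have := hC ⟨c, by rw [← h1, mul_comm]⟩
      rwa [← h1, Nat.mul_div_cancel _ (by omega), h1, ← h1] at this
    · rw [← h.C c (by omega)]
      refine hcheck c ?_
      rintro ⟨h2, rfl⟩
      rw [Nat.div_mul_cancel h2] at h1
      omega

/-- Transfer of the invariant to a state with the same run and output. -/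
lemma Main.transfer {i c b i' b' : ℕ} {L L' : List (ℕ × ℕ × ℕ)} {s s' : State 40}
    (h : Main π i c b L s) (hC : Consts π s')
    (hreg : ∀ y : Fin 40, 12 ≤ y.val → y.val < 19 → s'.reg y = s.reg y) (hout : s'.out = s.out)
    (hash : HashMem π i' s'.mem) (hi : s'.reg Ri = i') (arr : SinglesMem L' s'.mem)
    (hfst : L'.map Prod.fst = L.map Prod.fst) (sok : ∀ e ∈ L', SingleOk π e)
    (hsg : π.Good → ∀ e ∈ L', SingleGood π b' e) : Main π i' c b' L' s' := by
  have hlen : L'.length = L.length := by simpa using congrArg List.length hfst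
  have e1 := hreg Rcnt (by decide) (by decide)
  have e2 := hreg Rfst (by decide) (by decide)
  have e3 := hreg Rgap (by decide) (by decide)
  have e4 := hreg Rlast (by decide) (by decide)
  have e5 := hreg Refst (by decide) (by decide)
  have e6 := hreg Relast (by decide) (by decide)
  have e7 := hreg Rns (by decide) (by decide)
  refine ⟨hC, hash, hi, ?_, arr, sok, ?_, ?_, ?_, ?_⟩
  · rw [e7, h.ns, hlen]
  · rw [e1, e2, e3, e4]; exact h.rok
  · rw [hout, hfst, e1, e2, e3]; exact h.perm
  · rw [hlen, e1, e2]; exact h.count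
  · rw [hout, e1, e2, e3, e4, e5, e6]
    exact fun hg => ⟨(h.good hg).1, hsg hg, (h.good hg).2.2⟩

set_option maxHeartbeats 1000000 in
lemma advanceCmd_spec (hV : π.Valid Γ) {s : State 40} {i c b t : ℕ} {L : List (ℕ × ℕ × ℕ)}
    (h : Main π i c b L s) (hcur : Cur π i s) (hin : i + 1 ≤ π.n + 3 * π.s + 2) :
    WP Γ advanceCmd (fun s' t' => Main π (i + 1) c b L s' ∧ Cur π (i + 1) s' ∧ s'.out = s.out ∧
      t' ≤ t + 3 * (8 * π.k + 15)) s t := by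
  have hB := Γ.hB
  have hnB := hV.hnB
  have hsn := hV.s_le
  have hA := hV.hA1
  have hd := hV.hd
  refine WP.seq (WP.assign (i + 1) rfl (by simp [h.i]) (by omega) ?_)
  refine WP.seq (WP.assign 0 rfl rfl (by omega) ?_)
  refine WP.seq ?_
  have hE0 : π.T (i + 1) * π.E < Γ.B := hV.code_lt (hV.hT _)
  suffices hmid : ∀ s2 t2, (∀ y : Fin 40, y ≠ Ri → y ≠ Rv → s2.reg y = s.reg y) → s2.mem = s.mem →
      s2.reg Ri = i + 1 → s2.reg Rv = π.T (i + 1) * π.E → s2.out = s.out →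
      s2.pos = min (i + 1) π.n → t2 ≤ t + 5 →
      WP Γ (setFma RF (rg Rv) (rg RP) (rg RF) ;;
        setFma RG (rg Rr) (rg RG) (rg Rv) ;;
        setFma RP (rg Rr) (rg RP) (cn 0) ;;
        .store (cn 7 * (rg Ri % (cn 4 * rg Rs + cn 4))) (rg RF) ;;
        .store (cn 7 * (rg Ri % (cn 4 * rg Rs + cn 4)) + cn 1) (rg RG) ;;
        .store (cn 7 * (rg Ri % (cn 4 * rg Rs + cn 4)) + cn 2) (rg RP) ;;
        .ite (rg Ri % rg Rd) .skip (.store (cn 7 * (rg Ri / rg Rd) + cn 3) (rg RG)))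
        (fun s' t' => Main π (i + 1) c b L s' ∧ Cur π (i + 1) s' ∧ s'.out = s.out ∧
          t' ≤ t + 3 * (8 * π.k + 15)) s2 t2 by
    refine WP.ite rfl (fun hcond => ?_) (fun hcond => WP.skip ?_)
    · have hcond : i + 1 ≤ π.n := by
        simp [h.consts.n] at hcond; omega
      have hpos : s.pos = i := by rw [hcur.pos]; omega
      have hv : Γ.S.getD s.pos 0 + 1 = π.T (i + 1) := by
        rw [hV.hS, hpos, Par.T, if_pos (by omega)]
        rfl
      have hvB := hV.hTB (i + 1)
      have hv' : Γ.S.getD s.pos 0 = symbol π.S (i + 1) := by rw [hV.hS, hpos]; rfl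
      refine WP.seq (WP.read (by simp only [State.set_pos, hv']; omega) ?_)
      refine WP.assign (π.T (i + 1) * π.E) rfl ?_ hE0 ?_
      · rw [← hv, Expr.nat_mul, Expr.nat_add, Expr.nat_reg, Expr.nat_reg]
        simp [h.consts.E]
      refine hmid _ _ ?_ rfl ?_ (by simp) rfl ?_ (by omega)
      · intro y h1 h2
        simp [h1, h2]
      · simp
      · change s.pos + 1 = _
        omega
    · have hcond : π.n ≤ i := by
        simp [h.consts.n] at hcond; omega
      refine hmid _ _ ?_ rfl (by simp) ?_ rfl ?_ (by omega)
      · intro y h1 h2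
        simp [h1, h2]
      · rw [Par.T, if_neg (by omega)]
        simp
      · change s.pos = _
        rw [hcur.pos]; omega
  intro s2 t2 hreg2 hmem2 hi2 hv2 hout2 hpos2 ht2
  have hC2 : Consts π s2 := h.consts.of_eq fun y hy => by
    have h1 : y ≠ Ri := by rintro rfl; revert hy; decide
    have h2 : y ≠ Rv := by rintro rfl; revert hy; decide
    exact hreg2 y h1 h2
  have hF2 := (hreg2 RF (by decide) (by decide)).trans hcur.F
  have hG2 := (hreg2 RG (by decide) (by decide)).trans hcur.G
  have hP2 := (hreg2 RP (by decide) (by decide)).trans hcur.P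
  refine WP.ok fun ho2 => ?_
  have hFB : π.Fc i < Γ.B := hF2 ▸ ho2.reg RF
  have hGB : π.Gc i < Γ.B := hG2 ▸ ho2.reg RG
  have hPB : π.Pc i < Γ.B := hP2 ▸ ho2.reg RP
  have hrB : π.r < Γ.B := hV.code_lt hV.hr
  refine WP.seq ((setFma_spec hV hC2 (x := π.T (i + 1) * π.E) (y := π.Pc i) (w := π.Fc i)
    rfl rfl rfl (by simp [hv2]) (fun ρ hρ => by simp [hρ, hP2]) (fun ρ hρ => by simp [hρ, hF2])
    hE0 hPB hFB).use ?_)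
  rintro s3 t3 hf3 - ⟨hF3, ht3⟩
  have hC3 := hC2.frame hf3 (by decide)
  have hG3 := (hf3.reg RG (by decide)).trans hG2
  have hP3 := (hf3.reg RP (by decide)).trans hP2
  have hv3 := (hf3.reg Rv (by decide)).trans hv2
  refine WP.seq ((setFma_spec hV hC3 (x := π.r) (y := π.Gc i) (w := π.T (i + 1) * π.E)
    rfl rfl rfl (by simp [hC3.r]) (fun ρ hρ => by simp [hρ, hG3]) (fun ρ hρ => by simp [hρ, hv3])
    hrB hGB hE0).use ?_)
  rintro s4 t4 hf4 - ⟨hG4, ht4⟩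
  have hC4 := hC3.frame hf4 (by decide)
  have hF4 := (hf4.reg RF (by decide)).trans hF3
  have hP4 := (hf4.reg RP (by decide)).trans hP3
  refine WP.seq ((setFma_spec hV hC4 (x := π.r) (y := π.Pc i) (w := 0)
    rfl rfl rfl (by simp [hC4.r]) (fun ρ hρ => by simp [hρ, hP4]) (fun ρ hρ => by simp)
    hrB hPB (by omega)).use ?_)
  rintro s5 t5 hf5 - ⟨hP5, ht5⟩
  have hC5 := hC4.frame hf5 (by decide)
  have hF5 : s5.reg RF = π.Fc (i + 1) := (hf5.reg RF (by decide)).trans hF4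
  have hG5 : s5.reg RG = π.Gc (i + 1) := (hf5.reg RG (by decide)).trans hG4
  have hP5 : s5.reg RP = π.Pc (i + 1) := hP5
  have hi5 : s5.reg Ri = i + 1 := by
    rw [hf5.reg Ri (by decide), hf4.reg Ri (by decide), hf3.reg Ri (by decide), hi2]
  have hmem5 : s5.mem = s.mem := by rw [hf5.mem rfl, hf4.mem rfl, hf3.mem rfl, hmem2]
  have hout5 : s5.out = s.out := by rw [hf5.out rfl, hf4.out rfl, hf3.out rfl, hout2]
  have hpos5 : s5.pos = min (i + 1) π.n := by
    rw [hf5.pos rfl, hf4.pos rfl, hf3.pos rfl, hpos2]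
  have hreg5 : ∀ y : Fin 40, 12 ≤ y.val → y.val < 19 → s5.reg y = s.reg y := by
    intro y h1 h2
    rw [hf5.reg y (by revert y; decide), hf4.reg y (by revert y; decide),
      hf3.reg y (by revert y; decide), hreg2 y (by rintro rfl; revert h1; decide)
      (by rintro rfl; revert h2; decide)]
  have hFB : π.Fc (i + 1) < Γ.B := hV.fma_lt_B _ _ _
  have hGB : π.Gc (i + 1) < Γ.B := hV.fma_lt_B _ _ _
  have hPB : π.Pc (i + 1) < Γ.B := hV.fma_lt_B _ _ _
  have hlt := Nat.mod_lt (i + 1) (show 0 < 4 * π.s + 4 by omega)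
  clear hf3 hf4 hf5
  refine WP.seq (WP.store (7 * ((i + 1) % (4 * π.s + 4))) (π.Fc (i + 1)) rfl rfl (by decide)
    (by simp [hi5, hC5.s]) (by omega) (by simp [hF5]) hFB ?_)
  refine WP.seq (WP.store (7 * ((i + 1) % (4 * π.s + 4)) + 1) (π.Gc (i + 1)) rfl rfl (by decide)
    (by simp [hi5, hC5.s]) (by omega) (by simp [hG5]) hGB ?_)
  refine WP.seq (WP.store (7 * ((i + 1) % (4 * π.s + 4)) + 2) (π.Pc (i + 1)) rfl rfl (by decide)
    (by simp [hi5, hC5.s]) (by omega) (by simp [hP5]) hPB ?_)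
  refine WP.ite rfl (fun hcond => WP.skip ?_) (fun hcond => ?_)
  · have hcond : ¬ π.d ∣ i + 1 := by
      simpa [hi5, hC5.d, Nat.dvd_iff_mod_eq_zero] using hcond
    refine ⟨h.transfer (hC5.of_eq fun _ _ => rfl) hreg5 hout5 ?_ hi5 ?_ rfl h.sok fun hg => (h.good hg).2.1,
      ⟨hF5, hG5, hP5, hpos5⟩, hout5, by omega⟩
    · refine h.hash.succ hd ?_ ?_ ?_ ?_ ?_ ?_ <;> simp only [State.st_mem, hmem5]
      · rw [if_neg (by omega), if_neg (by omega), if_pos trivial]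
      · rw [if_neg (by omega), if_pos trivial]
      · rw [if_pos trivial]
      · exact fun h => absurd h hcond
      · intro q a ha hq
        rw [if_neg (by omega), if_neg (by omega), if_neg (by omega)]
      · intro q _
        rw [if_neg (by omega), if_neg (by omega), if_neg (by omega)]
    · refine h.arr.of_eq fun q a h1 h2 => ?_
      simp only [State.st_mem, hmem5]
      rw [if_neg (by omega), if_neg (by omega), if_neg (by omega)]
  · have hcond : π.d ∣ i + 1 := by
      simpa [hi5, hC5.d, Nat.dvd_iff_mod_eq_zero] using hcond
    have hA2 := hV.hA2 ((i + 1) / π.d) (by rw [Nat.div_mul_cancel hcond]; omega)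
    refine WP.store (7 * ((i + 1) / π.d) + 3) (π.Gc (i + 1)) rfl rfl (by decide)
      (by simp [hi5, hC5.d]) (by omega) (by simp [hG5]) hGB ?_
    refine ⟨h.transfer (hC5.of_eq fun _ _ => rfl) hreg5 hout5 ?_ hi5 ?_ rfl h.sok fun hg => (h.good hg).2.1,
      ⟨hF5, hG5, hP5, hpos5⟩, hout5, by omega⟩
    · refine h.hash.succ hd ?_ ?_ ?_ ?_ ?_ ?_ <;> simp only [State.st_mem, hmem5]
      · rw [if_neg (by omega), if_neg (by omega), if_neg (by omega), if_pos trivial]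
      · rw [if_neg (by omega), if_neg (by omega), if_pos trivial]
      · rw [if_neg (by omega), if_pos trivial]
      · exact fun _ => if_pos trivial
      · intro q a ha hq
        rw [if_neg (by omega), if_neg (by omega), if_neg (by omega), if_neg (by omega)]
      · intro q hq
        have : q ≠ (i + 1) / π.d := fun h => hq ⟨hcond, h⟩
        rw [if_neg (by omega), if_neg (by omega), if_neg (by omega), if_neg (by omega)]
    · refine h.arr.of_eq fun q a h1 h2 => ?_
      simp only [State.st_mem, hmem5]
      rw [if_neg (by omega), if_neg (by omega), if_neg (by omega), if_neg (by omega)]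

/-! ### Updating the single midpoints -/

/-- Update the estimates of all single midpoints. -/
def batchCmd : Cmd 40 :=
  .assign Rq (cn 0) ;;
  .loop (.bin .lt (rg Rq) (rg Rns))
    (.load Rc (cn 7 * rg Rq + cn 4) ;; .load Rx (cn 7 * rg Rq + cn 5) ;;
    .load RH (cn 7 * rg Rq + cn 6) ;;
    .ite (.bin .lt (rg Ri) (rg Rc + rg Rx + rg Rd))
      (scanCmd ;; .store (cn 7 * rg Rq + cn 5) (rg Rx)) .skip ;;
    .assign Rq (rg Rq + cn 1))

/-- Invariant of the loop in `batchCmd`. -/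
structure Batch (π : Par) (i b : ℕ) (L : List (ℕ × ℕ × ℕ)) (σ₀ : State 40) (t₀ j : ℕ)
    (σ : State 40) (t : ℕ) : Prop where
  reg : ∀ y : Fin 40, y.val < 19 → σ.reg y = σ₀.reg y
  out : σ.out = σ₀.out
  pos : σ.pos = σ₀.pos
  hash : HashMem π i σ.mem
  idx : σ.reg Rq = j
  singles : ∃ L' : List (ℕ × ℕ × ℕ), SinglesMem L' σ.mem ∧ L'.map Prod.fst = L.map Prod.fst ∧
    (∀ e ∈ L', SingleOk π e) ∧ (π.Good → ∀ (q : ℕ) (e : ℕ × ℕ × ℕ), L'[q]? = some e →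
      SingleGood π (if q < j then i else b) e)
  time : t ≤ t₀ + 4 * (8 * π.k + 15) * j

lemma Main.length_le {i c b : ℕ} {L : List (ℕ × ℕ × ℕ)} {s : State 40} (h : Main π i c b L s) :
    s.out.length + L.length + s.reg Rcnt = min c π.n := by
  have hlen := h.perm.length_eq
  simp only [List.length_append, List.length_map, length_runList, List.length_range'] at hlen
  omega

/-- If the next arm would have ended at least `d` symbols ago, it was already refuted at the
previous update. Nothing needs to be recomputed, and the ring buffer may have forgotten its end. -/
lemma SingleGood.of_le {i b d : ℕ} {e : ℕ × ℕ × ℕ} (h : SingleGood π b e) (hb : i ≤ b + d)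
    (hi : e.1 + e.2.1 + d ≤ i) : SingleGood π i e :=
  ⟨h.hash, h.pal, fun _ => h.halt (by omega)⟩

lemma SingleOk.of_scan {i : ℕ} {e : ℕ × ℕ × ℕ} {x' : ℕ} (h : SingleOk π e)
    (hR : ScanRes π i e.1 e.2.2 e.2.1 x') : SingleOk π (e.1, x', e.2.2) where
  pos := h.pos
  le := h.le
  dx := h.dx.trans hR.le
  xle := by
    have := h.xle
    rcases hR.pass with h | h
    · simp only; omega
    · exact h.2.1
  dvd := hR.dvd

set_option maxHeartbeats 1000000 in
-- Updates follow each other at distance at most `d`, and only entries whose next arm ends after `i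
-- - d` are scanned. The ring buffer therefore suffices, and each entry costs a bounded number of
-- tests.
lemma batchCmd_spec (hV : π.Valid Γ) {s : State 40} {i c b t : ℕ} {L : List (ℕ × ℕ × ℕ)}
    (h : Main π i c b L s) (hb : i ≤ b + π.d) (hbi : b ≤ i) (hin : i ≤ π.n + 3 * π.s + 2)
    (hLA : 7 * L.length ≤ Γ.A) :
    WP Γ batchCmd (fun s' t' => ∃ L', Main π i c i L' s' ∧ s'.out = s.out ∧
      L'.length = L.length ∧ t' ≤ t + 4 * (8 * π.k + 15) * L.length + 2) s t := by
  have hB := Γ.hB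
  have hnB := hV.hnB
  have hds := hV.hds
  have hd := hV.hd
  have hsn := hV.s_le
  have hLn : L.length ≤ π.n := by have := h.length_le; omega
  have hconst : ∀ s' : State 40, (∀ y : Fin 40, y.val < 19 → s'.reg y = s.reg y) →
      Consts π s' := fun s' hs => h.consts.of_eq fun y hy => hs y (by omega)
  refine WP.seq (WP.assign 0 rfl rfl (by omega) ?_)
  refine WP.for rfl (Batch π i b L s (t + 1)) L.length ?_ ?_ ?_ ?_
  · intro j s' t' hj hI
    have := (hI.reg Rns (by decide)).trans h.ns
    simp [hI.idx, this]
  · intro j s' t' ho hj hI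
    obtain ⟨L', h1, h2, h3, h4⟩ := hI.singles
    have hlen : L'.length = L.length := by simpa using congrArg List.length h2
    have hget : L'[j]? = some L'[j] := List.getElem?_eq_getElem (by omega)
    set e := L'[j] with he
    have hmem : e ∈ L' := List.getElem_mem _
    have hok := h3 e hmem
    obtain ⟨g1, g2, g3⟩ := h1 j e hget
    have hOd := hok.dx
    have hOx := hok.xle
    have hOn := hok.le
    have hj' := hI.idx
    refine WP.seq (WP.load (7 * j + 4) e.1 rfl (by simp [hj']) (by omega) g1 ?_)
    refine WP.seq (WP.load (7 * j + 5) e.2.1 rfl (by simp [hj']) (by omega) (by simpa using g2) ?_)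
    refine WP.seq (WP.load (7 * j + 6) e.2.2 rfl (by simp [hj']) (by omega) (by simpa using g3) ?_)
    refine WP.seq ?_
    set s1 := ((s'.ld Rc (7 * j + 4) e.1).ld Rx (7 * j + 5) e.2.1).ld RH (7 * j + 6) e.2.2 with hs1
    have hreg1 : ∀ y : Fin 40, y.val < 19 → s1.reg y = s.reg y := by
      intro y hy
      have h1 : y ≠ Rc := by rintro rfl; revert hy; decide
      have h2 : y ≠ Rx := by rintro rfl; revert hy; decide
      have h3 : y ≠ RH := by rintro rfl; revert hy; decide
      simp [hs1, h1, h2, h3, hI.reg y hy]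
    have hC1 := hconst s1 hreg1
    have hi1 : s1.reg Ri = i := (hreg1 Ri (by decide)).trans h.i
    have hc1 : s1.reg Rc = e.1 := by simp [hs1]
    have hx1 : s1.reg Rx = e.2.1 := by simp [hs1]
    have hH1 : s1.reg RH = e.2.2 := by simp [hs1]
    have hq1 : s1.reg Rq = j := by simp [hs1, hj']
    have hmem1 : s1.mem = s'.mem := by simp [hs1]
    have hout1 : s1.out = s.out := by simp [hs1, hI.out]
    have hpos1 : s1.pos = s.pos := by simp [hs1, hI.pos]
    clear_value s1
    have htime := hI.time
    refine WP.ite rfl (fun hcond => ?_) (fun hcond => WP.skip ?_)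
    · have hcond : i < e.1 + e.2.1 + π.d := by
        simp [hi1, hc1, hx1, hC1.d] at hcond; omega
      refine WP.seq ((scanCmd_spec hV hC1 (i := i) (m := e.1) (x := e.2.1) (H := e.2.2)
        (by rw [hmem1]; exact hI.hash) hi1 hc1 hx1 hH1 hin (by omega) hok.dvd).use ?_)
      rintro s2 t2 hf2 - ⟨⟨x', hx', hR⟩, ht2⟩
      have hq2 := (hf2.reg Rq (by decide)).trans hq1
      have hok' := hok.of_scan hR
      have hx'B : x' < Γ.B := by
        have := hok'.xle
        simp only at this
        omega
      have hmem2 : s2.mem = s'.mem := by rw [hf2.mem rfl, hmem1]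
      refine WP.store (7 * j + 5) x' rfl rfl (by decide) (by simp [hq2]) (by omega)
        (by simp [hx']) hx'B ?_
      refine WP.assign (j + 1) rfl (by simp [hq2]) (by omega) ?_
      refine ⟨?_, ?_, ?_, ?_, by simp, ⟨L'.set j (e.1, x', e.2.2), ?_, ?_, ?_, ?_⟩, ?_⟩
      · intro y hy
        have hy1 : y ≠ Rq := by rintro rfl; revert hy; decide
        rw [State.set_reg, if_neg hy1, State.st_reg,
          hf2.reg y (by clear hy1; revert y; decide)]
        exact hreg1 y hy
      · simp [hf2.out rfl, hout1]
      · simp [hf2.pos rfl, hpos1]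
      · refine hI.hash.of_eq fun q a ha => ?_
        simp only [State.set_mem, State.st_mem, hmem2]
        rw [if_neg (by omega)]
      · intro q e' hq
        simp only [State.set_mem, State.st_mem, hmem2]
        rw [if_neg (by omega), if_neg (show 7 * q + 6 ≠ 7 * j + 5 by omega)]
        by_cases hqj : q = j
        · subst hqj
          rw [List.getElem?_set_self (by omega)] at hq
          cases hq
          exact ⟨g1, if_pos rfl, g3⟩
        · rw [List.getElem?_set_ne (by omega)] at hq
          rw [if_neg (by omega)]
          exact h1 q e' hq
      · rw [List.map_set, h2]
        apply List.ext_getElem?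
        intro q
        by_cases hqj : q = j
        · subst hqj
          rw [List.getElem?_set_self (by simpa using hj), ← h2]
          simp [hget]
        · rw [List.getElem?_set_ne (by omega)]
      · intro e' he'
        rcases List.mem_or_eq_of_mem_set he' with h | rfl
        exacts [h3 e' h, hok']
      · intro hg q e' hq
        by_cases hqj : q = j
        · subst hqj
          rw [List.getElem?_set_self (by omega)] at hq
          cases hq
          rw [if_pos (by omega)]
          have hG := h4 hg _ _ hget
          exact singleGood_of_scan hV.hp hg hok.pos hok.le hG.hash hG.pal le_rfl hR
        · rw [List.getElem?_set_ne (by omega)] at hq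
          have := h4 hg q e' hq
          rwa [show (if q < j + 1 then i else b) = if q < j then i else b by
            split_ifs <;> omega]
      -- The next arm ends after `i - d`, so less than `2 * d` is left.
      · have : (i + π.d - (e.1 + e.2.1)) / π.d ≤ 1 := by
          rw [← Nat.lt_succ_iff, Nat.div_lt_iff_lt_mul hd]
          omega
        have := Nat.mul_le_mul_left (8 * π.k + 15) (Nat.add_le_add_right this 2)
        rw [Nat.mul_add_one]
        omega
    · have hcond : e.1 + e.2.1 + π.d ≤ i := by
        simp [hi1, hc1, hx1, hC1.d] at hcond; omega
      refine WP.assign (j + 1) rfl (by simp [hq1]) (by omega) ?_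
      refine ⟨?_, by simp [hout1], by simp [hpos1], by simpa [hmem1] using hI.hash, by simp,
        ⟨L', by simpa [hmem1] using h1, h2, h3, ?_⟩, ?_⟩
      · intro y hy
        have hy1 : y ≠ Rq := by rintro rfl; revert hy; decide
        simp [hy1, hreg1 y hy]
      · intro hg q e' hq
        by_cases hqj : q = j
        · subst hqj
          rw [hget] at hq
          obtain rfl := (Option.some.inj hq).symm
          rw [if_pos (by omega)]
          have := h4 hg q e hget
          rw [if_neg (by omega)] at this
          exact this.of_le hb hcond
        · have := h4 hg q e' hq
          rwa [show (if q < j + 1 then i else b) = if q < j then i else b by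
            split_ifs <;> omega]
      · rw [Nat.mul_add_one]
        omega
  · refine ⟨?_, rfl, rfl, by simpa using h.hash, by simp, ⟨L, by simpa using h.arr, rfl, h.sok, ?_⟩,
      by simp⟩
    · intro y hy
      have hy1 : y ≠ Rq := by rintro rfl; revert hy; decide
      simp [hy1]
    · intro hg q e hq
      simpa using (h.good hg).2.1 e (List.mem_of_getElem? hq)
  · intro s' t' ho hI
    obtain ⟨L', h1, h2, h3, h4⟩ := hI.singles
    have hlen : L'.length = L.length := by simpa using congrArg List.length h2
    refine ⟨L', h.transfer (hconst s' hI.reg) (fun y _ hy => hI.reg y hy) hI.out hI.hash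
      ((hI.reg Ri (by decide)).trans h.i) h1 h2 h3 fun hg e he => ?_, hI.out, hlen, ?_⟩
    · obtain ⟨q, hq, rfl⟩ := List.getElem_of_mem he
      have := h4 hg q L'[q] (List.getElem?_eq_getElem hq)
      rwa [if_pos (by omega)] at this
    · have := hI.time
      omega

end PalStream

/-! ### The main loop and its amortized running time. -/

namespace PalStream

variable {π : Par} {Γ : Env}

/-! ### The main loop -/

/-- Work after one more symbol. -/
def bodyCmd : Cmd 40 :=
  advanceCmd ;; .ite (.bin .lt (cn 2 * rg Rs) (rg Ri)) midpointCmd .skip ;;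
  .ite (rg Ri % rg Rd) .skip batchCmd

/-- Invariant of the main loop. -/
structure Loop (π : Par) (K t₀ i : ℕ) (σ : State 40) (t : ℕ) : Prop where
  cur : Cur π i σ
  main : ∃ L, Main π i (i - 2 * π.s) (i / π.d * π.d) L σ ∧
    t ≤ t₀ + (8 * π.k + 15) * (2 * (2 * π.s / π.d) + 20) * i +
      (8 * π.k + 15) * (σ.out.length + L.length) + 4 * (8 * π.k + 15) * (K + 1) * (i / π.d)

/-- Each single midpoint uses up a stretch of `s / 2 + 1` midpoints of its own, which bounds the
list by O(√n). -/
lemma Main.count_le {i c b : ℕ} {L : List (ℕ × ℕ × ℕ)} {s : State 40} (h : Main π i c b L s)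
    (hc : c ≤ π.n + π.s / 2 + 1) : L.length * (π.s / 2 + 1) ≤ π.n + π.s / 2 + 2 := by
  have h1 := h.count
  split_ifs at h1 with hk
  · omega
  · have := h.rok.last (by omega)
    have := h.rok.lastn (by omega)
    omega

set_option maxHeartbeats 1000000 in
-- The time in `Loop` has three parts: the examination, paid per symbol; the closing of runs, paid
-- per midpoint that leaves a run; and the updates of at most `K` entries, paid once per `d`
-- symbols.
lemma bodyCmd_spec (hV : π.Valid Γ) {K t₀ i t : ℕ} {s : State 40} (h : Loop π K t₀ i s t)
    (hK : ∀ x, x * (π.s / 2 + 1) ≤ π.n + π.s / 2 + 2 → x ≤ K)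
    (hi : i < π.n + 2 * π.s + π.s / 2 + 1) :
    WP Γ bodyCmd (fun s' t' => Loop π K t₀ (i + 1) s' t') s (t + 1) := by
  have hd := hV.hd
  have hds := hV.hds
  obtain ⟨L, hM, ht⟩ := h.main
  have hdm := Nat.div_add_mod' i π.d
  have hml := Nat.mod_lt i (show 0 < π.d by omega)
  refine WP.seq ((advanceCmd_spec hV hM h.cur (by omega)).mono ?_)
  rintro s1 t1 - - ⟨hM1, hcur1, hout1, ht1⟩
  refine WP.seq ?_
  have e1 : (8 * π.k + 15) * (2 * (2 * π.s / π.d) + 20) * (i + 1) = (8 * π.k + 15) * (2 * (2 * π.s / π.d) + 20) * i + (8 * π.k + 15) * (2 * (2 * π.s / π.d) + 14) + (8 * π.k + 15) * 6 := by ring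
  suffices hmid : ∀ s2 t2 L2, Main π (i + 1) (i + 1 - 2 * π.s) (i / π.d * π.d) L2 s2 →
      Cur π (i + 1) s2 →
      t2 + 4 ≤ t₀ + (8 * π.k + 15) * (2 * (2 * π.s / π.d) + 20) * (i + 1) + (8 * π.k + 15) * (s2.out.length + L2.length) +
        4 * (8 * π.k + 15) * (K + 1) * (i / π.d) →
      WP Γ (.ite (rg Ri % rg Rd) .skip batchCmd) (fun s' t' => Loop π K t₀ (i + 1) s' t') s2 t2 by
    refine WP.ite rfl (fun hcond => ?_) (fun hcond => WP.skip ?_)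
    · have hcond : 2 * π.s < i + 1 := by
        simp [hM1.i, hM1.consts.s] at hcond; omega
      refine (midpointCmd_spec hV hM1 (by omega) (by omega) (by omega)).use ?_
      rintro s2 t2 hf2 - ⟨L2, hM2, ht2⟩
      rw [show i - 2 * π.s + 1 = i + 1 - 2 * π.s by omega] at hM2
      refine hmid s2 t2 L2 hM2 (hcur1.frame hf2 (by decide) (by decide) (by decide) rfl) ?_
      rw [hout1] at ht2
      omega
    · have hcond : i + 1 ≤ 2 * π.s := by
        simp [hM1.i, hM1.consts.s] at hcond; omega
      rw [show i - 2 * π.s = i + 1 - 2 * π.s by omega] at hM1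
      refine hmid s1 _ L hM1 hcur1 ?_
      rw [hout1]
      omega
  intro s2 t2 L2 hM2 hcur2 ht2
  have hL2 := hM2.count_le (by omega)
  have hL2K := hK _ hL2
  refine WP.ite rfl (fun hcond => WP.skip ?_) (fun hcond => ?_)
  · have hcond : ¬ π.d ∣ i + 1 := by
      simpa [hM2.i, hM2.consts.d, Nat.dvd_iff_mod_eq_zero] using hcond
    have hdiv : (i + 1) / π.d = i / π.d := by rw [Nat.succ_div, if_neg hcond]; rfl
    refine ⟨hcur2, L2, ?_, ?_⟩ <;> rw [hdiv]
    · exact hM2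
    · omega
  · have hcond : π.d ∣ i + 1 := by
      simpa [hM2.i, hM2.consts.d, Nat.dvd_iff_mod_eq_zero] using hcond
    have hdiv : (i + 1) / π.d = i / π.d + 1 := by rw [Nat.succ_div, if_pos hcond]
    have hb : (i + 1) / π.d * π.d = i + 1 := Nat.div_mul_cancel hcond
    refine (batchCmd_spec hV hM2 (by omega) (by omega) (by omega) ?_).use ?_
    · have := hV.hA3 _ hL2; omega
    rintro s3 t3 hf3 - ⟨L3, hM3, hout3, hlen3, ht3⟩
    refine ⟨hcur2.frame hf3 (by decide) (by decide) (by decide) rfl, L3, by rwa [hb], ?_⟩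
    rw [hdiv, hout3, hlen3, Nat.mul_add_one (4 * (8 * π.k + 15) * (K + 1))]
    have := Nat.mul_le_mul_left (4 * (8 * π.k + 15)) (show L2.length ≤ K + 1 by omega)
    omega

/-- Report the single midpoints. -/
def reportCmd : Cmd 40 :=
  .assign Rq (cn 0) ;;
  .loop (.bin .lt (rg Rq) (rg Rns))
    (.load Rc (cn 7 * rg Rq + cn 4) ;; .load Rx (cn 7 * rg Rq + cn 5) ;;
    .emit (rg Rc) (rg Rx - rg Rd) ;; .assign Rq (rg Rq + cn 1))

lemma reportCmd_spec (hV : π.Valid Γ) {s : State 40} {i c b t : ℕ} {L : List (ℕ × ℕ × ℕ)}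
    (h : Main π i c b L s) (hk : s.reg Rcnt = 0) (hc : π.n ≤ c) (hb : π.n ≤ b)
    (hLA : 7 * L.length ≤ Γ.A) :
    WP Γ reportCmd (fun s' t' => (s'.out.map Prod.fst).Perm (List.range' 1 π.n) ∧
      (π.Good → ∀ q ∈ s'.out, Par.Acc π q) ∧ t' ≤ t + 5 * L.length + 2) s t := by
  have hB := Γ.hB
  have hnB := hV.hnB
  have hLn : L.length ≤ π.n := by have := h.length_le; omega
  refine WP.seq (WP.assign 0 rfl rfl (by omega) ?_)
  refine WP.for rfl (fun j σ t' => σ.reg Rq = j ∧ σ.reg Rns = L.length ∧ σ.reg Rd = π.d ∧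
    σ.mem = s.mem ∧ σ.out = s.out ++ (L.take j).map (fun e => (e.1, e.2.1 - π.d)) ∧
    t' ≤ t + 1 + 5 * j) L.length ?_ ?_ ?_ ?_
  · rintro j s' t' hj ⟨h1, h2, -⟩
    simp [h1, h2]
  · rintro j s' t' ho hj ⟨h1, h2, h3, h4, h5, h6⟩
    obtain ⟨g1, g2, -⟩ := h.arr j L[j] (List.getElem?_eq_getElem hj)
    refine WP.seq (WP.load (7 * j + 4) L[j].1 rfl (by simp [h1]) (by omega) (by rw [h4, g1]) ?_)
    refine WP.seq (WP.load (7 * j + 5) L[j].2.1 rfl (by simp [h1]) (by omega)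
      (by rw [State.ld_mem, h4, g2]) ?_)
    refine WP.seq (WP.emit rfl rfl (by decide) (L[j].1, L[j].2.1 - π.d) (by simp [h3]) ?_)
    refine WP.assign (j + 1) rfl (by simp [h1]) (by omega) ?_
    refine ⟨by simp, by simp [h2], by simp [h3], by simp [h4], ?_, by omega⟩
    rw [List.take_succ_eq_append_getElem hj, List.map_append, State.set_out, State.put_out,
      State.ld_out, State.ld_out, h5, List.append_assoc]
    rfl
  · exact ⟨by simp, by simp [h.ns], by simp [h.consts.d], by simp, by simp, by omega⟩
  · rintro s' t' ho ⟨h1, h2, h3, h4, h5, h6⟩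
    rw [List.take_length] at h5
    refine ⟨?_, fun hg q hq => ?_, by omega⟩
    · have hp := h.perm
      rw [hk, show runList 0 _ _ = [] from rfl, List.append_nil, min_eq_right hc] at hp
      rw [h5, List.map_append, List.map_map]
      exact hp
    · rw [h5, List.mem_append, List.mem_map] at hq
      rcases hq with hq | ⟨e, he, rfl⟩
      · exact (h.good hg).1 q hq
      · have hS := (h.good hg).2.1 e he
        have hO := h.sok e he
        refine ⟨hS.pal, ?_⟩
        simp only
        rw [Nat.sub_add_cancel hO.dx]
        intro hp
        -- The longer palindrome would end at or before `n ≤ b`, hence would have been tested by the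
        -- time of the last update.
        exact hS.halt (le_trans (hp.add_le hO.le) hb) hp

/-- The streaming algorithm after the choice of the parameters. -/
def mainCmd : Cmd 40 :=
  .assign Ri (cn 0) ;; .assign RF (cn 0) ;; .assign RG (cn 0) ;; .assign RP (rg Rr) ;;
  .assign Rcnt (cn 0) ;; .assign Rns (cn 0) ;; .store (cn 2) (rg Rr) ;;
  .loop (.bin .lt (rg Ri) (rg Rn + cn 2 * rg Rs + rg Rs / cn 2 + cn 1)) bodyCmd ;;
  reportCmd

set_option maxHeartbeats 1000000 in
lemma mainCmd_spec (hV : π.Valid Γ) {s : State 40} (hC : Consts π s) (hmem : ∀ a, s.mem a = 0)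
    (hpos : s.pos = 0) (hout : s.out = []) {K N t : ℕ}
    (hK : ∀ x, x * (π.s / 2 + 1) ≤ π.n + π.s / 2 + 2 → x ≤ K)
    (hN : N = π.n + 2 * π.s + π.s / 2 + 1) :
    WP Γ mainCmd (fun s' t' => (s'.out.map Prod.fst).Perm (List.range' 1 π.n) ∧
      (π.Good → ∀ q ∈ s'.out, Par.Acc π q) ∧
      t' ≤ t + (8 * π.k + 15) * (2 * (2 * π.s / π.d) + 20) * (N + 1) +
        2 * (8 * π.k + 15) * π.n + 4 * (8 * π.k + 15) * (K + 1) * (N / π.d)) s t := by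
  have hB := Γ.hB
  have hA := hV.hA1
  have hd := hV.hd
  have hds := hV.hds
  have hrB : π.r < Γ.B := hV.code_lt hV.hr
  refine WP.seq (WP.assign 0 rfl rfl (by omega) ?_)
  refine WP.seq (WP.assign 0 rfl rfl (by omega) ?_)
  refine WP.seq (WP.assign 0 rfl rfl (by omega) ?_)
  refine WP.seq (WP.assign π.r rfl (by simp [hC.r]) hrB ?_)
  refine WP.seq (WP.assign 0 rfl rfl (by omega) ?_)
  refine WP.seq (WP.assign 0 rfl rfl (by omega) ?_)
  refine WP.seq (WP.store 2 π.r rfl rfl (by decide) rfl (by omega) (by simp [hC.r]) hrB ?_)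
  refine WP.seq (WP.for rfl (Loop π K (t + 7)) N ?_ ?_ ?_ ?_)
  · rintro j s' t' hj ⟨-, L, hM, -⟩
    simp [hM.i, hM.consts.n, hM.consts.s, hN]
  · exact fun j s' t' ho hj hI => bodyCmd_spec hV hI hK (by omega)
  · refine ⟨⟨by simp; rfl, by simp; rfl, by simp; rfl, by simp [hpos]⟩, [], ⟨?_, ?_, by simp, by simp, ?_,
      by simp, ?_, by simp [hout, runList], by simp, fun _ => ⟨by simp [hout], by simp, ?_⟩⟩, ?_⟩
    · refine hC.of_eq fun y hy => ?_
      have h1 : y ≠ Ri := by rintro rfl; revert hy; decide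
      have h2 : y ≠ RF := by rintro rfl; revert hy; decide
      have h3 : y ≠ RG := by rintro rfl; revert hy; decide
      have h4 : y ≠ RP := by rintro rfl; revert hy; decide
      have h5 : y ≠ Rcnt := by rintro rfl; revert hy; decide
      have h6 : y ≠ Rns := by rintro rfl; revert hy; decide
      simp [h1, h2, h3, h4, h5, h6]
    · have h0 : ∀ j, j ≤ 0 → j = 0 := fun j hj => by omega
      constructor
      · intro j hj _
        obtain rfl := h0 j hj
        simp [hmem, Par.Fc]
      · intro j hj _
        obtain rfl := h0 j hj
        simp [hmem, Par.Gc]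
      · intro j hj _
        obtain rfl := h0 j hj
        simp [Par.Pc]
      · intro c hc
        have : c = 0 := by
          rcases Nat.eq_zero_or_pos c with h | h
          · exact h
          · have := Nat.mul_pos h hd; omega
        subst this
        simp [hmem, Par.Gc]
    · intro q e hq
      simp at hq
    · constructor <;> simp
    · constructor <;> simp
      · intro hp
        have := hp.1
        omega
    · simp only [Nat.mul_zero, Nat.zero_div]; omega
  · rintro s' t' ho ⟨-, L, hM, ht⟩
    have hdm := Nat.div_add_mod' N π.d
    have hml := Nat.mod_lt N (show 0 < π.d by omega)
    -- A midpoint is examined with delay `2 * s`, and a run is closed once `s / 2` further midpoints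
    -- have passed. `N` leaves room for both, so no run is open at the end.
    have hk : s'.reg Rcnt = 0 := by
      by_contra hk
      have h1 := hM.rok.cle (by omega)
      have h2 := hM.rok.lastn (by omega)
      omega
    have hLA := hV.hA3 _ (hM.count_le (by omega))
    have hlen := hM.length_le
    refine (reportCmd_spec hV hM hk (by omega) (by omega) (by omega)).mono ?_
    rintro s2 t2 - - ⟨h1, h2, h3⟩
    refine ⟨h1, h2, ?_⟩
    set U := 8 * π.k + 15 with hU
    set q := 2 * π.s / π.d with hq
    have e1 : U * (2 * q + 20) * (N + 1) = U * (2 * q + 20) * N + U * (2 * q) + U * 20 := by ring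
    have e2 := Nat.mul_le_mul_left U (show s'.out.length + L.length ≤ π.n by omega)
    have e3 : 5 * L.length ≤ U * π.n := Nat.mul_le_mul (by omega) (by omega)
    have e4 : 2 * U * π.n = U * π.n + U * π.n := by ring
    omega

end PalStream

/-! ### A prime and a quadratic nonresidue that are found in linear time. -/

namespace PalStream

/-! ### The field -/

/-- The least quadratic nonresidue is small. -/
lemma exists_small_nonresidue {p : ℕ} [hp : Fact p.Prime] (h2 : p ≠ 2) :
    ∃ g : ℕ, 1 < g ∧ g < p ∧ (g - 1) * (g - 1) < p ∧ ¬ IsSquare (g : ZMod p) := by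
  classical
  obtain ⟨x, hx⟩ := FiniteField.exists_nonsquare (F := ZMod p) (by rwa [ZMod.ringChar_zmod_n])
  have hex : ∃ g : ℕ, ¬ IsSquare (g : ZMod p) := ⟨x.val, by rwa [ZMod.natCast_zmod_val]⟩
  set g := Nat.find hex with hg
  have hns : ¬ IsSquare (g : ZMod p) := Nat.find_spec hex
  have hmin : ∀ m < g, IsSquare (m : ZMod p) := fun m hm => not_not.1 (Nat.find_min hex hm)
  have hgp : g < p := lt_of_le_of_lt
    (Nat.find_min' hex (m := x.val) (by rwa [ZMod.natCast_zmod_val])) (ZMod.val_lt x)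
  clear_value g
  have hg1 : 1 < g := by
    by_contra hcon
    interval_cases h : g
    · exact hns (by simp)
    · exact hns (by simp)
  refine ⟨g, hg1, hgp, ?_, hns⟩
  have hdm := Nat.div_add_mod p g
  have hml := Nat.mod_lt p (show 0 < g by omega)
  have hm0 : p % g ≠ 0 := fun h => by
    rcases (Nat.dvd_prime hp.out).1 (Nat.dvd_of_mod_eq_zero h) with h | h <;> omega
  by_contra hcon
  have hq : 0 ≤ (p : ℤ) / g := by positivity
  have hlt : p / g + 1 < g := by
    by_contra hle
    have h1 : g * (g - 1) ≤ g * (p / g) := Nat.mul_le_mul_left _ (by omega)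
    have h2 : (g - 1) * (g - 1) < g * (g - 1) := Nat.mul_lt_mul_of_pos_right (by omega) (by omega)
    omega
  have hne : ((p / g + 1 : ℕ) : ZMod p) ≠ 0 := by
    rw [Ne, ZMod.natCast_eq_zero_iff]
    exact Nat.not_dvd_of_pos_of_lt (by omega) (by omega)
  -- The first multiple of `g` above `p` is congruent to `g - p % g`. This number and the cofactor
  -- `p / g + 1` are both below `g`, hence squares by minimality, and `g` would be their quotient.
  have hprod : (g : ZMod p) * ((p / g + 1 : ℕ) : ZMod p) = ((g - p % g : ℕ) : ZMod p) := by
    have h1 : g * (p / g + 1) = p + (g - p % g) := by rw [Nat.mul_add_one]; omega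
    rw [← Nat.cast_mul, h1, Nat.cast_add, ZMod.natCast_self, zero_add]
  refine hns ?_
  rw [eq_div_of_mul_eq hne hprod]
  exact (hmin _ (by omega)).div (hmin _ hlt)

/-- Side length of the search intervals. -/
def halfSize (n : ℕ) : ℕ := 2 * (n.sqrt + 1) * (n.sqrt.sqrt.sqrt + 1)

/-- Bound for trial divisors and for the nonresidue. -/
def trialBound (n : ℕ) : ℕ := 2 * (n.sqrt.sqrt + 1) * (n.sqrt.sqrt.sqrt + 1)

open Classical in
/-- The largest `c ≤ h` with `l < c` such that `P c j` fails for all `j < K`. -/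
noncomputable def greatest (l h K : ℕ) (P : ℕ → ℕ → Prop) : ℕ :=
  Nat.findGreatest (fun c => l < c ∧ ∀ j < K, ¬ P c j) h

/-- The characteristic of the field of fingerprints. -/
noncomputable def prm (n : ℕ) : ℕ :=
  greatest (halfSize n) (2 * halfSize n) (trialBound n + 1) fun c j => 1 < j ∧ c % j = 0

/-- A quadratic nonresidue modulo `prm n`. -/
noncomputable def nonres (n : ℕ) : ℕ :=
  greatest 0 (trialBound n) (prm n) fun g z => z * z % prm n = g

lemma greatest_spec {l h K c : ℕ} {P : ℕ → ℕ → Prop} (hc : c ≤ h) (hl : l < c)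
    (hP : ∀ j < K, ¬ P c j) :
    greatest l h K P ≤ h ∧ l < greatest l h K P ∧ ∀ j < K, ¬ P (greatest l h K P) j := by
  classical
  have := Nat.findGreatest_spec (P := fun c => l < c ∧ ∀ j < K, ¬ P c j) hc ⟨hl, hP⟩
  refine ⟨Nat.findGreatest_le _, ?_⟩
  unfold greatest
  convert this

lemma sqrt_bounds (n : ℕ) : n.sqrt * n.sqrt ≤ n ∧ n + 1 ≤ (n.sqrt + 1) * (n.sqrt + 1) :=
  ⟨Nat.sqrt_le n, Nat.lt_succ_sqrt n⟩

/-- Trial divisors up to `trialBound n` decide primality in the whole search interval, and the same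
bound covers the least nonresidue. -/
lemma trialBound_sq (n : ℕ) : 2 * halfSize n ≤ trialBound n * trialBound n := by
  unfold halfSize trialBound
  have := (sqrt_bounds n.sqrt).2
  generalize n.sqrt.sqrt.sqrt = v
  generalize n.sqrt.sqrt = u at *
  generalize n.sqrt = s at *
  calc 2 * (2 * (s + 1) * (v + 1)) = 4 * (v + 1) * (s + 1) := by ring
    _ ≤ 4 * (v + 1) * ((u + 1) * (u + 1)) := Nat.mul_le_mul_left _ this
    _ ≤ 4 * (v + 1) * ((u + 1) * (u + 1)) * (v + 1) := Nat.le_mul_of_pos_right _ (by omega)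
    _ = _ := by ring

lemma trialBound_le (n : ℕ) : trialBound n ≤ halfSize n := by
  unfold halfSize trialBound
  have := Nat.sqrt_le_self n.sqrt
  gcongr

/-- The orders are n^(5/8) and n^(3/8). Both searches take time proportional to this product, hence
linear time. -/
lemma halfSize_mul_trialBound (n : ℕ) (hn : 1 ≤ n) : halfSize n * trialBound n ≤ 64 * n := by
  unfold halfSize trialBound
  have h1 := (sqrt_bounds n.sqrt.sqrt).1
  have h2 := (sqrt_bounds n.sqrt).1
  have h3 := (sqrt_bounds n).1
  have h4 : 1 ≤ n.sqrt := Nat.sqrt_pos.2 hn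
  generalize n.sqrt.sqrt.sqrt = v at *
  generalize n.sqrt.sqrt = u at *
  generalize n.sqrt = s at *
  have h5 : (v + 1) * (v + 1) ≤ 2 * (u + 1) := by nlinarith [sq_nonneg ((v : ℤ) - 1), h1]
  have h6 : (u + 1) * (u + 1) ≤ 2 * (s + 1) := by nlinarith
  calc 2 * (s + 1) * (v + 1) * (2 * (u + 1) * (v + 1))
      = 4 * (s + 1) * (u + 1) * ((v + 1) * (v + 1)) := by ring
    _ ≤ 4 * (s + 1) * (u + 1) * (2 * (u + 1)) := Nat.mul_le_mul_left _ h5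
    _ = 8 * (s + 1) * ((u + 1) * (u + 1)) := by ring
    _ ≤ 8 * (s + 1) * (2 * (s + 1)) := Nat.mul_le_mul_left _ h6
    _ ≤ 64 * (s * s) := by nlinarith
    _ ≤ 64 * n := Nat.mul_le_mul_left _ h3

lemma four_le_halfSize (n : ℕ) (hn : 1 ≤ n) : 4 ≤ halfSize n := by
  unfold halfSize
  have h4 : 1 ≤ n.sqrt := Nat.sqrt_pos.2 hn
  generalize n.sqrt.sqrt.sqrt = v at *
  nlinarith

lemma prm_spec (n : ℕ) (hn : 1 ≤ n) :
    (prm n).Prime ∧ halfSize n < prm n ∧ prm n ≤ 2 * halfSize n := by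
  have h4 := four_le_halfSize n hn
  have hR := trialBound_sq n
  have hR2 := trialBound_le n
  obtain ⟨c, hc, hc1, hc2⟩ := Nat.exists_prime_lt_and_le_two_mul (halfSize n) (by omega)
  obtain ⟨h1, h2, h3⟩ := greatest_spec (K := trialBound n + 1)
    (P := fun c j => 1 < j ∧ c % j = 0) hc2 hc1 (by
      rintro j hj ⟨h1, h2⟩
      rcases (Nat.dvd_prime hc).1 (Nat.dvd_of_mod_eq_zero h2) with h | h <;> omega)
  change prm n ≤ _ at h1
  change _ < prm n at h2
  change ∀ j < _, ¬ (1 < j ∧ prm n % j = 0) at h3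
  refine ⟨?_, h2, h1⟩
  by_contra hcon
  have hm := Nat.minFac_sq_le_self (show 0 < prm n by omega) hcon
  have hp := Nat.minFac_prime (show prm n ≠ 1 by omega)
  refine h3 (prm n).minFac ?_ ⟨hp.one_lt, Nat.mod_eq_zero_of_dvd (Nat.minFac_dvd _)⟩
  by_contra hle
  have : trialBound n * trialBound n < (prm n).minFac * (prm n).minFac := by
    apply Nat.mul_self_lt_mul_self; omega
  rw [sq] at hm
  omega

/-- The inequality has the form, with linear coefficient 0, under which `QuadraticAlgebra` over
`ZMod (prm n)` is a field. -/
lemma nonres_spec (n : ℕ) (hn : 1 ≤ n) :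
    nonres n < prm n ∧ nonres n ≤ trialBound n ∧
      ∀ r : ZMod (prm n), r ^ 2 ≠ (nonres n : ZMod (prm n)) + 0 * r := by
  obtain ⟨hp, h1, h2⟩ := prm_spec n hn
  have h4 := four_le_halfSize n hn
  have hR := trialBound_sq n
  have hR2 := trialBound_le n
  have : Fact (prm n).Prime := ⟨hp⟩
  obtain ⟨g, hg1, hg2, hg3, hg4⟩ := exists_small_nonresidue (p := prm n) (by omega)
  have hgR : g ≤ trialBound n := by
    by_contra hcon
    have : trialBound n * trialBound n ≤ (g - 1) * (g - 1) := by
      apply Nat.mul_self_le_mul_self; omega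
    omega
  obtain ⟨k1, k2, k3⟩ := greatest_spec (l := 0) (K := prm n) (c := g)
    (P := fun g z => z * z % prm n = g) hgR (by omega) (by
      intro z _ hz
      refine hg4 ⟨z, ?_⟩
      rw [← hz, ZMod.natCast_mod, Nat.cast_mul])
  change nonres n ≤ _ at k1
  change ∀ j < _, ¬ (j * j % prm n = nonres n) at k3
  refine ⟨by omega, k1, fun r hr => ?_⟩
  refine k3 r.val (ZMod.val_lt r) ?_
  rw [zero_mul, add_zero, sq] at hr
  have hr2 : ((r.val * r.val : ℕ) : ZMod (prm n)) = (nonres n : ℕ) := by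
    rw [Nat.cast_mul, ZMod.natCast_zmod_val, hr]
  have := (ZMod.natCast_eq_natCast_iff' _ _ _).1 hr2
  rwa [Nat.mod_eq_of_lt (show nonres n < prm n by omega)] at this

end PalStream

/-! ### Computation of the parameters by the machine, and the complete program. -/

namespace PalStream

variable {Γ : Env}

/-! ### Choice of the parameters -/

/-- The parameters for symbols up to `(n + 1) ^ a`. -/
noncomputable def stdPar (a n d : ℕ) (S : List ℕ) (r : ℕ) : Par where
  n := n
  d := d
  s := n.sqrt
  p := prm n
  g := nonres n
  E := Par.rep ((prm n * prm n) ^ (a + 1)) 12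
  r := r
  k := 12 * (a + 1)
  S := S

/-- `x := ⌊√y⌋` -/
def sqrtCmd (x y : Fin 40) : Cmd 40 :=
  .assign x (cn 0) ;;
  .loop (.bin .lt ((rg x + cn 1) * (rg x + cn 1)) (rg y + cn 1)) (.assign x (rg x + cn 1))

lemma sqrtCmd_spec {x y : Fin 40} (hxy : y ≠ x) {s : State 40} {A t : ℕ} (hA : s.reg y = A) :
    WP Γ (sqrtCmd x y) (fun s' t' => s'.reg x = A.sqrt ∧ t' ≤ t + 2 * A.sqrt + 2) s t := by
  refine WP.ok fun ho => ?_
  have hB := Γ.hB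
  have hAB : A < Γ.B := hA ▸ ho.reg y
  have hsA := Nat.sqrt_le_self A
  refine WP.seq (WP.assign 0 rfl rfl (by omega) ?_)
  refine WP.for rfl (fun j σ t' => σ.reg x = j ∧ σ.reg y = A ∧ t' ≤ t + 1 + 2 * j) A.sqrt
    ?_ ?_ ?_ ?_
  · rintro j s' t' hj ⟨h1, h2, -⟩
    have : (j + 1) * (j + 1) < A + 1 ↔ j < A.sqrt := by
      rw [Nat.lt_succ_iff, ← Nat.le_sqrt, Nat.succ_le_iff]
    simp [h1, h2, ← this]
  · rintro j s' t' _ hj ⟨h1, h2, h3⟩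
    exact WP.assign (j + 1) rfl (by simp [h1]) (by omega) ⟨by simp, by simp [hxy, h2], by omega⟩
  · simp [hxy, hA]
  · rintro s' t' _ ⟨h1, h2, h3⟩
    exact ⟨h1, by omega⟩

/-- `x :=` the largest number `Rq` in `(lo, hi]` such that the test `e` fails for all `Rj < b`. -/
def searchCmd (x : Fin 40) (lo hi b e : Expr 40) : Cmd 40 :=
  .assign x (cn 0) ;; .assign Rq lo ;;
  .loop (.bin .lt (rg Rq) hi)
    (.assign Rq (rg Rq + cn 1) ;; .assign Rfl (cn 1) ;; .assign Rj (cn 0) ;;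
    .loop (.bin .lt (rg Rj) b) (.ite e (.assign Rfl (cn 0)) .skip ;; .assign Rj (rg Rj + cn 1)) ;;
    .ite (rg Rfl) (.assign x (rg Rq)) .skip)

set_option maxHeartbeats 1000000 in
-- Candidates are visited in increasing order and each success overwrites `x`, so the last one
-- remains: the recursion of `Nat.findGreatest`. The expressions are specified for all contents of
-- the work registers, which the search itself changes.
lemma searchCmd_spec {x : Fin 40} {lo hi b e : Expr 40} {s : State 40} {l h K t : ℕ}
    {P : ℕ → ℕ → Prop} (hx1 : x ≠ Rq) (hx2 : x ≠ Rfl) (hx3 : x ≠ Rj)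
    (olo : lo.ok = true) (ohi : (Expr.bin .lt (rg Rq) hi).ok = true)
    (ob : (Expr.bin .lt (rg Rj) b).ok = true) (oe : e.ok = true)
    (hlo : ∀ ρ : Fin 40 → ℕ, (∀ y, y ≠ x → y ≠ Rq → y ≠ Rfl → y ≠ Rj → ρ y = s.reg y) →
      lo.nat ρ = l)
    (hhi : ∀ ρ : Fin 40 → ℕ, (∀ y, y ≠ x → y ≠ Rq → y ≠ Rfl → y ≠ Rj → ρ y = s.reg y) →
      hi.nat ρ = h)
    (hb : ∀ ρ : Fin 40 → ℕ, (∀ y, y ≠ x → y ≠ Rq → y ≠ Rfl → y ≠ Rj → ρ y = s.reg y) →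
      b.nat ρ = K)
    (he : ∀ ρ : Fin 40 → ℕ, (∀ y, y ≠ x → y ≠ Rq → y ≠ Rfl → y ≠ Rj → ρ y = s.reg y) →
      (e.nat ρ ≠ 0 ↔ P (ρ Rq) (ρ Rj)))
    (hlh : l ≤ h) (hhB : h < Γ.B) (hKB : K < Γ.B) :
    WP Γ (searchCmd x lo hi b e) (fun s' t' => s'.reg x = greatest l h K P ∧
      t' ≤ t + (4 * K + 8) * (h - l) + 3) s t := by
  classical
  have hB := Γ.hB
  refine WP.seq (WP.assign 0 rfl rfl (by omega) ?_)
  refine WP.seq (WP.assign l olo (hlo _ fun y h1 _ _ _ => by simp [h1]) (by omega) ?_)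
  refine WP.for ohi (fun i σ t' => (∀ y, y ≠ x → y ≠ Rq → y ≠ Rfl → y ≠ Rj → σ.reg y = s.reg y) ∧
    σ.reg Rq = l + i ∧ σ.reg x = greatest l (l + i) K P ∧ t' ≤ t + 2 + (4 * K + 8) * i) (h - l)
    ?_ ?_ ?_ ?_
  · rintro i s' t' hi ⟨h1, h2, -⟩
    rw [Expr.nat_lt, hhi _ h1, Expr.nat_reg, h2]
    split_ifs <;> omega
  · rintro i s' t' - hi ⟨h1, h2, h3, h4⟩
    refine WP.seq (WP.assign (l + (i + 1)) rfl (by simp [h2]; omega) (by omega) ?_)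
    refine WP.seq (WP.assign 1 rfl rfl (by omega) ?_)
    refine WP.seq (WP.assign 0 rfl rfl (by omega) ?_)
    refine WP.seq (WP.for ob (fun j σ t' => (∀ y, y ≠ x → y ≠ Rq → y ≠ Rfl → y ≠ Rj →
      σ.reg y = s.reg y) ∧ σ.reg Rq = l + (i + 1) ∧ σ.reg x = greatest l (l + i) K P ∧
      σ.reg Rj = j ∧ (σ.reg Rfl ≠ 0 ↔ ∀ u < j, ¬ P (l + (i + 1)) u) ∧
      t' ≤ t + 6 + (4 * K + 8) * i + 4 * j) K ?_ ?_ ?_ ?_)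
    · rintro j s' t' hj ⟨h1, -, -, h2, -⟩
      rw [Expr.nat_lt, hb _ h1, Expr.nat_reg, h2]
      split_ifs <;> omega
    · rintro j s' t' - hj ⟨g1, g2, g3, g4, g5, g6⟩
      have he' := he _ g1
      rw [g2, g4] at he'
      refine WP.seq (WP.ite oe (fun hc => ?_) (fun hc => WP.skip ?_))
      · refine WP.assign 0 rfl rfl (by omega) ?_
        refine WP.assign (j + 1) rfl (by simp [g4]) (by omega) ⟨?_, by simp [g2], ?_, by simp, ?_, by omega⟩
        · intro y k1 k2 k3 k4
          simp [k3, k4, g1 y k1 k2 k3 k4]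
        · simp [hx2, hx3, g3]
        · simp only [State.set_reg, Fin.reduceEq, if_false, if_true, ne_eq, not_true_eq_false,
            false_iff]
          exact fun h => h j (by omega) (he'.1 hc)
      · have hc' : ¬ P (l + (i + 1)) j := fun h => he'.2 h hc
        refine WP.assign (j + 1) rfl (by simp [g4]) (by omega) ⟨?_, by simp [g2], ?_, by simp, ?_, by omega⟩
        · intro y k1 k2 k3 k4
          simp [k4, g1 y k1 k2 k3 k4]
        · simp [hx3, g3]
        · rw [State.set_reg, if_neg (by decide), g5]
          constructor
          · intro h u hu
            rcases Nat.lt_succ_iff_lt_or_eq.1 hu with hu | rfl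
            exacts [h u hu, hc']
          · exact fun h u hu => h u (by omega)
    · refine ⟨?_, by simp, ?_, by simp, by simp, by omega⟩
      · intro y k1 k2 k3 k4
        simp [k2, k3, k4, h1 y k1 k2 k3 k4]
      · simp [hx1, hx2, hx3, h3]
    · rintro s' t' - ⟨g1, g2, g3, g4, g5, g6⟩
      have hG : greatest l (l + (i + 1)) K P = if ∀ u < K, ¬ P (l + (i + 1)) u then l + (i + 1)
          else greatest l (l + i) K P := by
        rw [greatest, ← add_assoc, Nat.findGreatest_succ]
        have : l < l + i + 1 := by omega
        simp only [this, true_and]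
        rfl
      have hT : (4 * K + 8) * (i + 1) = (4 * K + 8) * i + 4 * K + 8 := by ring
      refine WP.ite rfl (fun hc => ?_) (fun hc => WP.skip ?_)
      · refine WP.assign (l + (i + 1)) rfl (by simp [g2]) (by omega) ⟨?_, ?_, ?_, by omega⟩
        · intro y k1 k2 k3 k4
          simp [k1, g1 y k1 k2 k3 k4]
        · simp [hx1.symm, g2]
        · rw [hG, if_pos (g5.1 hc)]
          simp
      · refine ⟨g1, g2, ?_, by omega⟩
        rw [hG, if_neg fun h => g5.2 h hc, g3]
  · refine ⟨?_, by simp, ?_, by omega⟩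
    · intro y k1 k2 k3 k4
      simp [k1, k2]
    · rw [State.set_reg, if_neg hx1, State.set_reg, if_pos rfl, add_zero, eq_comm, greatest,
        Nat.findGreatest_eq_zero_iff]
      intro k _ h2 h3
      omega
  · rintro s' t' - ⟨h1, h2, h3, h4⟩
    rw [Nat.add_sub_cancel' hlh] at h3
    exact ⟨h3, by omega⟩

/-- Compute the powers of the field size. -/
def powerCmd (L : ℕ) : Cmd 40 :=
  .assign Rk (.const (12 * L)) ;;
  .assign Rq (.const L) ;; .assign Rlong (cn 1) ;;
  .loop (rg Rq) (.assign Rlong (rg Rlong * (rg Rp * rg Rp)) ;; .assign Rq (rg Rq - cn 1)) ;;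
  .assign Rq (cn 12) ;; .assign RE (cn 0) ;; .assign Rv (cn 1) ;;
  .loop (rg Rq) (.assign RE (rg RE * rg Rlong + cn 1) ;; .assign Rv (rg Rv * rg Rlong) ;;
    .assign Rq (rg Rq - cn 1))

lemma rep_le_pow {Q : ℕ} (hQ : 2 ≤ Q) (t : ℕ) : Par.rep Q t < Q ^ t := by
  simpa using Par.mul_rep_lt (show 1 < Q by omega) t

set_option maxHeartbeats 1000000 in
lemma powerCmd_spec {L p t : ℕ} {s : State 40} (hp : s.reg Rp = p) (hp2 : 2 ≤ p)
    (hL : 12 * L < Γ.B) (hL0 : L ≠ 0) (hB : (p * p) ^ (12 * L) < Γ.B) :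
    WP Γ (powerCmd L) (fun s' t' => s'.reg Rk = 12 * L ∧
      s'.reg RE = Par.rep ((p * p) ^ L) 12 ∧ s'.reg Rv = (p * p) ^ (12 * L) ∧
      t' ≤ t + 3 * L + 60) s t := by
  have hB1 := Γ.hB
  have hpp : 2 ≤ p * p := by nlinarith
  have hmono : ∀ j, j ≤ 12 * L → (p * p) ^ j < Γ.B := fun j hj =>
    lt_of_le_of_lt (Nat.pow_le_pow_right (by omega) hj) hB
  refine WP.seq (WP.assign_const hL ?_)
  refine WP.seq (WP.assign_const (by omega) ?_)
  refine WP.seq (WP.assign 1 rfl rfl (by omega) ?_)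
  refine WP.seq (WP.for rfl (fun j σ t' => σ.reg Rp = p ∧ σ.reg Rk = 12 * L ∧
    σ.reg Rq = L - j ∧ σ.reg Rlong = (p * p) ^ j ∧ t' ≤ t + 3 + 3 * j) L ?_ ?_ ?_ ?_)
  · rintro j s' t' hj ⟨-, -, h, -⟩
    rw [Expr.nat_reg, h]
    omega
  · rintro j s' t' - hj ⟨h1, h2, h3, h4, h5⟩
    refine WP.seq (WP.assign ((p * p) ^ (j + 1)) rfl (by simp [h1, h4, pow_succ])
      (hmono _ (by omega)) ?_)
    exact WP.assign (L - (j + 1)) rfl (by simp [h3]; omega) (by omega)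
      ⟨by simp [h1], by simp [h2], by simp, by simp, by omega⟩
  · exact ⟨by simp [hp], by simp, by simp, by simp, by omega⟩
  rintro s' t' - ⟨h1, h2, h3, h4, h5⟩
  refine WP.seq (WP.assign 12 rfl rfl (by omega) ?_)
  refine WP.seq (WP.assign 0 rfl rfl (by omega) ?_)
  refine WP.seq (WP.assign 1 rfl rfl (by omega) ?_)
  have hQ2 : 2 ≤ (p * p) ^ L := le_trans hpp (Nat.le_self_pow hL0 _)
  have hQ : ∀ j, j ≤ 12 → ((p * p) ^ L) ^ j < Γ.B := by
    intro j hj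
    rw [← pow_mul]
    exact hmono _ (by rw [mul_comm]; exact Nat.mul_le_mul_right _ hj)
  refine WP.for rfl (fun j σ t' => σ.reg Rlong = (p * p) ^ L ∧ σ.reg Rk = 12 * L ∧
    σ.reg Rq = 12 - j ∧ σ.reg RE = Par.rep ((p * p) ^ L) j ∧ σ.reg Rv = ((p * p) ^ L) ^ j ∧
    t' ≤ t + 7 + 3 * L + 4 * j) 12 ?_ ?_ ?_ ?_
  · rintro j s' t' hj ⟨-, -, h, -⟩
    rw [Expr.nat_reg, h]
    omega
  · rintro j s' t' - hj ⟨h1, h2, h3, h4, h5, h6⟩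
    refine WP.seq (WP.assign (Par.rep ((p * p) ^ L) (j + 1)) rfl (by simp [h1, h4, Par.rep])
      ((rep_le_pow hQ2 _).trans (hQ _ (by omega))) ?_)
    refine WP.seq (WP.assign (((p * p) ^ L) ^ (j + 1)) rfl (by simp [h1, h5, pow_succ])
      (hQ _ (by omega)) ?_)
    exact WP.assign (12 - (j + 1)) rfl (by simp [h3]; omega) (by omega)
      ⟨by simp [h1], by simp [h2], by simp, by simp, by simp, by omega⟩
  · exact ⟨by simp [h4], by simp [h2], by simp, by simp [Par.rep], by simp, by omega⟩
  · rintro s' t' - ⟨g1, g2, g3, g4, g5, g6⟩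
    refine ⟨g2, g4, ?_, by omega⟩
    rw [g5, ← pow_mul, mul_comm L]

/-- Compute all parameters except for the evaluation point. -/
def prepareCmd (a : ℕ) : Cmd 40 :=
  sqrtCmd Rs Rn ;; sqrtCmd Rm Rs ;; sqrtCmd Rc Rm ;;
  .assign Rx (cn 2 * (rg Rs + cn 1) * (rg Rc + cn 1)) ;;
  .assign RH (cn 2 * (rg Rm + cn 1) * (rg Rc + cn 1)) ;;
  searchCmd Rp (rg Rx) (cn 2 * rg Rx) (rg RH + cn 1)
    (.bin .lt (cn 1) (rg Rj) * .bin .eq (rg Rq % rg Rj) (cn 0)) ;;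
  searchCmd Rg (cn 0) (rg RH) (rg Rp) (.bin .eq (rg Rj * rg Rj % rg Rp) (rg Rq)) ;;
  powerCmd (a + 1)

set_option maxHeartbeats 1000000 in
lemma prepareCmd_spec {a n d t : ℕ} {s : State 40} (hn : s.reg Rn = n) (hn1 : 1 ≤ n)
    (hnB : 100 * (n + 1) ≤ Γ.B) (ha : 12 * (a + 1) < Γ.B) (hd : s.reg Rd = d)
    (hB : (prm n * prm n) ^ (12 * (a + 1)) < Γ.B) :
    WP Γ (prepareCmd a) (fun s' t' => s'.reg Rn = n ∧ s'.reg Rd = d ∧ s'.reg Rs = n.sqrt ∧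
      s'.reg Rp = prm n ∧ s'.reg Rg = nonres n ∧ s'.reg Rk = 12 * (a + 1) ∧
      s'.reg RE = Par.rep ((prm n * prm n) ^ (a + 1)) 12 ∧
      s'.reg Rv = (prm n * prm n) ^ (12 * (a + 1)) ∧ t' ≤ t + 3 * a + 2500 * n + 100) s t := by
  have hyR := halfSize_mul_trialBound n hn1
  have hRy := trialBound_le n
  have h4y := four_le_halfSize n hn1
  obtain ⟨hp, hp1, hp2⟩ := prm_spec n hn1
  obtain ⟨hg1, hg2, -⟩ := nonres_spec n hn1
  have hR1 : 1 ≤ trialBound n := by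
    unfold trialBound; exact Nat.mul_pos (by omega) (by omega)
  have hy64 : halfSize n ≤ 64 * n := le_trans (Nat.le_mul_of_pos_right _ hR1) hyR
  have hs1 : n.sqrt ≤ n := Nat.sqrt_le_self n
  have hs2 : n.sqrt.sqrt ≤ n.sqrt := Nat.sqrt_le_self _
  have hs3 : n.sqrt.sqrt.sqrt ≤ n.sqrt.sqrt := Nat.sqrt_le_self _
  have hy16 : 2 * halfSize n < Γ.B := by
    have h1 := (sqrt_bounds n).1
    have h3 : 2 * halfSize n ≤ 4 * ((n.sqrt + 1) * (n.sqrt + 1)) := by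
      unfold halfSize
      calc 2 * (2 * (n.sqrt + 1) * (n.sqrt.sqrt.sqrt + 1))
          = 4 * ((n.sqrt + 1) * (n.sqrt.sqrt.sqrt + 1)) := by ring
        _ ≤ _ := by gcongr; omega
    have h4 : (n.sqrt + 1) * (n.sqrt + 1) ≤ 3 * n + 1 := by nlinarith
    omega
  refine WP.seq ((sqrtCmd_spec (by decide) hn).use ?_)
  rintro s1 t1 hf1 - ⟨k1, ht1⟩
  refine WP.seq ((sqrtCmd_spec (by decide) k1).use ?_)
  rintro s2 t2 hf2 - ⟨k2, ht2⟩
  refine WP.seq ((sqrtCmd_spec (by decide) k2).use ?_)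
  rintro s3 t3 hf3 - ⟨k3, ht3⟩
  have n3 : s3.reg Rn = n := by
    rw [hf3.reg Rn (by decide), hf2.reg Rn (by decide), hf1.reg Rn (by decide), hn]
  have d3 : s3.reg Rd = d := by
    rw [hf3.reg Rd (by decide), hf2.reg Rd (by decide), hf1.reg Rd (by decide), hd]
  have s3' : s3.reg Rs = n.sqrt := by rw [hf3.reg Rs (by decide), hf2.reg Rs (by decide), k1]
  have m3 : s3.reg Rm = n.sqrt.sqrt := by rw [hf3.reg Rm (by decide), k2]
  refine WP.seq (WP.assign (halfSize n) rfl (by simp [s3', k3, halfSize]) (by omega) ?_)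
  refine WP.seq (WP.assign (trialBound n) rfl (by simp [m3, k3, trialBound]) (by omega) ?_)
  refine WP.seq ((searchCmd_spec (l := halfSize n) (h := 2 * halfSize n) (K := trialBound n + 1)
    (P := fun c j => 1 < j ∧ c % j = 0) (by decide) (by decide) (by decide) rfl rfl rfl rfl
    ?_ ?_ ?_ ?_ (by omega) hy16 (by omega)).use ?_)
  · intro ρ hρ
    simp [hρ]
  · intro ρ hρ
    simp [hρ]
  · intro ρ hρ
    simp [hρ]
  · intro ρ hρ
    simp only [Expr.nat_mul, Expr.nat_lt, Expr.nat_eq, Expr.nat_mod, Expr.nat_reg, Expr.nat_const]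
    by_cases h1 : 1 < ρ Rj <;> by_cases h2 : ρ Rq % ρ Rj = 0 <;> simp [h1, h2]
  rintro s4 t4 hf4 - ⟨hp4, ht4⟩
  have hp4 : s4.reg Rp = prm n := hp4
  have n4 : s4.reg Rn = n := by rw [hf4.reg Rn (by decide)]; simp [n3]
  have d4 : s4.reg Rd = d := by rw [hf4.reg Rd (by decide)]; simp [d3]
  have s4' : s4.reg Rs = n.sqrt := by rw [hf4.reg Rs (by decide)]; simp [s3']
  have r4 : s4.reg RH = trialBound n := by rw [hf4.reg RH (by decide)]; simp
  refine WP.seq ((searchCmd_spec (l := 0) (h := trialBound n) (K := prm n)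
    (P := fun g z => z * z % prm n = g) (by decide) (by decide) (by decide) rfl rfl rfl rfl
    ?_ ?_ ?_ ?_ (by omega) (by omega) (by omega)).use ?_)
  · intro ρ hρ
    simp
  · intro ρ hρ
    simp [hρ, r4]
  · intro ρ hρ
    simp [hρ, hp4]
  · intro ρ hρ
    simp [hρ, hp4]
  rintro s5 t5 hf5 - ⟨hg5, ht5⟩
  have hg5 : s5.reg Rg = nonres n := hg5
  have hp5 : s5.reg Rp = prm n := by rw [hf5.reg Rp (by decide), hp4]
  refine (powerCmd_spec hp5 hp.two_le ha (by omega) hB).use ?_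
  rintro s6 t6 hf6 - ⟨g1, g2, g3, g4⟩
  have w6 : ∀ y ∈ [Rn, Rd, Rs, Rp, Rg], y ∉ (powerCmd (a + 1)).writes := by
    intro y hy
    simp only [powerCmd, Cmd.writes]
    revert y
    decide
  refine ⟨?_, ?_, ?_, ?_, ?_, g1, g2, g3, ?_⟩
  · rw [hf6.reg Rn (w6 _ (by decide)), hf5.reg Rn (by decide), n4]
  · rw [hf6.reg Rd (w6 _ (by decide)), hf5.reg Rd (by decide), d4]
  · rw [hf6.reg Rs (w6 _ (by decide)), hf5.reg Rs (by decide), s4']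
  · rw [hf6.reg Rp (w6 _ (by decide)), hp5]
  · rw [hf6.reg Rg (w6 _ (by decide)), hg5]
  · have e1 : (4 * (trialBound n + 1) + 8) * (2 * halfSize n - halfSize n)
        ≤ 16 * (halfSize n * trialBound n) := by
      rw [show 2 * halfSize n - halfSize n = halfSize n by omega]
      nlinarith
    have e2 : (4 * prm n + 8) * (trialBound n - 0) ≤ 16 * (halfSize n * trialBound n) := by
      rw [Nat.sub_zero]
      have : 4 * prm n + 8 ≤ 16 * halfSize n := by omega
      calc (4 * prm n + 8) * trialBound n ≤ 16 * halfSize n * trialBound n :=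
            Nat.mul_le_mul_right _ this
        _ = _ := by ring
    omega

/-- The complete program. -/
def programCmd (a : ℕ) : Cmd 40 :=
  prepareCmd a ;; (.rand Rr ;; .assign Rr (.bin .mod (rg Rr) (rg Rv))) ;; mainCmd

/-- Bounds the list of single midpoints, both for the memory and for the time of an update. -/
lemma le_of_mul_half_sqrt_le {n x : ℕ} (hx : x * (n.sqrt / 2 + 1) ≤ n + n.sqrt / 2 + 2) :
    x ≤ 2 * n.sqrt + 4 := by
  by_contra hcon
  have h1 := (sqrt_bounds n).2
  have h2 : (2 * n.sqrt + 5) * (n.sqrt / 2 + 1) ≤ x * (n.sqrt / 2 + 1) :=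
    Nat.mul_le_mul_right _ (by omega)
  have h3 : (2 * n.sqrt + 4) * (n.sqrt / 2 + 1) = (n.sqrt + 2) * (2 * (n.sqrt / 2 + 1)) := by ring
  have h4 : (n.sqrt + 2) * (n.sqrt + 1) ≤ (n.sqrt + 2) * (2 * (n.sqrt / 2 + 1)) :=
    Nat.mul_le_mul_left _ (by omega)
  have h5 : (2 * n.sqrt + 5) * (n.sqrt / 2 + 1)
    = (2 * n.sqrt + 4) * (n.sqrt / 2 + 1) + (n.sqrt / 2 + 1) := by ring
  nlinarith

lemma programCmd_spec {a n d : ℕ} {S : List ℕ} {s : State 40} {π : Par}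
    (hπ : π = stdPar a n d S (Γ.ω 0 % (prm n * prm n) ^ (12 * (a + 1)))) (hV : π.Valid Γ)
    (hn : s.reg Rn = n) (hd : s.reg Rd = d) (hmem : ∀ x, s.mem x = 0) (hpos : s.pos = 0)
    (hdrawn : s.drawn = 0) (hout : s.out = []) :
    WP Γ (programCmd a) (fun s' t' => (s'.out.map Prod.fst).Perm (List.range' 1 n) ∧
      (π.Good → ∀ q ∈ s'.out, Par.Acc π q) ∧
      t' ≤ 3 * a + 2500 * n + 101 + (8 * π.k + 15) * (2 * (2 * n.sqrt / d) + 20) *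
        (n + 2 * n.sqrt + n.sqrt / 2 + 2) + 2 * (8 * π.k + 15) * n +
        4 * (8 * π.k + 15) * (2 * n.sqrt + 5) * ((n + 2 * n.sqrt + n.sqrt / 2 + 1) / d)) s 0 := by
  have hn1 : 1 ≤ n := by have := hV.hn; rwa [hπ] at this
  have hnB : 100 * (n + 1) ≤ Γ.B := by have := hV.hnB; rwa [hπ] at this
  have hkB : 12 * (a + 1) < Γ.B := by have := hV.hkB; rwa [hπ] at this
  have hpp : 0 < prm n * prm n := by
    have := (prm_spec n hn1).1.pos
    exact Nat.mul_pos this this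
  have hB : (prm n * prm n) ^ (12 * (a + 1)) < Γ.B := by
    have := hV.hB
    rw [hπ] at this
    exact lt_of_le_of_lt (Nat.pow_le_pow_right hpp (Nat.le_succ _)) this
  refine WP.seq ((prepareCmd_spec hn hn1 hnB hkB hd hB).use ?_)
  rintro s1 t1 hf1 - ⟨k1, k2, k3, k4, k5, k6, k7, k8, ht1⟩
  have hdr1 : s1.drawn = 0 := (hf1.drawn rfl).trans hdrawn
  refine WP.seq (WP.rand_mod (by decide) (by rw [k8]; exact Nat.pow_pos hpp) ?_)
  intro s2 hmem2 hout2 hpos2 hreg2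
  rw [k8, hdr1] at hreg2
  have hC : Consts π s2 := by
    rw [hπ]
    constructor <;> rw [hreg2]
    exacts [k1, k2, k3, k4, k5, k7, rfl, k6]
  refine (mainCmd_spec hV hC ?_ ?_ ?_ (K := 2 * n.sqrt + 4) ?_ rfl).mono ?_
  · intro x
    rw [hmem2, hf1.mem rfl, hmem]
  · rw [hpos2, hf1.pos rfl, hpos]
  · rw [hout2, hf1.out rfl, hout]
  · rw [show π.s = n.sqrt by rw [hπ]; rfl, show π.n = n by rw [hπ]; rfl]
    exact fun x => le_of_mul_half_sqrt_le
  · rintro s3 t3 - - ⟨h1, h2, h3⟩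
    rw [show π.s = n.sqrt by rw [hπ]; rfl, show π.n = n by rw [hπ]; rfl,
      show π.d = d by rw [hπ]; rfl, show 2 * n.sqrt + 4 + 1 = 2 * n.sqrt + 5 from rfl,
      show n + 2 * n.sqrt + n.sqrt / 2 + 1 + 1 = n + 2 * n.sqrt + n.sqrt / 2 + 2 from rfl] at h3
    rw [show π.n = n by rw [hπ]; rfl] at h1
    exact ⟨h1, h2, by omega⟩

end PalStream

/-! ### Probability of a fingerprint error. -/

namespace PalStream

/-! ### Few random words are bad -/

/-- The second inequality is the union bound: n² pairs, a factor `2 * n` for the target 1/(2n), and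
`2 * n` roots in each of twelve coordinates. It holds because `p * p` exceeds `4 * n` by about
n^(1/4), whose twelfth power is about n³. -/
lemma prm_sq_bound (n : ℕ) (hn : 1 ≤ n) :
    4 * (n + 1) ≤ prm n * prm n ∧ 2 * n ^ 3 * (2 * n) ^ 12 ≤ (prm n * prm n) ^ 12 := by
  obtain ⟨-, h1, -⟩ := prm_spec n hn
  have h2 := Nat.mul_self_le_mul_self h1.le
  have hs := (sqrt_bounds n).2
  have hu := (sqrt_bounds n.sqrt).2
  have hv := (sqrt_bounds n.sqrt.sqrt).2
  unfold halfSize at h2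
  generalize prm n * prm n = q at *
  generalize n.sqrt.sqrt.sqrt = v at *
  generalize n.sqrt.sqrt = u at *
  generalize n.sqrt = s at *
  have h3 : 4 * (n + 1) * ((v + 1) * (v + 1)) ≤ q := by
    calc 4 * (n + 1) * ((v + 1) * (v + 1)) ≤ 4 * ((s + 1) * (s + 1)) * ((v + 1) * (v + 1)) := by
          gcongr
      _ = 2 * (s + 1) * (v + 1) * (2 * (s + 1) * (v + 1)) := by ring
      _ ≤ q := h2
  refine ⟨le_trans (Nat.le_mul_of_pos_right _ (by positivity)) h3, ?_⟩
  have h4 : n + 1 ≤ (v + 1) ^ 8 := by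
    calc n + 1 ≤ (s + 1) * (s + 1) := hs
      _ ≤ ((u + 1) * (u + 1)) * ((u + 1) * (u + 1)) := Nat.mul_le_mul hu hu
      _ ≤ (((v + 1) * (v + 1)) * ((v + 1) * (v + 1))) * (((v + 1) * (v + 1)) * ((v + 1) * (v + 1))) := by
          gcongr
      _ = (v + 1) ^ 8 := by ring
  calc 2 * n ^ 3 * (2 * n) ^ 12 ≤ 2 ^ 12 * ((v + 1) ^ 8) ^ 3 * (2 * n) ^ 12 := by
        gcongr
        · norm_num
        · omega
    _ = (4 * n * ((v + 1) * (v + 1))) ^ 12 := by ring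
    _ ≤ q ^ 12 := by
        refine Nat.pow_le_pow_left (le_trans ?_ h3) _
        gcongr
        omega

lemma symbol_le {S : List ℕ} {M : ℕ} (hS : ∀ x ∈ S, x ≤ M) (j : ℕ) : symbol S j ≤ M := by
  unfold symbol
  rcases Nat.lt_or_ge (j - 1) S.length with h | h
  · rw [List.getD_eq_getElem _ _ h]
    exact hS _ (List.getElem_mem h)
  · rw [List.getD_eq_default _ _ h]
    exact Nat.zero_le _

lemma symbol_bound {a n : ℕ} (hn : 1 ≤ n) : (n + 1) ^ a + 1 < (prm n * prm n) ^ (a + 1) := by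
  have h := (prm_sq_bound n hn).1
  calc (n + 1) ^ a + 1 < (n + 1) ^ a * 4 := by
        have : 1 ≤ (n + 1) ^ a := Nat.one_le_pow _ _ (by omega)
        omega
    _ ≤ (n + 1) ^ a * (4 * (n + 1)) := Nat.mul_le_mul_left _ (by omega)
    _ ≤ (prm n * prm n) ^ a * (prm n * prm n) := by
        gcongr
        omega
    _ = _ := (pow_succ _ _).symm

lemma stdPar_T_lt {a n d : ℕ} {S : List ℕ} {r : ℕ} (hn : 1 ≤ n) (hS : ∀ x ∈ S, x ≤ (n + 1) ^ a)
    (j : ℕ) : (stdPar a n d S r).T j < (prm n * prm n) ^ (a + 1) := by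
  have h1 := symbol_bound (a := a) hn
  have h2 := symbol_le hS j
  unfold Par.T
  split_ifs
  · change symbol S j + 1 < _
    omega
  · omega

open Classical in
-- Union over the pairs (m, x) with 1 ≤ x ≤ m ≤ n that are not palindromes; length 0 never fails.
-- Whether a pair is a palindrome does not depend on `r`, so the index set is fixed with `r = 0`.
lemma card_not_good_le {a n d : ℕ} {S : List ℕ} (hn : 1 ≤ n) (hS : ∀ x ∈ S, x ≤ (n + 1) ^ a) :
    2 * n * ((Finset.range ((prm n * prm n) ^ (12 * (a + 1)))).filter
      fun r => ¬ (stdPar a n d S r).Good).card ≤ (prm n * prm n) ^ (12 * (a + 1)) := by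
  obtain ⟨hp, -⟩ := prm_spec n hn
  have : Fact (prm n).Prime := ⟨hp⟩
  have : Fact (∀ r : ZMod (prm n), r ^ 2 ≠ (nonres n : ZMod (prm n)) + 0 * r) :=
    ⟨(nonres_spec n hn).2.2⟩
  set q := prm n * prm n with hq
  have hsub : ((Finset.range (q ^ (12 * (a + 1)))).filter fun r => ¬ (stdPar a n d S r).Good) ⊆
      ((Finset.Icc 1 n ×ˢ Finset.Icc 1 n).filter fun z => z.2 ≤ z.1 ∧
        ¬ (stdPar a n d S 0).Pal z.1 z.2).biUnion fun z =>
        (Finset.range (q ^ (12 * (a + 1)))).filter fun r =>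
          (stdPar a n d S r).Hc z.1 z.2 = (stdPar a n d S r).Hc z.1 0 := by
    intro r hr
    rw [Finset.mem_filter] at hr
    obtain ⟨hr1, hr2⟩ := hr
    unfold Par.Good at hr2
    push Not at hr2
    obtain ⟨m, x, h1, h2, h3, h4, h5⟩ := hr2
    have h2 : m ≤ n := h2
    have hx : x ≠ 0 := by
      rintro rfl
      exact h5 (Par.pal_zero m)
    rw [Finset.mem_biUnion]
    refine ⟨(m, x), ?_, Finset.mem_filter.2 ⟨hr1, h4⟩⟩
    simp only [Finset.mem_filter, Finset.mem_product, Finset.mem_Icc]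
    exact ⟨⟨⟨h1, h2⟩, by omega, by omega⟩, h3, h5⟩
  have hcard := (Finset.card_le_card hsub).trans (Finset.card_biUnion_le_card_mul _ _
    ((2 * n * q ^ a) ^ 12) ?_)
  · have hz : ((Finset.Icc 1 n ×ˢ Finset.Icc 1 n).filter fun z : ℕ × ℕ => z.2 ≤ z.1 ∧
        ¬ (stdPar a n d S 0).Pal z.1 z.2).card ≤ n * n := by
      refine (Finset.card_filter_le _ _).trans ?_
      simp
    calc 2 * n * _ ≤ 2 * n * (n * n * (2 * n * q ^ a) ^ 12) :=
          Nat.mul_le_mul_left _ (hcard.trans (Nat.mul_le_mul_right _ hz))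
      _ = 2 * n ^ 3 * (2 * n) ^ 12 * (q ^ a) ^ 12 := by ring
      _ ≤ q ^ 12 * (q ^ a) ^ 12 := Nat.mul_le_mul_right _ (prm_sq_bound n hn).2
      _ = q ^ (12 * (a + 1)) := by ring
  · intro z hz
    simp only [Finset.mem_filter, Finset.mem_product, Finset.mem_Icc] at hz
    exact card_not_pal_le (π := stdPar a n d S 0) (p := prm n) (g := nonres n) rfl rfl (L := a + 1)
      (t := 12) rfl rfl (stdPar_T_lt hn hS) hz.2.1 hz.1.1.2 hz.2.2

/-- A residue is hit by at most `W / M + 1` words, and `M * (W / M + 1) ≤ 2 * W`. The bias of the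
reduction thus costs at most a factor of two. -/
lemma card_mod_mem_le {M W : ℕ} (hM : 0 < M) (hMW : M ≤ W) (P : ℕ → Prop) [DecidablePred P] :
    M * ((Finset.univ : Finset (Fin W)).filter fun w => P (w.val % M)).card
      ≤ 2 * W * ((Finset.range M).filter P).card := by
  have h1 : ((Finset.univ : Finset (Fin W)).filter fun w => P (w.val % M)).card
      ≤ (((Finset.range M).filter P) ×ˢ Finset.range (W / M + 1)).card := by
    refine Finset.card_le_card_of_injOn (fun w => (w.val % M, w.val / M)) ?_ ?_
    · intro w hw
      simp only [Finset.coe_filter, Set.mem_ofPred_eq, Finset.mem_univ, true_and] at hw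
      simp only [Finset.coe_product, Set.mem_prod, Finset.coe_filter, Finset.mem_range,
        Set.mem_ofPred_eq, Finset.coe_range, Set.mem_Iio]
      exact ⟨⟨Nat.mod_lt _ hM, hw⟩, Nat.lt_succ_of_le (Nat.div_le_div_right w.isLt.le)⟩
    · intro w _ w' _ h
      simp only [Prod.mk.injEq] at h
      ext
      rw [← Nat.div_add_mod w.val M, ← Nat.div_add_mod w'.val M, h.1, h.2]
  rw [Finset.card_product, Finset.card_range] at h1
  calc M * _ ≤ M * (((Finset.range M).filter P).card * (W / M + 1)) := Nat.mul_le_mul_left _ h1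
    _ = ((Finset.range M).filter P).card * (M * (W / M) + M) := by ring
    _ ≤ ((Finset.range M).filter P).card * (W + W) := by
        gcongr
        exact Nat.mul_div_le W M
    _ = _ := by ring

lemma coinMeasure_real_ge {k n : ℕ} (hn : 1 ≤ n) (P : ℕ → Prop) [DecidablePred P]
    (hP : n * ((Finset.univ : Finset (Fin (numWords k n))).filter fun w => ¬ P w.val).card
      ≤ numWords k n) :
    1 - 1 / (n : ℝ) ≤ (coinMeasure k n).real {ω | P (ω 0).val} := by
  have hW : 0 < numWords k n := Nat.pow_pos Nat.two_pos
  have hset : {ω : Coins k n | P (ω 0).val} = (fun ω => ω 0) ⁻¹' {w : Fin (numWords k n) | P w.val} :=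
    rfl
  have hmap : (coinMeasure k n).map (fun ω => ω 0)
      = (PMF.uniformOfFintype (Fin (numWords k n))).toMeasure :=
    MeasureTheory.Measure.infinitePi_map_eval _ 0
  rw [hset, ← MeasureTheory.map_measureReal_apply (by fun_prop) (MeasurableSet.of_discrete), hmap,
    MeasureTheory.measureReal_def, PMF.toMeasure_uniformOfFintype_apply _ MeasurableSet.of_discrete]
  have hsum := Finset.card_filter_add_card_filter_not (s := (Finset.univ : Finset (Fin (numWords k n))))
    (fun w => P w.val)
  rw [Finset.card_univ, Fintype.card_fin] at hsum
  have e1 : Fintype.card {w : Fin (numWords k n) | P w.val}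
      = ((Finset.univ : Finset (Fin (numWords k n))).filter fun w => P w.val).card := by
    rw [← Set.toFinset_card]
    congr 1
    ext
    simp
  rw [e1, Fintype.card_fin, ENNReal.toReal_div, ENNReal.toReal_natCast, ENNReal.toReal_natCast]
  have hW' : (0 : ℝ) < numWords k n := by exact_mod_cast hW
  have hn' : (0 : ℝ) < n := by exact_mod_cast hn
  generalize ((Finset.univ : Finset (Fin (numWords k n))).filter fun w => P w.val).card = x at *
  generalize ((Finset.univ : Finset (Fin (numWords k n))).filter fun w => ¬ P w.val).card = y at *
  have h1 : (x : ℝ) + y = numWords k n := by exact_mod_cast hsum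
  have h2 : (n : ℝ) * y ≤ numWords k n := by exact_mod_cast hP
  rw [le_div_iff₀ hW', sub_mul, one_mul, div_mul_eq_mul_div, one_mul, ← h1]
  have : (y : ℝ) ≤ (x + y) / n := by
    rw [le_div_iff₀ hn', h1]
    linarith
  linarith

end PalStream

/-! ### Transfer to the original stream, resource bounds in real numbers, and the theorem. -/

namespace PalStream

/-! ### Accurate estimates and palindromes of the stream -/

lemma stdPar_pal_iff_isPalindromeAt {a n d : ℕ} {S : List ℕ} {r m x : ℕ} (hS : S.length = n)
    (hm : 1 ≤ m) (hmn : m ≤ n) : (stdPar a n d S r).Pal m x ↔ IsPalindromeAt S m x := by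
  have hT : ∀ j, 1 ≤ j → j ≤ n → (stdPar a n d S r).T j = symbol S j + 1 :=
    fun j h1 h2 => if_pos ⟨h1, h2⟩
  constructor
  · intro h
    have hmx : m + x ≤ n := h.add_le hmn
    refine ⟨h.1, by omega, fun i h1 h2 => ?_⟩
    have h3 := h.1
    have := h.2 i h1 h2
    rw [hT _ (by omega) (by omega), hT _ (by omega) (by omega)] at this
    rw [show m - i + 1 = m + 1 - i by omega]
    omega
  · rintro ⟨h1, h2, h3⟩
    refine ⟨h1, fun i h4 h5 => ?_⟩
    rw [hT _ (by omega) (by omega), hT _ (by omega) (by omega),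
      show m + 1 - i = m - i + 1 by omega, h3 i h4 h5]

lemma Par.Acc.palLength {a n d : ℕ} {S : List ℕ} {r : ℕ} {q : ℕ × ℕ} (hS : S.length = n)
    (hm : 1 ≤ q.1) (hmn : q.1 ≤ n) (h : Par.Acc (stdPar a n d S r) q) :
    q.2 ≤ PalStream.palLength S q.1 ∧ PalStream.palLength S q.1 < q.2 + d := by
  have hb : BddAbove {l | IsPalindromeAt S q.1 l} := ⟨q.1, fun l hl => hl.1⟩
  refine ⟨le_csSup hb ((stdPar_pal_iff_isPalindromeAt hS hm hmn).1 h.1), ?_⟩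
  by_contra hcon
  have hmem : IsPalindromeAt S q.1 (PalStream.palLength S q.1) :=
    Nat.sSup_mem (s := {l | IsPalindromeAt S q.1 l}) ⟨0, Nat.zero_le _, by omega, fun i h1 h2 => by omega⟩ hb
  exact h.2 (((stdPar_pal_iff_isPalindromeAt hS hm hmn).2 hmem).mono (not_lt.1 hcon))

/-! ### The machine -/

/-- Exponent of the bound for words in use. -/
def wordExp (a : ℕ) : ℕ := 130 * (a + 1)

/-- Bound for the memory in use. -/
def memBound (n d : ℕ) : ℕ := 42 * n.sqrt + 100 + 7 * ((n + 3 * n.sqrt + 2) / d)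

lemma lt_two_pow_size (n : ℕ) : n < 2 ^ Nat.size n := Nat.lt_size_self n

lemma prm_le (n : ℕ) (hn : 1 ≤ n) : prm n ≤ 16 * n := by
  obtain ⟨-, -, h⟩ := prm_spec n hn
  refine h.trans ?_
  have h1 := (sqrt_bounds n).1
  have h2 : n.sqrt.sqrt.sqrt ≤ n.sqrt := (Nat.sqrt_le_self _).trans (Nat.sqrt_le_self _)
  have h3 : n.sqrt ≤ n := Nat.sqrt_le_self n
  calc 2 * halfSize n = 4 * ((n.sqrt + 1) * (n.sqrt.sqrt.sqrt + 1)) := by unfold halfSize; ring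
    _ ≤ 4 * ((n.sqrt + 1) * (n.sqrt + 1)) := by gcongr
    _ ≤ 16 * n := by nlinarith

/-- Bounds for the words in use. -/
lemma word_bounds (a n : ℕ) (hn : 1 ≤ n) {B : ℕ} (hB : B = (2 ^ Nat.size n) ^ wordExp a) :
    101 ≤ B ∧ (prm n * prm n) ^ (12 * (a + 1) + 1) < B ∧ 100 * (n + 1) ≤ B ∧ 12 * (a + 1) < B := by
  have hb := lt_two_pow_size n
  have hp := prm_le n hn
  set b := 2 ^ Nat.size n with hbd
  have hb2 : 2 ≤ b := by omega
  have hmono : ∀ {i j : ℕ}, i ≤ j → b ^ i ≤ b ^ j := fun h => Nat.pow_le_pow_right (by omega) h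
  have h2pow : ∀ i, 2 ^ i ≤ b ^ i := fun i => Nat.pow_le_pow_left hb2 i
  subst hB
  unfold wordExp
  refine ⟨?_, ?_, ?_, ?_⟩
  · calc 101 ≤ 2 ^ 7 := by norm_num
      _ ≤ b ^ 7 := h2pow 7
      _ ≤ _ := hmono (by omega)
  · have hpb : prm n * prm n < b ^ 10 := by
      have h1 : prm n < b ^ 5 := by
        calc prm n ≤ 16 * n := hp
          _ < 16 * b := by omega
          _ ≤ b ^ 4 * b := Nat.mul_le_mul_right _ (h2pow 4)
          _ = b ^ 5 := by ring
      calc prm n * prm n < b ^ 5 * b ^ 5 := Nat.mul_lt_mul'' h1 h1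
        _ = b ^ 10 := by ring
    calc (prm n * prm n) ^ (12 * (a + 1) + 1) < (b ^ 10) ^ (12 * (a + 1) + 1) :=
          Nat.pow_lt_pow_left hpb (by omega)
      _ = b ^ (10 * (12 * (a + 1) + 1)) := (pow_mul _ _ _).symm
      _ ≤ _ := hmono (by omega)
  · calc 100 * (n + 1) ≤ 2 ^ 7 * b := Nat.mul_le_mul (by norm_num) hb
      _ ≤ b ^ 7 * b := Nat.mul_le_mul_right _ (h2pow 7)
      _ = b ^ 8 := by ring
      _ ≤ _ := hmono (by omega)
  · calc 12 * (a + 1) < 2 ^ (12 * (a + 1)) := Nat.lt_two_pow_self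
      _ ≤ b ^ (12 * (a + 1)) := h2pow _
      _ ≤ _ := hmono (by omega)

lemma stdPar_valid {a n d r : ℕ} {S : List ℕ} {Γ : Env} (hn : 1 ≤ n) (hd : 1 ≤ d)
    (hds : d ≤ n.sqrt) (hS : ∀ x ∈ S, x ≤ (n + 1) ^ a) (hΓS : Γ.S = S)
    (hΓB : Γ.B = (2 ^ Nat.size n) ^ wordExp a) (hΓA : Γ.A = memBound n d)
    (hr : r < (prm n * prm n) ^ (12 * (a + 1))) : (stdPar a n d S r).Valid Γ := by
  obtain ⟨hB1, hB2, hB3, hB4⟩ := word_bounds a n hn hΓB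
  have hp := (prm_spec n hn).1.pos
  have hpp : 0 < prm n * prm n := Nat.mul_pos hp hp
  refine ⟨hn, hd, hds, (sqrt_bounds n).1, hp, hr, fun j => ?_, hB2, hB3, hB4,
    hΓS, fun j => ?_, ?_, fun c hc => ?_, fun c hc => ?_⟩
  · change (stdPar a n d S r).T j * Par.rep ((prm n * prm n) ^ (a + 1)) 12
      < (prm n * prm n) ^ (12 * (a + 1))
    rw [mul_comm 12, pow_mul]
    exact Par.mul_rep_lt (stdPar_T_lt hn hS j) 12
  · have h1 := symbol_le hS j
    have h2 := symbol_bound (a := a) hn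
    have h3 : (prm n * prm n) ^ (a + 1) ≤ (prm n * prm n) ^ (12 * (a + 1) + 1) :=
      Nat.pow_le_pow_right hpp (by omega)
    change symbol S j + 1 < _
    omega
  · change 7 * (4 * n.sqrt + 4) + 7 ≤ _
    rw [hΓA, memBound]
    omega
  · change c * d ≤ n + 3 * n.sqrt + 2 at hc
    have := (Nat.le_div_iff_mul_le (by omega)).2 hc
    rw [hΓA, memBound]
    omega
  · change c * (n.sqrt / 2 + 1) ≤ n + n.sqrt / 2 + 2 at hc
    have := le_of_mul_half_sqrt_le hc
    rw [hΓA, memBound]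
    omega

/-- As `d ≥ 1`, rounding down loses at most half: `ε * √n < d + 1 ≤ 2 * d`. -/
lemma real_bounds {n d : ℕ} {ε : ℝ} (hn : 1 ≤ n) (hd1 : 1 ≤ d) (hε0 : 0 < ε) (hε : ε ≤ 1)
    (hd : ε * √n < d + 1) : (n : ℝ) / d ≤ 2 * (√n / ε) ∧ (n.sqrt : ℝ) ≤ √n ∧ 1 ≤ √n / ε ∧
      √n ≤ √n / ε := by
  have hn' : (1 : ℝ) ≤ n := by exact_mod_cast hn
  have hd' : (1 : ℝ) ≤ d := by exact_mod_cast hd1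
  have hs1 : 1 ≤ √(n : ℝ) := Real.one_le_sqrt.2 hn'
  have hsq : √(n : ℝ) * √n = n := Real.mul_self_sqrt (by positivity)
  have h4 : √(n : ℝ) ≤ √n / ε := by
    rw [le_div_iff₀ hε0]
    nlinarith
  refine ⟨?_, Real.nat_sqrt_le_real_sqrt, hs1.trans h4, h4⟩
  rw [← mul_div_assoc, div_le_div_iff₀ (by positivity) hε0]
  nlinarith

lemma memBound_le {n d : ℕ} {ε : ℝ} (hn : 1 ≤ n) (hd1 : 1 ≤ d) (hε0 : 0 < ε) (hε : ε ≤ 1)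
    (hd : ε * √n < d + 1) : ((40 + memBound n d : ℕ) : ℝ) ≤ 300 * (√n / ε) := by
  obtain ⟨h1, h2, h3, h4⟩ := real_bounds hn hd1 hε0 hε hd
  have h5 : n.sqrt ≤ n := Nat.sqrt_le_self n
  have h6 : (((n + 3 * n.sqrt + 2) / d : ℕ) : ℝ) ≤ 6 * (n / d) := by
    refine Nat.cast_div_le.trans ?_
    rw [← mul_div_assoc]
    gcongr
    exact_mod_cast (show n + 3 * n.sqrt + 2 ≤ 6 * n by omega)
  unfold memBound
  push_cast
  linarith

/-- Beyond linear terms there are two products of order √n · (n / d): the arms tested at each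
midpoint, and the updates of the single midpoints. -/
lemma ticks_le {n d a k : ℕ} {ε : ℝ} (hn : 1 ≤ n) (hd1 : 1 ≤ d) (hε0 : 0 < ε) (hε : ε ≤ 1)
    (hd : ε * √n < d + 1) :
    ((3 * a + 2500 * n + 101 + (8 * k + 15) * (2 * (2 * n.sqrt / d) + 20) *
        (n + 2 * n.sqrt + n.sqrt / 2 + 2) + 2 * (8 * k + 15) * n +
        4 * (8 * k + 15) * (2 * n.sqrt + 5) * ((n + 2 * n.sqrt + n.sqrt / 2 + 1) / d) : ℕ) : ℝ)
      ≤ (3 * a + 2601 + 600 * (8 * k + 15)) * (n / ε) := by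
  obtain ⟨h1, h2, h3, h4⟩ := real_bounds hn hd1 hε0 hε hd
  have h5 : n.sqrt ≤ n := Nat.sqrt_le_self n
  have hn' : (1 : ℝ) ≤ n := by exact_mod_cast hn
  have hs1 : 1 ≤ √(n : ℝ) := Real.one_le_sqrt.2 hn'
  have hsq : √(n : ℝ) * √n = n := Real.mul_self_sqrt (by positivity)
  have hY : (n : ℝ) / ε = √n * (√n / ε) := by rw [← mul_div_assoc, hsq]
  have hnY : (n : ℝ) ≤ n / ε := by rw [le_div_iff₀ hε0]; nlinarith
  have e1 : ((n + 2 * n.sqrt + n.sqrt / 2 + 2 : ℕ) : ℝ) ≤ 6 * n := by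
    exact_mod_cast (show n + 2 * n.sqrt + n.sqrt / 2 + 2 ≤ 6 * n by omega)
  have e2 : (((n + 2 * n.sqrt + n.sqrt / 2 + 1) / d : ℕ) : ℝ) ≤ 6 * (n / d) := by
    refine Nat.cast_div_le.trans ?_
    rw [← mul_div_assoc]
    gcongr
    exact_mod_cast (show n + 2 * n.sqrt + n.sqrt / 2 + 1 ≤ 6 * n by omega)
  have e3 : ((2 * n.sqrt / d : ℕ) : ℝ) ≤ 2 * √n / d := by
    refine Nat.cast_div_le.trans ?_
    push_cast
    gcongr
  have f1 : ((2 * (2 * n.sqrt / d) + 20 : ℕ) : ℝ) * ((n + 2 * n.sqrt + n.sqrt / 2 + 2 : ℕ) : ℝ)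
      ≤ 168 * (n / ε) := by
    calc ((2 * (2 * n.sqrt / d) + 20 : ℕ) : ℝ) * ((n + 2 * n.sqrt + n.sqrt / 2 + 2 : ℕ) : ℝ)
        ≤ (2 * (2 * √n / d) + 20) * (6 * n) := by
          refine mul_le_mul ?_ e1 (by positivity) (by positivity)
          push_cast
          linarith
      _ = 24 * (√n * (n / d)) + 120 * n := by ring
      _ ≤ 24 * (√n * (2 * (√n / ε))) + 120 * (n / ε) := by gcongr
      _ = 168 * (n / ε) := by rw [hY]; ring
  have f2 : ((2 * n.sqrt + 5 : ℕ) : ℝ) * (((n + 2 * n.sqrt + n.sqrt / 2 + 1) / d : ℕ) : ℝ)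
      ≤ 84 * (n / ε) := by
    calc ((2 * n.sqrt + 5 : ℕ) : ℝ) * (((n + 2 * n.sqrt + n.sqrt / 2 + 1) / d : ℕ) : ℝ)
        ≤ (7 * √n) * (6 * (n / d)) := by
          refine mul_le_mul ?_ e2 (by positivity) (by positivity)
          push_cast
          linarith
      _ ≤ (7 * √n) * (6 * (2 * (√n / ε))) := by gcongr
      _ = 84 * (n / ε) := by rw [hY]; ring
  have hU : (0 : ℝ) ≤ 8 * k + 15 := by positivity
  have g1 := mul_le_mul_of_nonneg_left f1 hU
  have g2 := mul_le_mul_of_nonneg_left f2 hU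
  have g3 := mul_le_mul_of_nonneg_left hnY hU
  have g4 : (3 * a + 101 : ℝ) ≤ (3 * a + 101) * (n / ε) :=
    le_mul_of_one_le_right (by positivity) (hn'.trans hnY)
  push_cast at g1 g2 ⊢
  nlinarith

open Classical in
lemma good_probability {a n d : ℕ} {S : List ℕ} (hn : 1 ≤ n) (hS : ∀ x ∈ S, x ≤ (n + 1) ^ a) :
    1 - 1 / (n : ℝ) ≤ (coinMeasure (wordExp a * 24) n).real
      {ω | (stdPar a n d S ((ω 0).val % (prm n * prm n) ^ (12 * (a + 1)))).Good} := by
  have hp := (prm_spec n hn).1.pos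
  have hpp : 0 < prm n * prm n := Nat.mul_pos hp hp
  have hM : 0 < (prm n * prm n) ^ (12 * (a + 1)) := Nat.pow_pos hpp
  obtain ⟨-, hB2, -⟩ := word_bounds a n hn rfl
  have hMW : (prm n * prm n) ^ (12 * (a + 1)) ≤ numWords (wordExp a * 24) n := by
    refine le_trans (Nat.pow_le_pow_right hpp (Nat.le_succ _)) (hB2.le.trans ?_)
    rw [numWords, ← pow_mul]
    refine Nat.pow_le_pow_right (by norm_num) ?_
    rw [mul_comm]
    exact Nat.mul_le_mul_right _ (by omega)
  refine coinMeasure_real_ge hn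
    (fun w => (stdPar a n d S (w % (prm n * prm n) ^ (12 * (a + 1)))).Good) ?_
  have h1 := card_mod_mem_le hM hMW (fun r => ¬ (stdPar a n d S r).Good)
  have h2 := card_not_good_le (d := d) hn hS
  generalize (prm n * prm n) ^ (12 * (a + 1)) = M at *
  refine Nat.le_of_mul_le_mul_left ?_ hM
  calc M * (n * _) = n * (M * _) := by ring
    _ ≤ n * (2 * numWords (wordExp a * 24) n * _) := Nat.mul_le_mul_left _ h1
    _ = numWords (wordExp a * 24) n * (2 * n * _) := by ring
    _ ≤ numWords (wordExp a * 24) n * M := Nat.mul_le_mul_left _ h2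
    _ = M * numWords (wordExp a * 24) n := mul_comm _ _

/-- Correctness and resource bounds of the program for one sequence of random words. -/
lemma programCmd_run {a n d : ℕ} {S : List ℕ} (hn : 1 ≤ n) (hd : 1 ≤ d) (hds : d ≤ n.sqrt)
    (hS : ∀ x ∈ S, x ≤ (n + 1) ^ a) (ω : ℕ → ℕ) :
    ∃ (t u : ℕ) (s : State 40),
      Exec (numWords (wordExp a * 24) n) S ω (programCmd a) (State.init 40 n d) t s ∧
      t ≤ 50 * u ∧
      u ≤ 3 * a + 2500 * n + 101 + (8 * (12 * (a + 1)) + 15) * (2 * (2 * n.sqrt / d) + 20) *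
        (n + 2 * n.sqrt + n.sqrt / 2 + 2) + 2 * (8 * (12 * (a + 1)) + 15) * n +
        4 * (8 * (12 * (a + 1)) + 15) * (2 * n.sqrt + 5) *
          ((n + 2 * n.sqrt + n.sqrt / 2 + 1) / d) ∧
      s.space ≤ 40 + memBound n d ∧ (s.out.map Prod.fst).Perm (List.range' 1 n) ∧
      ((stdPar a n d S (ω 0 % (prm n * prm n) ^ (12 * (a + 1)))).Good →
        ∀ q ∈ s.out, Par.Acc (stdPar a n d S (ω 0 % (prm n * prm n) ^ (12 * (a + 1)))) q) := by
  obtain ⟨hB1, hB2, hB3, hB4⟩ := word_bounds a n hn rfl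
  have hp := (prm_spec n hn).1.pos
  have hM : 0 < (prm n * prm n) ^ (12 * (a + 1)) := Nat.pow_pos (Nat.mul_pos hp hp)
  have hdn : d ≤ n := hds.trans (Nat.sqrt_le_self n)
  -- The number of words is exactly the 24th power of the bound for the words in use, the room that
  -- expressions with 24 leaves require.
  have hpar := programCmd_spec (Γ := ⟨numWords (wordExp a * 24) n, S, ω,
    (2 ^ Nat.size n) ^ wordExp a, memBound n d, hB1, by
      rw [← pow_mul, ← pow_mul, numWords]
      exact le_of_eq (by ring)⟩) rfl
    (stdPar_valid hn hd hds hS rfl rfl rfl (Nat.mod_lt _ hM)) (s := State.init 40 n d)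
    rfl rfl (fun _ => rfl) rfl rfl rfl
  have hreg : ∀ y, (State.init 40 n d).reg y < (2 ^ Nat.size n) ^ wordExp a := by
    intro y
    simp only [State.init]
    split_ifs <;> omega
  obtain ⟨t, s, u, h1, h2, -, h3, h4, h5, h6⟩ :=
    hpar ⟨hreg, fun _ => lt_of_lt_of_le (Nat.succ_pos 100) hB1, Nat.zero_le _⟩
  exact ⟨t, u, s, h1, h3, h6, Nat.add_le_add_left h2.cells _, h4, h5⟩

end PalStream

theorem theorem1 (a : ℕ) :
    ∃ (r k : ℕ) (P : PalStream.Cmd r) (C : ℝ), 0 < k ∧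
      ∀ (n : ℕ) (ε : ℝ) (S : List ℕ),
        1 ≤ n → 1 / Real.sqrt n ≤ ε → ε ≤ 1 →
        S.length = n → (∀ x ∈ S, x ≤ (n + 1) ^ a) →
        ∃ (time : PalStream.Coins k n → ℕ) (final : PalStream.Coins k n → PalStream.State r),
          (∀ ω : PalStream.Coins k n,
            PalStream.Exec (PalStream.numWords k n) S (fun i => (ω i : ℕ)) P
              (PalStream.State.init r n ⌊ε * Real.sqrt n⌋₊) (time ω) (final ω)) ∧
          (∀ ω, (time ω : ℝ) ≤ C * (n / ε)) ∧
          (∀ ω, ((final ω).space : ℝ) ≤ C * (Real.sqrt n / ε)) ∧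
          (∀ ω, ((final ω).out.map Prod.fst).Perm (List.range' 1 n)) ∧
          1 - 1 / (n : ℝ) ≤ (PalStream.coinMeasure k n).real
            {ω | ∀ q ∈ (final ω).out,
              (PalStream.palLength S q.1 : ℝ) - ε * Real.sqrt n < (q.2 : ℝ) ∧
                q.2 ≤ PalStream.palLength S q.1} := by
  refine ⟨40, PalStream.wordExp a * 24, PalStream.programCmd a,
    -- One constant for both bounds: 50 steps per tick for the time, and 300 for the space.
    50 * (3 * a + 2601 + 600 * (8 * (12 * (a + 1) : ℕ) + 15)) + 300,
    Nat.mul_pos (Nat.mul_pos (by norm_num) (Nat.succ_pos a)) (by norm_num), ?_⟩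
  intro n ε S hn hε1 hε2 hlen hS
  have hn' : (1 : ℝ) ≤ n := by exact_mod_cast hn
  have hs1 : 1 ≤ √(n : ℝ) := Real.one_le_sqrt.2 hn'
  have hε0 : 0 < ε := lt_of_lt_of_le (by positivity) hε1
  have hεn : 1 ≤ ε * √n := by rwa [div_le_iff₀ (by positivity)] at hε1
  set d := ⌊ε * √(n : ℝ)⌋₊ with hd
  have hd1 : 1 ≤ d := Nat.le_floor (by exact_mod_cast hεn)
  have hdle : (d : ℝ) ≤ ε * √n := Nat.floor_le (by positivity)
  have hdlt : ε * √n < d + 1 := Nat.lt_floor_add_one _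
  have hds : d ≤ n.sqrt := by
    rw [Nat.le_sqrt]
    have h1 : (d : ℝ) ≤ √n := hdle.trans (mul_le_of_le_one_left (by positivity) hε2)
    have h2 : (d : ℝ) * d ≤ √n * √n := mul_self_le_mul_self (by positivity) h1
    rw [Real.mul_self_sqrt (by positivity)] at h2
    exact_mod_cast h2
  choose time ticks final h1 h2 h3 h4 h5 h6 using
    fun ω : PalStream.Coins (PalStream.wordExp a * 24) n => PalStream.programCmd_run hn hd1 hds hS (fun i => (ω i : ℕ))
  refine ⟨time, final, h1, fun ω => ?_, fun ω => ?_, h5, ?_⟩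
  · have k1 : (time ω : ℝ) ≤ 50 * ticks ω := by exact_mod_cast h2 ω
    have k2 : (ticks ω : ℝ) ≤ _ := le_trans (Nat.cast_le.2 (h3 ω))
      (PalStream.ticks_le (a := a) (k := 12 * (a + 1)) hn hd1 hε0 hε2 hdlt)
    have k3 : 0 ≤ (n : ℝ) / ε := by positivity
    linarith
  · have k1 : ((final ω).space : ℝ) ≤ _ := le_trans (Nat.cast_le.2 (h4 ω))
      (PalStream.memBound_le hn hd1 hε0 hε2 hdlt)
    refine k1.trans ?_
    gcongr
    exact le_add_of_nonneg_left (by positivity)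
  · refine (PalStream.good_probability (d := d) hn hS).trans ?_
    have : MeasureTheory.IsProbabilityMeasure (PalStream.coinMeasure (PalStream.wordExp a * 24) n) := by
      unfold PalStream.coinMeasure
      infer_instance
    refine MeasureTheory.measureReal_mono fun ω hω q hq => ?_
    have hmem : q.1 ∈ List.range' 1 n := (h5 ω).mem_iff.1 (List.mem_map_of_mem hq)
    rw [List.mem_range'_1] at hmem
    obtain ⟨k1, k2⟩ := (h6 ω hω q hq).palLength hlen hmem.1 (by omega)
    refine ⟨?_, k1⟩
    -- The strict inequality between integers gains 1, so the claim stays strict after replacing `d`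
    -- by `ε * √n ≥ d`.
    have k3 : (PalStream.palLength S q.1 : ℝ) + 1 ≤ q.2 + d := by exact_mod_cast k2
    linarith
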